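/- Let $d_1,d_2\ge 1$, $d=d_1+d_2$, let $q\in L^2[0,1]$ be real-valued, $g\in\mathbb R\setminus\{0\}$, $\omega\in\mathbb R^{d_2}$ and $\varphi\in\mathbb R$. Write $\mathbf m=(\mathbf m_1,\mathbf m_2)\in\mathbb Z^{d_1}\times\mathbb Z^{d_2}=\mathbb Z^d$ and let $\mathbf h_1,\dots,\mathbf h_d$ be the standard basis of $\mathbb Z^d$. Assume that $\varphi-\omega\cdot m\notin\frac12\mathbb Z$ for all $m\in\mathbb Z^{d_2}$, and that $\omega$ is Diophantine: there are $C,\beta>0$ with $|\omega\cdot m-r|\ge C|m|^{-\beta}$ for all $m\in\mathbb Z^{d_2}\setminus\{0\}$, $r\in\mathbb Z$. For $\alpha:\mathbb Z^d\to\mathbb R$ let $H_\alpha$ be the operator $(f_{\mathbf m,j})\mapsto(-f_{\mathbf m,j}''+qf_{\mathbf m,j})$ in $\bigoplus_{(\mathbf m,j)\in\mathbb Z^d\times\{1,\dots,d\}}L^2[0,1]$, defined on those $f\in\bigoplus H^2[0,1]$ that satisfy $f_{\mathbf m,j}(0)=f_{\mathbf m-\mathbf h_k,k}(1)=:f(\mathbf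 m)$ for all $\mathbf m,j,k$ and $\sum_j f_{\mathbf m,j}'(0)-\sum_j f_{\mathbf m-\mathbf h_j,j}'(1)=\alpha(\mathbf m)f(\mathbf m)$ for all $\mathbf m$. Let $H_0$ be this operator for $\alpha\equiv0$, and $H$ the operator for the surface coupling $\alpha(\mathbf m)=g\tan\pi(\omega\cdot\mathbf m_2+\varphi)$ if $\mathbf m_1=0$ and $\alpha(\mathbf m)=0$ if $\mathbf m_1\neq0$. For real $\lambda$ let $s(\cdot;\lambda),c(\cdot;\lambda)$ be the solutions of $-y''+qy=\lambda y$ on $[0,1]$ with $s(0)=c'(0)=0$, $s'(0)=c(0)=1$, and $\eta(\lambda)=c(1;\lambda)+s'(1;\lambda)$. For $\theta$ in the torus $\mathbb T^n=\{|\theta_j|=1\}$ put $\Delta_n(\theta)=\sum_{j=1}^n(\theta_j+\theta_j^{-1})$, and for $\theta\in\mathbb T^{d_2}$ $$N(\theta,\lambda)=-s(1;\lambda)\int_{\mathbb T^{d_1}}\frac{d\theta_1}{\Delta_{d_1}(\theta_1)+\Delta_{d_2}(\theta)-d\,\eta(\lambda)},$$ where $d\theta_1$ is the normalized Haar measure.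 Put $$g'=\frac1{|g|},\qquad \omega'=\operatorname{sgn}(g)\,\omega,\qquad \varphi'=\operatorname{sgn}(g)\,\varphi+\tfrac12,$$ so that $-1/\big(g\tan\pi(\omega\cdot m+\varphi)\big)=g'\tan\pi(\omega'\cdot m+\varphi')$ for $m\in\mathbb Z^{d_2}$, and let $$\sigma(\lambda)=\int_{\mathbb T^{d_2}}\arctan\frac{N(\theta,\lambda)}{g'}\,d\theta$$ (again with normalized Haar measure). Let $a<b$ with $[a,b]\cap\operatorname{spec}H_0=\emptyset$. Then: 1. $\sigma$ is strictly increasing on $[a,b]$. 2. The set of eigenvalues of $H$ in $[a,b]$ is dense in $[a,b]$ and coincides with the set of those $\lambda\in[a,b]$ that satisfy $$\sigma(\lambda)=\pi(\omega'\cdot m+\varphi')\mod\pi\qquad(*)$$ for some $m\in\mathbb Z^{d_2}$. 3. Each of these eigenvalues is simple. 4. For every fixed $m\in\mathbb Z^{d_2}$, $(*)$ has at most one solution $\lambda(m)\in[a,b]$, and $\lambda(m)\ne\lambda(m')$ whenever $m\ne m'$ and both exist. -/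

import Mathlib

open MeasureTheory Set

noncomputable section

namespace MarylandGraph

/-! ### Unbounded operators: resolvent set, spectrum, eigenspaces -/

section Operators

variable {E : Type*} [NormedAddCommGroup E] [NormedSpace ℂ E]

/-- `z` belongs to the resolvent set of the (unbounded) operator `T` when `T - z` maps the domain
of `T` bijectively onto the whole space and the inverse is bounded. -/
def opResolventSet (T : E →ₗ.[ℂ] E) : Set ℂ :=
  {z | ∃ R : E →L[ℂ] E,
    (∀ f : E, ∃ h : R f ∈ T.domain, T ⟨R f, h⟩ - z • R f = f) ∧
    (∀ f : T.domain, R (T f - z • (f : E)) = f)}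

/-- The spectrum of an unbounded operator. -/
def opSpectrum (T : E →ₗ.[ℂ] E) : Set ℂ := (opResolventSet T)ᶜ

/-- The eigenspace `ker (T - z)` of an unbounded operator. -/
def opEigenspace (T : E →ₗ.[ℂ] E) (z : ℂ) : Submodule ℂ E :=
  (LinearMap.ker (T.toFun - z • T.domain.subtype)).map T.domain.subtype

/-- The real eigenvalues of an unbounded operator. -/
def realEigenvalues (T : E →ₗ.[ℂ] E) : Set ℝ := {lam | opEigenspace T (lam : ℂ) ≠ ⊥}

end Operators

/-! ### The edge space and the Sobolev space `H²[0,1]` -/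

/-- The space `L²[0,1]` of complex-valued functions. -/
abbrev L2 : Type := Lp ℂ 2 (volume.restrict (Icc (0 : ℝ) 1))

/-- `f ∈ L²[0,1]` belongs to `H²[0,1]`, with first and second derivatives `f₁, f₂ ∈ L²[0,1]`;
`u` and `v` are, on `[0,1]`, the absolutely continuous representatives of `f` and of `f' = f₁`,
so that the boundary values of `f` and `f'` are those of `u` and `v`. -/
structure IsH2 (f f₁ f₂ : L2) (u v : ℝ → ℂ) : Prop where
  ae_fst : f =ᵐ[volume.restrict (Icc (0 : ℝ) 1)] u
  ae_snd : f₁ =ᵐ[volume.restrict (Icc (0 : ℝ) 1)] v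
  fst_eq : ∀ x ∈ Icc (0 : ℝ) 1, u x = u 0 + ∫ t in (0 : ℝ)..x, v t
  snd_eq : ∀ x ∈ Icc (0 : ℝ) 1, v x = v 0 + ∫ t in (0 : ℝ)..x, f₂ t

theorem intervalIntegrable_of_ae {F : L2} {w : ℝ → ℂ}
    (h : F =ᵐ[volume.restrict (Icc (0 : ℝ) 1)] w) {x : ℝ} (hx : x ∈ Icc (0 : ℝ) 1) :
    IntervalIntegrable w volume 0 x := by
  have h1 : IntegrableOn w (Icc (0 : ℝ) 1) volume :=
    (((Lp.memLp F).integrable (by norm_num))).congr h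
  rw [intervalIntegrable_iff_integrableOn_Ioc_of_le hx.1]
  exact h1.mono_set (fun t ht => ⟨ht.1.le, ht.2.trans hx.2⟩)

theorem integral_congr_of_ae {w w' : ℝ → ℂ}
    (h : w =ᵐ[volume.restrict (Icc (0 : ℝ) 1)] w') {x : ℝ} (hx : x ∈ Icc (0 : ℝ) 1) :
    ∫ t in (0 : ℝ)..x, w t = ∫ t in (0 : ℝ)..x, w' t := by
  rw [intervalIntegral.integral_of_le hx.1, intervalIntegral.integral_of_le hx.1]
  have hsub : Ioc 0 x ⊆ Icc (0 : ℝ) 1 := fun t ht => ⟨ht.1.le, ht.2.trans hx.2⟩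
  exact integral_congr_ae (ae_restrict_of_ae_restrict_of_subset hsub h)

theorem IsH2.zero : IsH2 0 0 0 0 0 where
  ae_fst := Lp.coeFn_zero _ _ _
  ae_snd := Lp.coeFn_zero _ _ _
  fst_eq := by simp
  snd_eq := by
    intro x hx
    rw [integral_congr_of_ae (Lp.coeFn_zero ℂ 2 _) hx]
    simp

theorem IsH2.add {f f₁ f₂ g g₁ g₂ : L2} {u v u' v' : ℝ → ℂ} (hf : IsH2 f f₁ f₂ u v)
    (hg : IsH2 g g₁ g₂ u' v') : IsH2 (f + g) (f₁ + g₁) (f₂ + g₂) (u + u') (v + v') where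
  ae_fst := (Lp.coeFn_add f g).trans (hf.ae_fst.add hg.ae_fst)
  ae_snd := (Lp.coeFn_add f₁ g₁).trans (hf.ae_snd.add hg.ae_snd)
  fst_eq := by
    intro x hx
    simp only [Pi.add_apply]
    rw [intervalIntegral.integral_add (intervalIntegrable_of_ae hf.ae_snd hx)
      (intervalIntegrable_of_ae hg.ae_snd hx), hf.fst_eq x hx, hg.fst_eq x hx]
    ring
  snd_eq := by
    intro x hx
    rw [integral_congr_of_ae (Lp.coeFn_add f₂ g₂) hx]
    simp only [Pi.add_apply]
    rw [intervalIntegral.integral_add (intervalIntegrable_of_ae (F := f₂) (ae_eq_refl _) hx)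
      (intervalIntegrable_of_ae (F := g₂) (ae_eq_refl _) hx), hf.snd_eq x hx, hg.snd_eq x hx]
    ring

theorem IsH2.smul {f f₁ f₂ : L2} {u v : ℝ → ℂ} (z : ℂ) (hf : IsH2 f f₁ f₂ u v) :
    IsH2 (z • f) (z • f₁) (z • f₂) (z • u) (z • v) where
  ae_fst := (Lp.coeFn_smul z f).trans (hf.ae_fst.const_smul z)
  ae_snd := (Lp.coeFn_smul z f₁).trans (hf.ae_snd.const_smul z)
  fst_eq := by
    intro x hx
    simp only [Pi.smul_apply]
    rw [intervalIntegral.integral_smul, hf.fst_eq x hx, smul_add]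
  snd_eq := by
    intro x hx
    rw [integral_congr_of_ae (Lp.coeFn_smul z f₂) hx]
    simp only [Pi.smul_apply]
    rw [intervalIntegral.integral_smul, hf.snd_eq x hx, smul_add]

theorem ae_zero_of_integral_zero {F : L2} {w : ℝ → ℂ}
    (h : F =ᵐ[volume.restrict (Icc (0 : ℝ) 1)] w)
    (h0 : ∀ x ∈ Icc (0 : ℝ) 1, ∫ t in (0 : ℝ)..x, w t = 0) : F = 0 := by
  have hi := intervalIntegrable_of_ae h (right_mem_Icc.2 (zero_le_one' ℝ))
  rw [Lp.eq_zero_iff_ae_eq_zero]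
  refine h.trans ?_
  rw [Filter.EventuallyEq, ae_restrict_iff' measurableSet_Icc]
  have hd := hi.ae_hasDerivAt_integral
  have hne : ∀ᵐ x : ℝ, x ≠ 0 ∧ x ≠ 1 := by
    refine Filter.Eventually.and ?_ ?_ <;> simp [ae_iff]
  filter_upwards [hd, hne] with x hx hx01 hxI
  have hd1 := hx (by simpa [uIcc_of_le] using hxI) 0 (by simp)
  have hev : (fun y => ∫ t in (0 : ℝ)..y, w t) =ᶠ[nhds x] fun _ => 0 := by
    filter_upwards [Icc_mem_nhds (lt_of_le_of_ne hxI.1 (Ne.symm hx01.1))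
      (lt_of_le_of_ne hxI.2 hx01.2)] with y hy using h0 y hy
  exact (hd1.congr_of_eventuallyEq hev.symm).unique (hasDerivAt_const x (0 : ℂ))

/-- The second derivative of the zero function vanishes. -/
theorem IsH2.eq_zero {f₁ f₂ : L2} {u v : ℝ → ℂ} (h : IsH2 0 f₁ f₂ u v) :
    (∀ x ∈ Icc (0 : ℝ) 1, u x = 0) ∧ f₂ = 0 := by
  have key : ∀ (F G : L2) (p w : ℝ → ℂ), F = 0 → F =ᵐ[volume.restrict (Icc (0 : ℝ) 1)] p →
      G =ᵐ[volume.restrict (Icc (0 : ℝ) 1)] w →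
      (∀ x ∈ Icc (0 : ℝ) 1, p x = p 0 + ∫ t in (0 : ℝ)..x, w t) →
      (∀ x ∈ Icc (0 : ℝ) 1, p x = 0) := by
    intro F G p w hF hp hw hpw
    have hcont : ContinuousOn p (Icc (0 : ℝ) 1) := by
      have hi := intervalIntegrable_of_ae hw (right_mem_Icc.2 (zero_le_one' ℝ))
      have hi' : IntegrableOn w (uIcc (0 : ℝ) 1) volume := by
        rw [uIcc_of_le zero_le_one]
        exact (intervalIntegrable_iff_integrableOn_Icc_of_le zero_le_one).1 hi
      have := intervalIntegral.continuousOn_primitive_interval hi'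
      rw [uIcc_of_le zero_le_one] at this
      exact (continuousOn_const.add this).congr hpw
    have hz : p =ᵐ[volume.restrict (Icc (0 : ℝ) 1)] fun _ => 0 := by
      subst hF
      exact hp.symm.trans (Lp.coeFn_zero _ _ _)
    intro x hx
    exact Measure.eqOn_Icc_of_ae_eq volume zero_ne_one hz hcont continuousOn_const hx
  have hu := key 0 f₁ u v rfl h.ae_fst h.ae_snd h.fst_eq
  have h1 : f₁ = 0 := by
    refine ae_zero_of_integral_zero h.ae_snd fun x hx => ?_
    have := h.fst_eq x hx
    rw [hu x hx, hu 0 (by simp)] at this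
    simpa using this.symm
  have hv := key f₁ f₂ v f₂ h1 h.ae_snd (ae_eq_refl _) h.snd_eq
  refine ⟨hu, ae_zero_of_integral_zero (F := f₂) (ae_eq_refl _) fun x hx => ?_⟩
  have := h.snd_eq x hx
  rw [hv x hx, hv 0 (by simp)] at this
  simpa using this.symm

/-! ### The quantum graph on the lattice `ℤ^{d₁} × ℤ^{d₂}` -/

section Graph

variable {d₁ d₂ : ℕ}

/-- Vertices `m = (m₁, m₂)` of the lattice `ℤ^{d₁} × ℤ^{d₂}`. -/
abbrev Vertex (d₁ d₂ : ℕ) : Type := (Fin d₁ → ℤ) × (Fin d₂ → ℤ)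

/-- The `d₁ + d₂` coordinate directions. -/
abbrev Dir (d₁ d₂ : ℕ) : Type := Fin d₁ ⊕ Fin d₂

/-- The standard basis vectors of the lattice. -/
def basisVec : Dir d₁ d₂ → Vertex d₁ d₂
  | Sum.inl j => (Pi.single j 1, 0)
  | Sum.inr j => (0, Pi.single j 1)

/-- The edge `(m, j)` goes from `m` (at the end `0`) to `m + basisVec j` (at the end `1`). -/
abbrev Edge (d₁ d₂ : ℕ) : Type := Vertex d₁ d₂ × Dir d₁ d₂

/-- The state space: the Hilbert direct sum of a copy of `L²[0,1]` for every edge. -/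
abbrev StateSpace (d₁ d₂ : ℕ) : Type := lp (fun _ : Edge d₁ d₂ => L2) 2

/-- The graph of the operator `f ↦ (-f'' + q f)` on those `f` in the direct sum of the spaces
`H²[0,1]` which are continuous at the vertices, with common value `ξ m` at the vertex `m`, and
satisfy the condition `∑ⱼ f'_{m,j}(0) - ∑ⱼ f'_{m-hⱼ,j}(1) = α(m) f(m)`. -/
def opGraph (q : ℝ → ℝ) (α : Vertex d₁ d₂ → ℝ) :
    Submodule ℂ (StateSpace d₁ d₂ × StateSpace d₁ d₂) where
  carrier := {p | ∃ (f₁ f₂ : StateSpace d₁ d₂) (u v : Edge d₁ d₂ → ℝ → ℂ)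
      (ξ : Vertex d₁ d₂ → ℂ),
    (∀ e, IsH2 (p.1 e) (f₁ e) (f₂ e) (u e) (v e)) ∧
    (∀ m j, u (m, j) 0 = ξ m ∧ u (m, j) 1 = ξ (m + basisVec j)) ∧
    (∀ m, ∑ j, v (m, j) 0 - ∑ j, v (m - basisVec j, j) 1 = (α m : ℂ) * ξ m) ∧
    (∀ e, p.2 e =ᵐ[volume.restrict (Icc (0 : ℝ) 1)]
      fun t => -(f₂ e : ℝ → ℂ) t + (q t : ℂ) * u e t)}
  zero_mem' := by
    refine ⟨0, 0, 0, 0, 0, fun e => IsH2.zero, by simp, by simp, fun e => ?_⟩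
    have h0 : (((0 : L2) : L2) : ℝ → ℂ) =ᵐ[volume.restrict (Icc (0 : ℝ) 1)] 0 :=
      Lp.coeFn_zero _ _ _
    filter_upwards [h0] with t ht
    have h1 : ((0 : StateSpace d₁ d₂ × StateSpace d₁ d₂).2 e : ℝ → ℂ) t = 0 := ht
    have h2 : ((0 : StateSpace d₁ d₂) e : ℝ → ℂ) t = 0 := ht
    rw [h1, h2]
    simp
  add_mem' := by
    rintro p p' ⟨f₁, f₂, u, v, ξ, h1, h2, h3, h4⟩ ⟨g₁, g₂, u', v', ξ', k1, k2, k3, k4⟩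
    refine ⟨f₁ + g₁, f₂ + g₂, u + u', v + v', ξ + ξ', fun e => (h1 e).add (k1 e),
      fun m j => ⟨?_, ?_⟩, fun m => ?_, fun e => ?_⟩
    · simp [(h2 m j).1, (k2 m j).1]
    · simp [(h2 m j).2, (k2 m j).2]
    · have a := h3 m
      have b := k3 m
      simp only [Pi.add_apply, Finset.sum_add_distrib, mul_add]
      rw [← a, ← b]
      ring
    · have a : ((p.2 e + p'.2 e : L2) : ℝ → ℂ) =ᵐ[volume.restrict (Icc (0 : ℝ) 1)] _ :=
        Lp.coeFn_add (p.2 e) (p'.2 e)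
      have b : ((f₂ e + g₂ e : L2) : ℝ → ℂ) =ᵐ[volume.restrict (Icc (0 : ℝ) 1)] _ :=
        Lp.coeFn_add (f₂ e) (g₂ e)
      filter_upwards [a, b, h4 e, k4 e] with t ha hb hh hk
      have ha' : ((p + p').2 e : ℝ → ℂ) t = _ := ha
      have hb' : ((f₂ + g₂) e : ℝ → ℂ) t = _ := hb
      rw [ha', hb']
      simp only [Pi.add_apply, hh, hk]
      ring
  smul_mem' := by
    rintro z p ⟨f₁, f₂, u, v, ξ, h1, h2, h3, h4⟩
    refine ⟨z • f₁, z • f₂, z • u, z • v, z • ξ, fun e => (h1 e).smul z,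
      fun m j => ⟨?_, ?_⟩, fun m => ?_, fun e => ?_⟩
    · simp [(h2 m j).1]
    · simp [(h2 m j).2]
    · have a := h3 m
      simp only [Pi.smul_apply, smul_eq_mul, ← Finset.mul_sum]
      rw [← mul_sub, a]
      ring
    · have a : ((z • p.2 e : L2) : ℝ → ℂ) =ᵐ[volume.restrict (Icc (0 : ℝ) 1)] _ :=
        Lp.coeFn_smul z (p.2 e)
      have b : ((z • f₂ e : L2) : ℝ → ℂ) =ᵐ[volume.restrict (Icc (0 : ℝ) 1)] _ :=
        Lp.coeFn_smul z (f₂ e)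
      filter_upwards [a, b, h4 e] with t ha hb hh
      have ha' : ((z • p).2 e : ℝ → ℂ) t = _ := ha
      have hb' : ((z • f₂) e : ℝ → ℂ) t = _ := hb
      rw [ha', hb']
      simp only [Pi.smul_apply, hh, smul_eq_mul]
      ring

/-- `opGraph q α` is single-valued, hence it is the graph of an operator. -/
theorem opGraph_single_valued (q : ℝ → ℝ) (α : Vertex d₁ d₂ → ℝ)
    (p : StateSpace d₁ d₂ × StateSpace d₁ d₂) (hp : p ∈ opGraph q α) (h0 : p.1 = 0) :
    p.2 = 0 := by
  obtain ⟨f₁, f₂, u, v, ξ, h1, -, -, h4⟩ := hp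
  ext1
  funext e
  have h1e := h1 e
  rw [h0] at h1e
  obtain ⟨hu, hf⟩ := IsH2.eq_zero h1e
  change p.2 e = (0 : L2)
  rw [Lp.eq_zero_iff_ae_eq_zero]
  have b : ((0 : L2) : ℝ → ℂ) =ᵐ[volume.restrict (Icc (0 : ℝ) 1)] 0 := Lp.coeFn_zero _ _ _
  rw [← hf] at b
  filter_upwards [h4 e, b, ae_restrict_mem measurableSet_Icc] with t ht hb hI
  rw [ht, hb, hu t hI]
  simp

/-- The Schrödinger operator `H_A` on the quantum graph with edge potential `q` and Kirchhoff
coupling constants `α(m)`. -/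
def schrodinger (q : ℝ → ℝ) (α : Vertex d₁ d₂ → ℝ) :
    StateSpace d₁ d₂ →ₗ.[ℂ] StateSpace d₁ d₂ :=
  (opGraph q α).toLinearPMap

theorem schrodinger_graph (q : ℝ → ℝ) (α : Vertex d₁ d₂ → ℝ) :
    (schrodinger q α).graph = opGraph q α :=
  Submodule.toLinearPMap_graph_eq _ fun p hp h0 => opGraph_single_valued q α p hp h0

/-- The surface Maryland coupling constants: `g tan π(ω·m₂ + φ)` at the vertices `(0, m₂)` of the
surface `{0} × ℤ^{d₂}`, and zero at all other vertices. -/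
def marylandCoupling (g : ℝ) (ω : Fin d₂ → ℝ) (φ : ℝ) (m : Vertex d₁ d₂) : ℝ :=
  if m.1 = 0 then g * Real.tan (Real.pi * (∑ i, ω i * (m.2 i : ℝ) + φ)) else 0

end Graph

/-! ### The edge equation and the functions `N` and `σ` -/

/-- `y` with derivative `y'` solves `-y'' + q y = λ y` on `[0,1]`, where `y` and `y'` are
absolutely continuous. -/
structure IsSolution (q : ℝ → ℝ) (lam : ℝ) (y y' : ℝ → ℝ) : Prop where
  continuousOn_fst : ContinuousOn y (Icc 0 1)
  continuousOn_snd : ContinuousOn y' (Icc 0 1)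
  fst_eq : ∀ x ∈ Icc (0 : ℝ) 1, y x = y 0 + ∫ t in (0 : ℝ)..x, y' t
  snd_eq : ∀ x ∈ Icc (0 : ℝ) 1, y' x = y' 0 + ∫ t in (0 : ℝ)..x, (q t - lam) * y t

/-- The pair `(y, y')` for the solution of `-y'' + q y = λ y` with `y(0) = y₀`, `y'(0) = y₁`;
it is determined on `[0,1]`. -/
def edgeSolution (q : ℝ → ℝ) (lam y₀ y₁ : ℝ) : (ℝ → ℝ) × (ℝ → ℝ) :=
  Classical.epsilon fun p => IsSolution q lam p.1 p.2 ∧ p.1 0 = y₀ ∧ p.2 0 = y₁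

/-- `s(1;λ)`, where `s(0;λ) = 0` and `s'(0;λ) = 1`. -/
def sOne (q : ℝ → ℝ) (lam : ℝ) : ℝ := (edgeSolution q lam 0 1).1 1

/-- The Hill discriminant `η(λ) = c(1;λ) + s'(1;λ)`, where `c(0;λ) = 1` and `c'(0;λ) = 0`. -/
def hillDiscriminant (q : ℝ → ℝ) (lam : ℝ) : ℝ :=
  (edgeSolution q lam 1 0).1 1 + (edgeSolution q lam 0 1).2 1

/-- The symbol `∑ⱼ (θⱼ + θⱼ⁻¹)` of the discrete Hamiltonian `Δ_n`, at the point
`θⱼ = exp (2 π i xⱼ)` of the torus. -/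
def latticeSymbol {n : ℕ} (x : Fin n → ℝ) : ℝ := ∑ j, 2 * Real.cos (2 * Real.pi * x j)

/-- The average of a function on the `n`-dimensional torus, in the coordinates
`θⱼ = exp (2 π i xⱼ)`, `x ∈ [0,1]ⁿ`. -/
def torusAverage {n : ℕ} (F : (Fin n → ℝ) → ℝ) : ℝ :=
  ∫ x in Icc (0 : Fin n → ℝ) 1, F x

/-- The diagonal value `G_n(0;μ)` of the Green function of `(Δ_n - μ)⁻¹`. -/
def greenDiag (n : ℕ) (μ : ℝ) : ℝ := torusAverage fun x : Fin n → ℝ => (latticeSymbol x - μ)⁻¹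

/-- `N(θ₂, λ) = -s(1;λ) G_{d₁}(0; d η(λ) - Δ_{d₂}(θ₂))`, where `d = d₁ + d₂` and
`θ₂ = exp (2 π i x)`. -/
def symbolN (d₁ : ℕ) {d₂ : ℕ} (q : ℝ → ℝ) (x : Fin d₂ → ℝ) (lam : ℝ) : ℝ :=
  -sOne q lam * greenDiag d₁ (((d₁ + d₂ : ℕ) : ℝ) * hillDiscriminant q lam - latticeSymbol x)

/-- `σ(λ)`: the average over the `d₂`-dimensional torus of `arctan (N(θ, λ) / g')`. -/
def sigma (d₁ d₂ : ℕ) (q : ℝ → ℝ) (g' lam : ℝ) : ℝ :=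
  torusAverage fun x : Fin d₂ → ℝ => Real.arctan (symbolN d₁ q x lam / g')

/-- The Diophantine condition: `|ω·m - r| ≥ C |m|^{-β}` for all nonzero `m` and all integers
`r`. -/
def IsDiophantine {d₂ : ℕ} (ω : Fin d₂ → ℝ) : Prop :=
  ∃ C > (0 : ℝ), ∃ β > (0 : ℝ), ∀ m : Fin d₂ → ℤ, m ≠ 0 → ∀ r : ℤ,
    C * ‖m‖ ^ (-β) ≤ |∑ i, ω i * (m i : ℝ) - (r : ℝ)|

/-- The quantization condition `σ(λ) = π (ω'·m + φ') mod π`, where `g' = 1 / |g|`,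
`ω' = sgn(g) ω` and `φ' = sgn(g) φ + 1/2` are the parameters for which
`-1 / (g tan π(ω·m + φ)) = g' tan π(ω'·m + φ')`. -/
def SolvesQuantization (d₁ : ℕ) {d₂ : ℕ} (q : ℝ → ℝ) (g : ℝ) (ω : Fin d₂ → ℝ) (φ : ℝ)
    (m : Fin d₂ → ℤ) (lam : ℝ) : Prop :=
  ∃ k : ℤ, sigma d₁ d₂ q (1 / |g|) lam =
    Real.pi * (∑ i, Real.sign g * ω i * (m i : ℝ) + (Real.sign g * φ + 1 / 2)) +
      k * Real.pi

end MarylandGraph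

end

open MarylandGraph

/-! On an edge, an eigenfunction at energy `λ` is a combination of `c` and `s`. If `s(1;λ) ≠ 0`, its
edge components are determined by the vertex values `ξ`, and the Wronskian identity turns the vertex
conditions into a lattice equation: the sum of `ξ` over the neighbours, minus `d η(λ) ξ`, equals
`s(1;λ) α ξ`. Off the spectrum of the unperturbed operator one has `s(1;λ) ≠ 0` (otherwise an
elementary square carries an eigenfunction, `sOne_ne_zero_of_notMem_opSpectrum`) and `|η(λ)| > 2`
(otherwise damped plane waves are approximate eigenfunctions, `two_lt_abs_hillDiscriminant`).

Since `|d η| > 2d`, the symbol `Δ - d η` is invertible on the torus. As `α` lives on the surface,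
`ξ` is recovered from `ψ = α ξ` there, and restriction to the surface integrates out the first `d₁`
variables. What remains is a Maryland equation on `ℤ^{d₂}`: `tan(π(ω'·n + φ')) ψ = (N/g') ψ`, with
`N` acting as a Fourier multiplier (`exists_marylandSolution`,
`solvesDifference_of_marylandSolution`).

A Cayley transform rewrites the tangent as `exp(2πi(ω'·n + φ'))`, which in Fourier space is a
constant times the translation by `ω'`, and rewrites `N/g'` as multiplication by `exp(2i
arctan(N/g'))`. The symbol is smooth and `ω'` is Diophantine, so the cohomological equation `2
arctan(N/g') = 2σ + u(· + ω') - u` has a continuous solution (`exists_cohomological`). Conjugation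
by `exp(iu)` leaves the constant `exp(2iσ)`, and the equation becomes diagonal in Fourier space
(`IsConjugation.equation_iff`). Solutions exist exactly when `σ = π(ω'·m + φ')` mod `π` for some
`m`. This `m` is unique by nonresonance, so the eigenspace is one-dimensional.

For the monotonicity of `σ`, write `N` as the average over the torus of `(s/(η - τ))/d` with `|τ| ≤
2`. Lagrange's identity, applied to the solutions with boundary values `1` and `±1`, shows that `(η
∓ 2)/s` decreases; hence so does `(η - τ)/s` by convexity, and its reciprocal increases. Density
follows from the density of `ω'·m + φ'` mod `1` and the continuity of `σ`. Uniqueness of `λ(m)`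
follows from `|σ| < π/2`. -/

open MeasureTheory Set

noncomputable section

namespace MarylandGraph

/-! ### Primitives of integrable functions -/

/-- `F` is on `[0,1]` a primitive of the integrable function `f`. -/
structure IsPrimitive (F f : ℝ → ℝ) : Prop where
  intervalIntegrable : IntervalIntegrable f volume 0 1
  eq_add_integral : ∀ x ∈ Icc (0 : ℝ) 1, F x = F 0 + ∫ t in (0 : ℝ)..x, f t

theorem _root_.IntervalIntegrable.mono_unitInterval {E : Type*} [NormedAddCommGroup E] {f : ℝ → E}
    (hf : IntervalIntegrable f volume 0 1) {x : ℝ} (hx : x ∈ Icc (0 : ℝ) 1) :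
    IntervalIntegrable f volume 0 x :=
  hf.mono_set (by rw [uIcc_of_le hx.1, uIcc_of_le zero_le_one]; exact Icc_subset_Icc_right hx.2)

theorem _root_.ContinuousOn.intervalIntegrable_unitInterval {E : Type*} [NormedAddCommGroup E]
    {f : ℝ → E} (hf : ContinuousOn f (Icc 0 1)) : IntervalIntegrable f volume 0 1 :=
  ContinuousOn.intervalIntegrable (by rwa [uIcc_of_le zero_le_one])

theorem continuousOn_of_eq_add_integral {E : Type*} [NormedAddCommGroup E] [NormedSpace ℝ E]
    {F f : ℝ → E} (hf : IntervalIntegrable f volume 0 1)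
    (hF : ∀ x ∈ Icc (0 : ℝ) 1, F x = F 0 + ∫ t in (0 : ℝ)..x, f t) :
    ContinuousOn F (Icc 0 1) := by
  have hi' : IntegrableOn f (uIcc (0 : ℝ) 1) volume := by
    rw [uIcc_of_le zero_le_one]
    exact (intervalIntegrable_iff_integrableOn_Icc_of_le zero_le_one).1 hf
  have := intervalIntegral.continuousOn_primitive_interval hi'
  rw [uIcc_of_le zero_le_one] at this
  exact (continuousOn_const.add this).congr hF

theorem IsPrimitive.continuousOn {F f : ℝ → ℝ} (h : IsPrimitive F f) :
    ContinuousOn F (Icc 0 1) :=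
  continuousOn_of_eq_add_integral h.intervalIntegrable h.eq_add_integral

theorem isPrimitive_integral {f : ℝ → ℝ} (hf : IntervalIntegrable f volume 0 1) :
    IsPrimitive (fun x => ∫ t in (0 : ℝ)..x, f t) f :=
  ⟨hf, fun x _ => by simp⟩

/-- The product rule for primitives. -/
theorem IsPrimitive.mul {F G f g : ℝ → ℝ} (hF : IsPrimitive F f) (hG : IsPrimitive G g) :
    IsPrimitive (fun x => F x * G x) (fun x => f x * G x + F x * g x) := by
  have hFc := hF.continuousOn
  have hGc := hG.continuousOn
  rw [← uIcc_of_le (zero_le_one' ℝ)] at hFc hGc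
  refine ⟨(hF.intervalIntegrable.mul_continuousOn hGc).add
    (hG.intervalIntegrable.continuousOn_mul hFc), fun x hx => ?_⟩
  have hf' := hF.intervalIntegrable.mono_unitInterval hx
  have hg' := hG.intervalIntegrable.mono_unitInterval hx
  -- `F` and `G` are controlled on `[0,1]` only, so integration by parts is applied to the explicit
  -- representatives `F 0 + ∫ f` and `G 0 + ∫ g`. By Lebesgue differentiation their derivatives are
  -- `f` and `g` almost everywhere.
  have key := AbsolutelyContinuousOnInterval.integral_deriv_mul_eq_sub
    (f := fun x => F 0 + ∫ t in (0 : ℝ)..x, f t) (g := fun x => G 0 + ∫ t in (0 : ℝ)..x, g t)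
    (a := 0) (b := x)
    ((LipschitzOnWith.absolutelyContinuousOnInterval
      (LipschitzOnWith.of_dist_le_mul (K := 0) (by simp))).fun_add
      (hf'.absolutelyContinuousOnInterval_intervalIntegral (by simp)))
    ((LipschitzOnWith.absolutelyContinuousOnInterval
      (LipschitzOnWith.of_dist_le_mul (K := 0) (by simp))).fun_add
      (hg'.absolutelyContinuousOnInterval_intervalIntegral (by simp)))
  rw [← hF.eq_add_integral x hx, ← hG.eq_add_integral x hx] at key
  simp only [intervalIntegral.integral_same, add_zero] at key
  have h2 : ∫ t in (0 : ℝ)..x, (f t * G t + F t * g t) = F x * G x - F 0 * G 0 := by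
    rw [← key]
    refine intervalIntegral.integral_congr_ae ?_
    filter_upwards [hf'.ae_hasDerivAt_integral, hg'.ae_hasDerivAt_integral] with t h1 h2 ht
    have ht' : t ∈ uIcc 0 x := uIoc_subset_uIcc ht
    have htI : t ∈ Icc (0 : ℝ) 1 := by
      rw [uIcc_of_le hx.1] at ht'
      exact ⟨ht'.1, ht'.2.trans hx.2⟩
    rw [((h1 ht' 0 (by simp)).const_add (F 0)).deriv, ((h2 ht' 0 (by simp)).const_add (G 0)).deriv,
      ← hF.eq_add_integral t htI, ← hG.eq_add_integral t htI]
  rw [h2]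
  ring

/-- Each integration against `k` raises the power of the primitive by one. As `k` is merely
integrable, the power rule comes from the product rule for primitives. This identity produces the
exponential series both in Grönwall's inequality and in the Picard iteration. -/
theorem integral_mul_pow_div_factorial {k : ℝ → ℝ} (hk : IntervalIntegrable k volume 0 1) (n : ℕ) :
    IsPrimitive (fun x => (∫ t in (0 : ℝ)..x, k t) ^ (n + 1) / (n + 1).factorial)
      (fun x => k x * ((∫ t in (0 : ℝ)..x, k t) ^ n / n.factorial)) := by
  have hP := isPrimitive_integral hk
  have key : ∀ n : ℕ, IsPrimitive (fun x => (∫ t in (0 : ℝ)..x, k t) ^ (n + 1))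
      (fun x => (n + 1) * (k x * (∫ t in (0 : ℝ)..x, k t) ^ n)) := by
    intro n
    induction n with
    | zero => simpa using hP
    | succ n ih =>
      have := ih.mul hP
      convert! this using 2 with x x
      push_cast
      ring
  refine ⟨?_, fun x hx => ?_⟩
  · have := (key n).intervalIntegrable.const_mul (1 / ((n + 1 : ℝ) * n.factorial))
    convert! this using 2 with x
    have : (n.factorial : ℝ) ≠ 0 := by positivity
    field_simp
  · have h := (key n).eq_add_integral x hx
    have hf : (n.factorial : ℝ) ≠ 0 := by positivity
    simp only [intervalIntegral.integral_same, ne_eq, Nat.add_eq_zero_iff, one_ne_zero, and_false,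
      not_false_eq_true, zero_pow, zero_add, zero_div] at h ⊢
    rw [h, intervalIntegral.integral_const_mul]
    simp only [← mul_div_assoc]
    rw [intervalIntegral.integral_div, Nat.factorial_succ]
    push_cast
    field_simp

/-- Grönwall's inequality in integral form, with an integrable coefficient. -/
theorem gronwall_integral {k a : ℝ → ℝ} {ε : ℝ} (hk : IntervalIntegrable k volume 0 1)
    (hk0 : ∀ x, 0 ≤ k x) (ha : ContinuousOn a (Icc 0 1)) (hε : 0 ≤ ε)
    (h : ∀ x ∈ Icc (0 : ℝ) 1, a x ≤ ε + ∫ t in (0 : ℝ)..x, k t * a t) {x : ℝ}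
    (hx : x ∈ Icc (0 : ℝ) 1) : a x ≤ ε * Real.exp (∫ t in (0 : ℝ)..x, k t) := by
  set φ : ℝ → ℝ := fun x => ∫ t in (0 : ℝ)..x, k t with hφ
  have hφ0 : ∀ x ∈ Icc (0 : ℝ) 1, 0 ≤ φ x := fun x hx =>
    intervalIntegral.integral_nonneg hx.1 fun t _ => hk0 t
  obtain ⟨M, hM⟩ := isCompact_Icc.bddAbove_image ha
  have hM' : ∀ x ∈ Icc (0 : ℝ) 1, a x ≤ |M| := fun x hx =>
    (hM (mem_image_of_mem _ hx)).trans (le_abs_self M)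
  -- Inserting the inequality into itself `n` times leaves a partial sum of `ε exp φ` and a
  -- remainder which starts from the crude bound `|M|` and tends to zero as `φ ^ n / n!`.
  have key : ∀ n : ℕ, ∀ x ∈ Icc (0 : ℝ) 1,
      a x ≤ ε * (∑ i ∈ Finset.range n, φ x ^ i / i.factorial) + |M| * (φ x ^ n / n.factorial) := by
    intro n
    induction n with
    | zero => intro x hx; simpa using hM' x hx
    | succ n ih =>
      intro x hx
      have hint : ∀ i : ℕ, IntervalIntegrable (fun t => k t * (φ t ^ i / i.factorial)) volume 0 x :=
        fun i => (integral_mul_pow_div_factorial hk i).intervalIntegrable.mono_unitInterval hx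
      have hval : ∀ i : ℕ, ∫ t in (0 : ℝ)..x, k t * (φ t ^ i / i.factorial) =
          φ x ^ (i + 1) / (i + 1).factorial := by
        intro i
        have := (integral_mul_pow_div_factorial hk i).eq_add_integral x hx
        simpa using this.symm
      have hsum : IntervalIntegrable
          (fun t => ∑ i ∈ Finset.range n, ε * (k t * (φ t ^ i / i.factorial))) volume 0 x :=
        (IntervalIntegrable.sum (Finset.range n) fun i _ => (hint i).const_mul ε).congr
          (by intro t _; simp [Finset.sum_apply])
      have hle : ∫ t in (0 : ℝ)..x, k t * a t ≤ ∫ t in (0 : ℝ)..x,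
          (∑ i ∈ Finset.range n, ε * (k t * (φ t ^ i / i.factorial)) +
            |M| * (k t * (φ t ^ n / n.factorial))) := by
        refine intervalIntegral.integral_mono_on hx.1 ?_ ?_ ?_
        · exact (hk.mul_continuousOn (by rwa [uIcc_of_le zero_le_one])).mono_unitInterval hx
        · exact hsum.add ((hint n).const_mul _)
        · intro t ht
          have := mul_le_mul_of_nonneg_left (ih t ⟨ht.1, ht.2.trans hx.2⟩) (hk0 t)
          refine this.trans (le_of_eq ?_)
          rw [mul_add, Finset.mul_sum, Finset.mul_sum]
          congr 1
          · exact Finset.sum_congr rfl fun i _ => by ring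
          · ring
      rw [intervalIntegral.integral_add hsum ((hint n).const_mul _),
        intervalIntegral.integral_finsetSum fun i _ => (hint i).const_mul ε] at hle
      simp only [intervalIntegral.integral_const_mul, hval] at hle
      refine (h x hx).trans ((add_le_add_right hle ε).trans (le_of_eq ?_))
      rw [Finset.sum_range_succ', mul_add, Finset.mul_sum]
      simp
      ring
  have hlim : Filter.Tendsto (fun n : ℕ => ε * Real.exp (φ x) + |M| * (φ x ^ n / n.factorial))
      Filter.atTop (nhds (ε * Real.exp (φ x) + |M| * 0)) :=
    ((FloorSemiring.tendsto_pow_div_factorial_atTop (φ x)).const_mul _).const_add _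
  rw [mul_zero, add_zero] at hlim
  refine ge_of_tendsto hlim (Filter.Eventually.of_forall fun n => (key n x hx).trans ?_)
  gcongr
  exact Real.sum_le_exp_of_nonneg (hφ0 x hx) n

/-! ### The edge equation -/

/-- The iterated integrals whose sum solves `y' = z`, `z' = w y`, `y(0) = y₀`, `z(0) = z₀`. -/
def picardTerm (w : ℝ → ℝ) (y₀ z₀ : ℝ) : ℕ → (ℝ → ℝ) × (ℝ → ℝ)
  | 0 => (fun _ => y₀, fun _ => z₀)
  | n + 1 => (fun x => ∫ t in (0 : ℝ)..x, (picardTerm w y₀ z₀ n).2 t,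
      fun x => ∫ t in (0 : ℝ)..x, w t * (picardTerm w y₀ z₀ n).1 t)

theorem picardTerm_continuousOn {w : ℝ → ℝ} (hw : IntervalIntegrable w volume 0 1) (y₀ z₀ : ℝ)
    (n : ℕ) : ContinuousOn (picardTerm w y₀ z₀ n).1 (Icc 0 1) ∧
      ContinuousOn (picardTerm w y₀ z₀ n).2 (Icc 0 1) := by
  induction n with
  | zero => exact ⟨continuousOn_const, continuousOn_const⟩
  | succ n ih =>
    refine ⟨(isPrimitive_integral ih.2.intervalIntegrable_unitInterval).continuousOn,
      (isPrimitive_integral (hw.mul_continuousOn ?_)).continuousOn⟩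
    rw [uIcc_of_le zero_le_one]
    exact ih.1

/-- The weight `1 + |w|` serves both components at once: one integrates `z`, the other `w y`, and
`|z| + |w y| ≤ (1 + |w|)(|y| + |z|)`. -/
theorem picardTerm_bound {w : ℝ → ℝ} (hw : IntervalIntegrable w volume 0 1) (y₀ z₀ : ℝ)
    (n : ℕ) {x : ℝ} (hx : x ∈ Icc (0 : ℝ) 1) :
    |(picardTerm w y₀ z₀ n).1 x| + |(picardTerm w y₀ z₀ n).2 x| ≤
      (|y₀| + |z₀|) * ((∫ t in (0 : ℝ)..x, (1 + |w t|)) ^ n / n.factorial) := by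
  have hk : IntervalIntegrable (fun t => 1 + |w t|) volume 0 1 :=
    intervalIntegrable_const.add hw.abs
  induction n generalizing x with
  | zero => simp [picardTerm]
  | succ n ih =>
    have hc := picardTerm_continuousOn hw y₀ z₀ n
    have hI := integral_mul_pow_div_factorial hk n
    have h1 : IntervalIntegrable (picardTerm w y₀ z₀ n).2 volume 0 x :=
      hc.2.intervalIntegrable_unitInterval.mono_unitInterval hx
    have h2 : IntervalIntegrable (fun t => w t * (picardTerm w y₀ z₀ n).1 t) volume 0 x :=
      (hw.mul_continuousOn (by rw [uIcc_of_le zero_le_one]; exact hc.1)).mono_unitInterval hx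
    have e1 : |(picardTerm w y₀ z₀ (n + 1)).1 x| ≤
        ∫ t in (0 : ℝ)..x, |(picardTerm w y₀ z₀ n).2 t| :=
      intervalIntegral.abs_integral_le_integral_abs hx.1
    have e2 : |(picardTerm w y₀ z₀ (n + 1)).2 x| ≤
        ∫ t in (0 : ℝ)..x, |w t * (picardTerm w y₀ z₀ n).1 t| :=
      intervalIntegral.abs_integral_le_integral_abs hx.1
    have e3 : (∫ t in (0 : ℝ)..x, |(picardTerm w y₀ z₀ n).2 t|) +
        (∫ t in (0 : ℝ)..x, |w t * (picardTerm w y₀ z₀ n).1 t|) ≤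
        ∫ t in (0 : ℝ)..x, (|y₀| + |z₀|) * ((1 + |w t|) *
          ((∫ t in (0 : ℝ)..t, (1 + |w t|)) ^ n / n.factorial)) := by
      rw [← intervalIntegral.integral_add h1.abs h2.abs]
      refine intervalIntegral.integral_mono_on hx.1 (h1.abs.add h2.abs)
        ((hI.intervalIntegrable.mono_unitInterval hx).const_mul _) fun t ht => ?_
      have := ih ⟨ht.1, ht.2.trans hx.2⟩
      rw [abs_mul, mul_left_comm]
      refine le_trans ?_ (mul_le_mul_of_nonneg_left this (by positivity))
      nlinarith [abs_nonneg ((picardTerm w y₀ z₀ n).1 t), abs_nonneg ((picardTerm w y₀ z₀ n).2 t),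
        abs_nonneg (w t), mul_nonneg (abs_nonneg (w t)) (abs_nonneg ((picardTerm w y₀ z₀ n).2 t))]
    have e4 := hI.eq_add_integral x hx
    simp only [intervalIntegral.integral_same, ne_eq, Nat.add_eq_zero_iff, one_ne_zero, and_false,
      not_false_eq_true, zero_pow, zero_add, zero_div] at e4
    rw [e4, ← intervalIntegral.integral_const_mul]
    linarith

/-- The solution is the sum of the iterated integrals. They are dominated uniformly on `[0,1]` by an
exponential series, and dominated convergence lets the sum pass under the integrals although `w` is
only integrable. -/
theorem exists_solution {w : ℝ → ℝ} (hw : IntervalIntegrable w volume 0 1) (y₀ z₀ : ℝ) :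
    ∃ y z : ℝ → ℝ, y 0 = y₀ ∧ z 0 = z₀ ∧ ContinuousOn y (Icc 0 1) ∧ ContinuousOn z (Icc 0 1) ∧
      (∀ x ∈ Icc (0 : ℝ) 1, y x = y₀ + ∫ t in (0 : ℝ)..x, z t) ∧
      (∀ x ∈ Icc (0 : ℝ) 1, z x = z₀ + ∫ t in (0 : ℝ)..x, w t * y t) := by
  set D := picardTerm w y₀ z₀ with hD
  set K : ℝ := ∫ t in (0 : ℝ)..1, (1 + |w t|) with hK
  set b : ℕ → ℝ := fun n => (|y₀| + |z₀|) * (K ^ n / n.factorial) with hb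
  have hk : IntervalIntegrable (fun t => 1 + |w t|) volume 0 1 :=
    intervalIntegrable_const.add hw.abs
  have hbs : Summable b := (Real.summable_pow_div_factorial K).mul_left _
  have hDb : ∀ n, ∀ x ∈ Icc (0 : ℝ) 1, |(D n).1 x| + |(D n).2 x| ≤ b n := by
    intro n x hx
    refine (picardTerm_bound hw y₀ z₀ n hx).trans ?_
    have h0 : 0 ≤ ∫ t in (0 : ℝ)..x, (1 + |w t|) :=
      intervalIntegral.integral_nonneg hx.1 fun t _ => by positivity
    have h1 : ∫ t in (0 : ℝ)..x, (1 + |w t|) ≤ K :=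
      intervalIntegral.integral_mono_interval le_rfl hx.1 hx.2
        (Filter.Eventually.of_forall fun t => by positivity) hk
    simp only [hb]
    gcongr
  have hD1 : ∀ n, ∀ x ∈ Icc (0 : ℝ) 1, ‖(D n).1 x‖ ≤ b n := fun n x hx =>
    (le_add_of_nonneg_right (abs_nonneg _)).trans (hDb n x hx)
  have hD2 : ∀ n, ∀ x ∈ Icc (0 : ℝ) 1, ‖(D n).2 x‖ ≤ b n := fun n x hx =>
    (le_add_of_nonneg_left (abs_nonneg _)).trans (hDb n x hx)
  have hs1 : ∀ x ∈ Icc (0 : ℝ) 1, Summable fun n => (D n).1 x := fun x hx =>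
    Summable.of_norm_bounded hbs fun n => hD1 n x hx
  have hs2 : ∀ x ∈ Icc (0 : ℝ) 1, Summable fun n => (D n).2 x := fun x hx =>
    Summable.of_norm_bounded hbs fun n => hD2 n x hx
  have hc : ∀ n, ContinuousOn (D n).1 (Icc 0 1) ∧ ContinuousOn (D n).2 (Icc 0 1) := fun n =>
    picardTerm_continuousOn hw y₀ z₀ n
  have hcw : ∀ n, IntervalIntegrable (fun t => w t * (D n).1 t) volume 0 1 := fun n =>
    hw.mul_continuousOn (by rw [uIcc_of_le zero_le_one]; exact (hc n).1)
  have hmem : ∀ {x t : ℝ}, x ∈ Icc (0 : ℝ) 1 → t ∈ uIoc 0 x → t ∈ Icc (0 : ℝ) 1 := by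
    intro x t hx ht
    rw [uIoc_of_le hx.1] at ht
    exact ⟨ht.1.le, ht.2.trans hx.2⟩
  have hy : ∀ x ∈ Icc (0 : ℝ) 1,
      ∑' n, (D n).1 x = y₀ + ∫ t in (0 : ℝ)..x, ∑' n, (D n).2 t := by
    intro x hx
    have := intervalIntegral.hasSum_integral_of_dominated_convergence (μ := volume) (a := 0)
      (b := x) (F := fun n t => (D n).2 t) (f := fun t => ∑' n, (D n).2 t) (fun n _ => b n)
      (fun n => ((hc n).2.intervalIntegrable_unitInterval.mono_unitInterval hx).def'.1)
      (fun n => Filter.Eventually.of_forall fun t ht => hD2 n t (hmem hx ht))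
      (Filter.Eventually.of_forall fun t _ => hbs) intervalIntegrable_const
      (Filter.Eventually.of_forall fun t ht => (hs2 t (hmem hx ht)).hasSum)
    rw [(hs1 x hx).tsum_eq_zero_add, ← this.tsum_eq]
    rfl
  have hz : ∀ x ∈ Icc (0 : ℝ) 1,
      ∑' n, (D n).2 x = z₀ + ∫ t in (0 : ℝ)..x, w t * ∑' n, (D n).1 t := by
    intro x hx
    have := intervalIntegral.hasSum_integral_of_dominated_convergence (μ := volume) (a := 0)
      (b := x) (F := fun n t => w t * (D n).1 t) (f := fun t => w t * ∑' n, (D n).1 t)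
      (fun n t => |w t| * b n)
      (fun n => ((hcw n).mono_unitInterval hx).def'.1)
      (fun n => Filter.Eventually.of_forall fun t ht => by
        rw [norm_mul]
        exact mul_le_mul_of_nonneg_left (hD1 n t (hmem hx ht)) (norm_nonneg _))
      (Filter.Eventually.of_forall fun t _ => hbs.mul_left _)
      (by
        simp only [tsum_mul_left]
        exact (hw.abs.mul_const _).mono_unitInterval hx)
      (Filter.Eventually.of_forall fun t ht => ((hs1 t (hmem hx ht)).hasSum.mul_left _))
    rw [(hs2 x hx).tsum_eq_zero_add, ← this.tsum_eq]
    rfl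
  refine ⟨fun x => ∑' n, (D n).1 x, fun x => ∑' n, (D n).2 x, ?_, ?_, ?_, ?_, hy, hz⟩
  · simpa using hy 0 (by simp)
  · simpa using hz 0 (by simp)
  · exact continuousOn_tsum (fun n => (hc n).1) hbs hD1
  · exact continuousOn_tsum (fun n => (hc n).2) hbs hD2

theorem intervalIntegrable_of_memLp {q : ℝ → ℝ}
    (hq : MemLp q 2 (volume.restrict (Icc (0 : ℝ) 1))) : IntervalIntegrable q volume 0 1 := by
  rw [intervalIntegrable_iff_integrableOn_Icc_of_le zero_le_one]
  exact hq.integrable (by norm_num)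

/-- The fundamental system is defined by a choice operator, so existence of a solution is what gives
it meaning. -/
theorem edgeSolution_spec {q : ℝ → ℝ} (hq : MemLp q 2 (volume.restrict (Icc (0 : ℝ) 1))) (lam y₀ y₁ : ℝ) :
    IsSolution q lam (edgeSolution q lam y₀ y₁).1 (edgeSolution q lam y₀ y₁).2 ∧
      (edgeSolution q lam y₀ y₁).1 0 = y₀ ∧ (edgeSolution q lam y₀ y₁).2 0 = y₁ := by
  refine Classical.epsilon_spec
    (p := fun p : (ℝ → ℝ) × (ℝ → ℝ) => IsSolution q lam p.1 p.2 ∧ p.1 0 = y₀ ∧ p.2 0 = y₁) ?_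
  obtain ⟨y, z, h0, h1, hy, hz, e1, e2⟩ := exists_solution
    ((intervalIntegrable_of_memLp hq).sub (intervalIntegrable_const (c := lam))) y₀ y₁
  refine ⟨(y, z), ⟨hy, hz, ?_, ?_⟩, h0, h1⟩
  · simpa only [h0] using e1
  · simpa only [h1] using e2

theorem IsSolution.comb {q : ℝ → ℝ} {lam : ℝ} {y y' z z' : ℝ → ℝ}
    (hq : MemLp q 2 (volume.restrict (Icc (0 : ℝ) 1)))
    (hy : IsSolution q lam y y') (hz : IsSolution q lam z z') (A B : ℝ) :
    IsSolution q lam (fun x => A * y x + B * z x) (fun x => A * y' x + B * z' x) where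
  continuousOn_fst := (hy.continuousOn_fst.const_smul A).add (hz.continuousOn_fst.const_smul B)
  continuousOn_snd := (hy.continuousOn_snd.const_smul A).add (hz.continuousOn_snd.const_smul B)
  fst_eq := by
    intro x hx
    rw [intervalIntegral.integral_add, intervalIntegral.integral_const_mul,
      intervalIntegral.integral_const_mul, hy.fst_eq x hx, hz.fst_eq x hx]
    · ring
    · exact (hy.continuousOn_snd.intervalIntegrable_unitInterval.mono_unitInterval hx).const_mul A
    · exact (hz.continuousOn_snd.intervalIntegrable_unitInterval.mono_unitInterval hx).const_mul B
  snd_eq := by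
    intro x hx
    have hw : IntervalIntegrable (fun t => q t - lam) volume 0 1 :=
      (intervalIntegrable_of_memLp hq).sub intervalIntegrable_const
    have e : ∀ t, (q t - lam) * (A * y t + B * z t) =
        A * ((q t - lam) * y t) + B * ((q t - lam) * z t) := fun t => by ring
    simp only [e]
    rw [intervalIntegral.integral_add, intervalIntegral.integral_const_mul,
      intervalIntegral.integral_const_mul, hy.snd_eq x hx, hz.snd_eq x hx]
    · ring
    · exact ((hw.mul_continuousOn (by
        rw [uIcc_of_le zero_le_one]; exact hy.continuousOn_fst)).mono_unitInterval hx).const_mul A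
    · exact ((hw.mul_continuousOn (by
        rw [uIcc_of_le zero_le_one]; exact hz.continuousOn_fst)).mono_unitInterval hx).const_mul B

theorem IsSolution.isPrimitive_fst {q : ℝ → ℝ} {lam : ℝ} {y y' : ℝ → ℝ}
    (hy : IsSolution q lam y y') : IsPrimitive y y' :=
  ⟨hy.continuousOn_snd.intervalIntegrable_unitInterval, hy.fst_eq⟩

theorem IsSolution.isPrimitive_snd {q : ℝ → ℝ} {lam : ℝ} {y y' : ℝ → ℝ}
    (hq : MemLp q 2 (volume.restrict (Icc (0 : ℝ) 1)))
    (hy : IsSolution q lam y y') : IsPrimitive y' (fun t => (q t - lam) * y t) :=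
  ⟨((intervalIntegrable_of_memLp hq).sub intervalIntegrable_const).mul_continuousOn (by
    rw [uIcc_of_le zero_le_one]; exact hy.continuousOn_fst), hy.snd_eq⟩

/-- Lagrange's identity for two solutions with different spectral parameters. -/
theorem IsSolution.lagrange {q : ℝ → ℝ} {lam mu : ℝ} {y y' z z' : ℝ → ℝ}
    (hq : MemLp q 2 (volume.restrict (Icc (0 : ℝ) 1)))
    (hy : IsSolution q lam y y') (hz : IsSolution q mu z z') :
    (y' 1 * z 1 - y 1 * z' 1) - (y' 0 * z 0 - y 0 * z' 0) =
      (mu - lam) * ∫ t in (0 : ℝ)..1, y t * z t := by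
  have h1 := (hy.isPrimitive_snd hq).mul hz.isPrimitive_fst
  have h2 := hy.isPrimitive_fst.mul (hz.isPrimitive_snd hq)
  have e1 := h1.eq_add_integral 1 (by simp)
  have e2 := h2.eq_add_integral 1 (by simp)
  have e3 : (∫ t in (0 : ℝ)..1, ((q t - lam) * y t * z t + y' t * z' t)) -
      (∫ t in (0 : ℝ)..1, (y' t * z' t + y t * ((q t - mu) * z t))) =
      (mu - lam) * ∫ t in (0 : ℝ)..1, y t * z t := by
    rw [← intervalIntegral.integral_sub h1.intervalIntegrable h2.intervalIntegrable,
      ← intervalIntegral.integral_const_mul]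
    exact intervalIntegral.integral_congr fun t _ => by ring
  linarith

/-- The Wronskian of the fundamental system is constant. -/
theorem wronskian_eq_one {q : ℝ → ℝ} (hq : MemLp q 2 (volume.restrict (Icc (0 : ℝ) 1)))
    (lam : ℝ) :
    (edgeSolution q lam 1 0).1 1 * (edgeSolution q lam 0 1).2 1 -
      (edgeSolution q lam 1 0).2 1 * (edgeSolution q lam 0 1).1 1 = 1 := by
  obtain ⟨hc, hc0, hc1⟩ := edgeSolution_spec hq lam 1 0
  obtain ⟨hs, hs0, hs1⟩ := edgeSolution_spec hq lam 0 1
  have := hc.lagrange hq hs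
  rw [hc0, hc1, hs0, hs1] at this
  linarith

/-- A pair of functions which satisfies a linear first order system, up to an error `ε`, with
vanishing initial values is small. -/
theorem norm_le_of_integral_system {E : Type*} [NormedAddCommGroup E] [NormedSpace ℝ E]
    {w : ℝ → ℝ} (hw : IntervalIntegrable w volume 0 1) {u v : ℝ → E} {r : ℝ → E} {ε : ℝ}
    (hu : ContinuousOn u (Icc 0 1)) (hv : ContinuousOn v (Icc 0 1))
    (hr : ∀ x ∈ Icc (0 : ℝ) 1, ‖r x‖ ≤ ε)
    (h1 : ∀ x ∈ Icc (0 : ℝ) 1, u x = ∫ t in (0 : ℝ)..x, v t)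
    (h2 : ∀ x ∈ Icc (0 : ℝ) 1, v x = r x + ∫ t in (0 : ℝ)..x, w t • u t) {x : ℝ}
    (hx : x ∈ Icc (0 : ℝ) 1) :
    ‖u x‖ + ‖v x‖ ≤ ε * Real.exp (∫ t in (0 : ℝ)..x, (1 + |w t|)) := by
  have hε : 0 ≤ ε := (norm_nonneg _).trans (hr 0 (by simp))
  refine gronwall_integral (a := fun x => ‖u x‖ + ‖v x‖) (intervalIntegrable_const.add hw.abs)
    (fun x => by positivity) (hu.norm.add hv.norm) hε (fun x hx => ?_) hx
  have i1 : IntervalIntegrable (fun t => ‖v t‖) volume 0 x :=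
    hv.norm.intervalIntegrable_unitInterval.mono_unitInterval hx
  have i2 : IntervalIntegrable (fun t => |w t| * ‖u t‖) volume 0 x :=
    (hw.abs.mul_continuousOn (by
      rw [uIcc_of_le zero_le_one]; exact hu.norm)).mono_unitInterval hx
  have i3 : IntervalIntegrable (fun t => (1 + |w t|) * (‖u t‖ + ‖v t‖)) volume 0 x :=
    ((intervalIntegrable_const.add hw.abs).mul_continuousOn (by
      rw [uIcc_of_le zero_le_one]; exact hu.norm.add hv.norm)).mono_unitInterval hx
  have e1 : ‖u x‖ ≤ ∫ t in (0 : ℝ)..x, ‖v t‖ := by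
    rw [h1 x hx]
    exact intervalIntegral.norm_integral_le_integral_norm hx.1
  have e2 : ‖v x‖ ≤ ε + ∫ t in (0 : ℝ)..x, |w t| * ‖u t‖ := by
    rw [h2 x hx]
    refine (norm_add_le _ _).trans (add_le_add (hr x hx) ?_)
    refine (intervalIntegral.norm_integral_le_integral_norm hx.1).trans (le_of_eq ?_)
    simp [norm_smul]
  have e3 : (∫ t in (0 : ℝ)..x, ‖v t‖) + (∫ t in (0 : ℝ)..x, |w t| * ‖u t‖) ≤
      ∫ t in (0 : ℝ)..x, (1 + |w t|) * (‖u t‖ + ‖v t‖) := by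
    rw [← intervalIntegral.integral_add i1 i2]
    refine intervalIntegral.integral_mono_on hx.1 (i1.add i2) i3 fun t _ => ?_
    nlinarith [norm_nonneg (u t), norm_nonneg (v t), abs_nonneg (w t),
      mul_nonneg (abs_nonneg (w t)) (norm_nonneg (v t))]
  show ‖u x‖ + ‖v x‖ ≤ _
  linarith

/-- Every complex solution of the edge equation is a combination of the fundamental system. -/
theorem eq_comb_of_integral_eq {q : ℝ → ℝ} (hq : MemLp q 2 (volume.restrict (Icc (0 : ℝ) 1)))
    {lam : ℝ} {u v : ℝ → ℂ} (hv : IntervalIntegrable v volume 0 1)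
    (h1 : ∀ x ∈ Icc (0 : ℝ) 1, u x = u 0 + ∫ t in (0 : ℝ)..x, v t)
    (h2 : ∀ x ∈ Icc (0 : ℝ) 1, v x = v 0 + ∫ t in (0 : ℝ)..x, ((q t - lam : ℝ) : ℂ) * u t) {x : ℝ}
    (hx : x ∈ Icc (0 : ℝ) 1) :
    u x = u 0 * (edgeSolution q lam 1 0).1 x + v 0 * (edgeSolution q lam 0 1).1 x ∧
      v x = u 0 * (edgeSolution q lam 1 0).2 x + v 0 * (edgeSolution q lam 0 1).2 x := by
  obtain ⟨hc, hc0, hc1⟩ := edgeSolution_spec hq lam 1 0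
  obtain ⟨hs, hs0, hs1⟩ := edgeSolution_spec hq lam 0 1
  set c := (edgeSolution q lam 1 0).1
  set c' := (edgeSolution q lam 1 0).2
  set s := (edgeSolution q lam 0 1).1
  set s' := (edgeSolution q lam 0 1).2
  have hw : IntervalIntegrable (fun t => q t - lam) volume 0 1 :=
    (intervalIntegrable_of_memLp hq).sub intervalIntegrable_const
  have hwC : IntervalIntegrable (fun t => ((q t - lam : ℝ) : ℂ)) volume 0 1 :=
    ⟨hw.1.ofReal, hw.2.ofReal⟩
  have huc : ContinuousOn u (Icc 0 1) := continuousOn_of_eq_add_integral hv h1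
  have hiu : IntervalIntegrable (fun t => ((q t - lam : ℝ) : ℂ) * u t) volume 0 1 :=
    hwC.mul_continuousOn (by rwa [uIcc_of_le zero_le_one])
  have hvc : ContinuousOn v (Icc 0 1) := continuousOn_of_eq_add_integral hiu h2
  have cast : ∀ {f : ℝ → ℝ}, ContinuousOn f (Icc 0 1) →
      ContinuousOn (fun t => (f t : ℂ)) (Icc 0 1) := fun hf =>
    Complex.continuous_ofReal.comp_continuousOn hf
  have hciu : ∀ {f : ℝ → ℝ}, ContinuousOn f (Icc 0 1) →
      IntervalIntegrable (fun t => ((q t - lam : ℝ) : ℂ) * f t) volume 0 1 := fun hf =>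
    hwC.mul_continuousOn (by rw [uIcc_of_le zero_le_one]; exact cast hf)
  have C1 : ∀ {f g : ℝ → ℝ}, (∀ x ∈ Icc (0 : ℝ) 1, f x = f 0 + ∫ t in (0 : ℝ)..x, g t) →
      ∀ x ∈ Icc (0 : ℝ) 1, (f x : ℂ) = f 0 + ∫ t in (0 : ℝ)..x, (g t : ℂ) := by
    intro f g hfg x hx
    rw [intervalIntegral.integral_ofReal, hfg x hx]
    push_cast
    rfl
  have key := norm_le_of_integral_system hw (u := fun x => u x - (u 0 * c x + v 0 * s x))
    (v := fun x => v x - (u 0 * c' x + v 0 * s' x)) (r := fun _ => 0) (ε := 0)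
    (huc.sub ((continuousOn_const.mul (cast hc.continuousOn_fst)).add
      (continuousOn_const.mul (cast hs.continuousOn_fst))))
    (hvc.sub ((continuousOn_const.mul (cast hc.continuousOn_snd)).add
      (continuousOn_const.mul (cast hs.continuousOn_snd)))) (by simp) ?_ ?_ hx
  · rw [zero_mul] at key
    have k1 := norm_nonneg (u x - (u 0 * c x + v 0 * s x))
    have k2 := norm_nonneg (v x - (u 0 * c' x + v 0 * s' x))
    exact ⟨sub_eq_zero.1 (norm_eq_zero.1 (by linarith)),
      sub_eq_zero.1 (norm_eq_zero.1 (by linarith))⟩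
  · intro x hx
    rw [intervalIntegral.integral_sub (hv.mono_unitInterval hx),
      intervalIntegral.integral_add, intervalIntegral.integral_const_mul,
      intervalIntegral.integral_const_mul, h1 x hx, C1 hc.fst_eq x hx, C1 hs.fst_eq x hx, hc0, hs0]
    · push_cast; ring
    · exact ((cast hc.continuousOn_snd).intervalIntegrable_unitInterval.mono_unitInterval
        hx).const_mul _
    · exact ((cast hs.continuousOn_snd).intervalIntegrable_unitInterval.mono_unitInterval
        hx).const_mul _
    · exact ((continuousOn_const.mul (cast hc.continuousOn_snd)).add
        (continuousOn_const.mul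
          (cast hs.continuousOn_snd))).intervalIntegrable_unitInterval.mono_unitInterval hx
  · intro x hx
    have e : ∀ t, (q t - lam) • (u t - (u 0 * c t + v 0 * s t)) =
        ((q t - lam : ℝ) : ℂ) * u t - (u 0 * (((q t - lam : ℝ) : ℂ) * c t) +
          v 0 * (((q t - lam : ℝ) : ℂ) * s t)) := by
      intro t
      rw [Complex.real_smul]
      ring
    simp only [e]
    have jc := (hciu hc.continuousOn_fst).mono_unitInterval hx
    have js := (hciu hs.continuousOn_fst).mono_unitInterval hx
    rw [intervalIntegral.integral_sub (hiu.mono_unitInterval hx)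
        ((jc.const_mul _).add (js.const_mul _)),
      intervalIntegral.integral_add (jc.const_mul _) (js.const_mul _),
      intervalIntegral.integral_const_mul,
      intervalIntegral.integral_const_mul, h2 x hx]
    have k1 := C1 hc.snd_eq x hx
    have k2 := C1 hs.snd_eq x hx
    rw [k1, k2, hc1, hs1]
    simp only [Complex.ofReal_mul]
    push_cast
    ring

/-! ### Dependence of the edge solutions on the spectral parameter -/

/-- The solutions of the edge equation depend Lipschitz continuously on the spectral parameter. -/
theorem exists_edgeSolution_sub_le {q : ℝ → ℝ} (hq : MemLp q 2 (volume.restrict (Icc (0 : ℝ) 1)))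
    (mu y₀ y₁ : ℝ) : ∃ C : ℝ, ∀ lam : ℝ, |lam - mu| ≤ 1 → ∀ x ∈ Icc (0 : ℝ) 1,
      |(edgeSolution q lam y₀ y₁).1 x - (edgeSolution q mu y₀ y₁).1 x| +
        |(edgeSolution q lam y₀ y₁).2 x - (edgeSolution q mu y₀ y₁).2 x| ≤ C * |lam - mu| := by
  obtain ⟨hy, hy0, hy1⟩ := edgeSolution_spec hq mu y₀ y₁
  obtain ⟨M, hM⟩ := isCompact_Icc.exists_bound_of_continuousOn hy.continuousOn_fst
  have hqi := intervalIntegrable_of_memLp hq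
  have hw : ∀ l : ℝ, IntervalIntegrable (fun t => q t - l) volume 0 1 := fun l =>
    hqi.sub intervalIntegrable_const
  have hM0 : 0 ≤ M := (norm_nonneg _).trans (hM 0 (by simp))
  -- The bound `|q - λ| ≤ |q| + |μ| + 1` holds for all `λ` with `|λ - μ| ≤ 1`, so the Grönwall
  -- exponent is uniform in `λ`.
  set K : ℝ := ∫ t in (0 : ℝ)..1, (1 + (|q t| + (|mu| + 1))) with hK
  refine ⟨M * Real.exp K, fun lam hlam x hx => ?_⟩
  obtain ⟨hz, hz0, hz1⟩ := edgeSolution_spec hq lam y₀ y₁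
  set y := (edgeSolution q mu y₀ y₁).1
  set y' := (edgeSolution q mu y₀ y₁).2
  set z := (edgeSolution q lam y₀ y₁).1
  set z' := (edgeSolution q lam y₀ y₁).2
  -- The difference of the two solutions solves the system with coefficient `q - λ`. The discrepancy
  -- between the two coefficients, acting on the fixed solution `y`, is the error term of size `|λ -
  -- μ| M`.
  have key := norm_le_of_integral_system (hw lam) (u := fun x => z x - y x)
    (v := fun x => z' x - y' x) (r := fun x => -(lam - mu) * ∫ t in (0 : ℝ)..x, y t)
    (ε := |lam - mu| * M) (hz.continuousOn_fst.sub hy.continuousOn_fst)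
    (hz.continuousOn_snd.sub hy.continuousOn_snd) ?_ ?_ ?_ hx
  · refine key.trans ?_
    have hle : ∫ t in (0 : ℝ)..x, (1 + |q t - lam|) ≤ K := by
      refine (intervalIntegral.integral_mono_interval le_rfl hx.1 hx.2
        (Filter.Eventually.of_forall fun t => by positivity)
        (intervalIntegrable_const.add (hw lam).abs)).trans ?_
      refine intervalIntegral.integral_mono_on zero_le_one
        (intervalIntegrable_const.add (hw lam).abs)
        (intervalIntegrable_const.add (hqi.abs.add intervalIntegrable_const)) fun t _ => ?_
      have h1 := abs_sub (q t) lam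
      have h2 : |lam| ≤ |mu| + 1 := by
        have := abs_add_le mu (lam - mu)
        rw [add_sub_cancel] at this
        linarith
      linarith
    have := Real.exp_le_exp.2 hle
    calc |lam - mu| * M * Real.exp (∫ t in (0 : ℝ)..x, (1 + |q t - lam|))
        ≤ |lam - mu| * M * Real.exp K := by gcongr
      _ = M * Real.exp K * |lam - mu| := by ring
  · intro x hx
    rw [norm_mul, norm_neg, Real.norm_eq_abs]
    refine mul_le_mul_of_nonneg_left ?_ (abs_nonneg _)
    refine (intervalIntegral.norm_integral_le_of_norm_le_const (C := M) fun t ht => ?_).trans ?_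
    · rw [uIoc_of_le hx.1] at ht
      exact hM t ⟨ht.1.le, ht.2.trans hx.2⟩
    · rw [sub_zero, abs_of_nonneg hx.1]
      exact mul_le_of_le_one_right hM0 hx.2
  · intro x hx
    rw [intervalIntegral.integral_sub
      (hz.continuousOn_snd.intervalIntegrable_unitInterval.mono_unitInterval hx)
      (hy.continuousOn_snd.intervalIntegrable_unitInterval.mono_unitInterval hx),
      hz.fst_eq x hx, hy.fst_eq x hx, hy0, hz0]
    ring
  · intro x hx
    have e : ∀ t, (q t - lam) • (z t - y t) =
        (q t - lam) * z t - ((q t - mu) * y t + -(lam - mu) * y t) := by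
      intro t; rw [smul_eq_mul]; ring
    have i1 := (hz.isPrimitive_snd hq).intervalIntegrable.mono_unitInterval hx
    have i2 := (hy.isPrimitive_snd hq).intervalIntegrable.mono_unitInterval hx
    have i3 := (hy.continuousOn_fst.intervalIntegrable_unitInterval.mono_unitInterval hx).const_mul
      (-(lam - mu))
    simp only [e]
    rw [intervalIntegral.integral_sub i1 (i2.add i3), intervalIntegral.integral_add i2 i3,
      intervalIntegral.integral_const_mul, hz.snd_eq x hx, hy.snd_eq x hx, hy1, hz1]
    ring

theorem continuous_edgeSolution {q : ℝ → ℝ} (hq : MemLp q 2 (volume.restrict (Icc (0 : ℝ) 1)))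
    (y₀ y₁ : ℝ) {x : ℝ} (hx : x ∈ Icc (0 : ℝ) 1) :
    Continuous (fun lam => (edgeSolution q lam y₀ y₁).1 x) ∧
      Continuous (fun lam => (edgeSolution q lam y₀ y₁).2 x) := by
  have aux : ∀ {f : ℝ → ℝ}, (∀ mu, ∃ C : ℝ, ∀ lam : ℝ, |lam - mu| ≤ 1 →
      |f lam - f mu| ≤ C * |lam - mu|) → Continuous f := by
    intro f hf
    refine continuous_iff_continuousAt.2 fun mu => ?_
    obtain ⟨C, hC⟩ := hf mu
    refine tendsto_iff_dist_tendsto_zero.2 ?_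
    refine squeeze_zero' (g := fun lam => C * |lam - mu|)
      (Filter.Eventually.of_forall fun _ => dist_nonneg) ?_ ?_
    · filter_upwards [Metric.closedBall_mem_nhds mu one_pos] with lam hlam
      exact hC lam hlam
    · have : Continuous fun lam : ℝ => C * |lam - mu| := by fun_prop
      simpa using this.tendsto mu
  constructor <;> refine aux fun mu => ?_ <;>
    obtain ⟨C, hC⟩ := exists_edgeSolution_sub_le hq mu y₀ y₁ <;>
    refine ⟨C, fun lam hlam => ?_⟩
  · exact (le_add_of_nonneg_right (abs_nonneg _)).trans (hC lam hlam x hx)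
  · exact (le_add_of_nonneg_left (abs_nonneg _)).trans (hC lam hlam x hx)

/-- This allows the limit `λ' → λ` in the integral of Lagrange's identity. -/
theorem continuous_integral_mul_edgeSolution {q : ℝ → ℝ}
    (hq : MemLp q 2 (volume.restrict (Icc (0 : ℝ) 1))) (y₀ y₁ : ℝ) {u : ℝ → ℝ}
    (hu : ContinuousOn u (Icc 0 1)) :
    Continuous (fun lam => ∫ t in (0 : ℝ)..1, u t * (edgeSolution q lam y₀ y₁).1 t) := by
  obtain ⟨B, hB⟩ := isCompact_Icc.exists_bound_of_continuousOn hu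
  refine continuous_iff_continuousAt.2 fun mu => ?_
  obtain ⟨C, hC⟩ := exists_edgeSolution_sub_le hq mu y₀ y₁
  refine tendsto_iff_dist_tendsto_zero.2 ?_
  refine squeeze_zero' (g := fun lam => B * (C * |lam - mu|))
    (Filter.Eventually.of_forall fun _ => dist_nonneg) ?_ ?_
  · filter_upwards [Metric.closedBall_mem_nhds mu one_pos] with lam hlam
    have hi : ∀ l, IntervalIntegrable (fun t => u t * (edgeSolution q l y₀ y₁).1 t) volume 0 1 :=
      fun l => (hu.mul (edgeSolution_spec hq l y₀ y₁).1.continuousOn_fst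
        ).intervalIntegrable_unitInterval
    rw [Real.dist_eq, ← intervalIntegral.integral_sub (hi _) (hi _)]
    have hbd : ∀ t ∈ uIoc (0 : ℝ) 1, ‖u t * (edgeSolution q lam y₀ y₁).1 t -
        u t * (edgeSolution q mu y₀ y₁).1 t‖ ≤ B * (C * |lam - mu|) := by
      intro t ht
      rw [uIoc_of_le zero_le_one] at ht
      have ht' : t ∈ Icc (0 : ℝ) 1 := ⟨ht.1.le, ht.2⟩
      rw [← mul_sub, norm_mul]
      exact mul_le_mul (hB t ht') ((le_add_of_nonneg_right (abs_nonneg _)).trans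
        (hC lam hlam t ht')) (norm_nonneg _) ((norm_nonneg _).trans (hB t ht'))
    simpa using intervalIntegral.norm_integral_le_of_norm_le_const hbd
  · have : Continuous fun lam : ℝ => B * (C * |lam - mu|) := by fun_prop
    simpa using this.tendsto mu

theorem continuous_sOne {q : ℝ → ℝ} (hq : MemLp q 2 (volume.restrict (Icc (0 : ℝ) 1))) :
    Continuous (sOne q) :=
  (continuous_edgeSolution hq 0 1 (by simp)).1

theorem continuous_hillDiscriminant {q : ℝ → ℝ}
    (hq : MemLp q 2 (volume.restrict (Icc (0 : ℝ) 1))) : Continuous (hillDiscriminant q) :=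
  (continuous_edgeSolution hq 1 0 (by simp)).1.add (continuous_edgeSolution hq 0 1 (by simp)).2

/-! ### Monotonicity of the quotients of the discriminant by the Dirichlet value -/

/-- The solution with boundary values `1` and `e` when the Dirichlet value `s(1;λ)` is nonzero. -/
def boundarySolution (q : ℝ → ℝ) (e lam : ℝ) (x : ℝ) : ℝ :=
  1 * (edgeSolution q lam 1 0).1 x +
    ((e - (edgeSolution q lam 1 0).1 1) / sOne q lam) * (edgeSolution q lam 0 1).1 x

/-- For the solution `y` with `y(0) = 1` and `y(1) = e = ±1`, the boundary expression `e y'(1) -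
y'(0)` equals `(η - 2e)/s` by the Wronskian identity. Lagrange's identity for two energies therefore
gives the difference quotient of this function as minus an integral of the product of the two
solutions, and the energies are then let coincide. -/
theorem hasDerivAt_hillDiscriminant_div {q : ℝ → ℝ}
    (hq : MemLp q 2 (volume.restrict (Icc (0 : ℝ) 1))) {e lam : ℝ} (he : e ^ 2 = 1)
    (hs : sOne q lam ≠ 0) :
    HasDerivAt (fun l => (hillDiscriminant q l - 2 * e) / sOne q l)
      (-∫ t in (0 : ℝ)..1, boundarySolution q e lam t * boundarySolution q e lam t) lam := by
  have hsol : ∀ l, IsSolution q l (boundarySolution q e l) _ := fun l =>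
    (edgeSolution_spec hq l 1 0).1.comb hq (edgeSolution_spec hq l 0 1).1 1
      ((e - (edgeSolution q l 1 0).1 1) / sOne q l)
  have hid : ∀ l l', sOne q l ≠ 0 → sOne q l' ≠ 0 →
      (hillDiscriminant q l - 2 * e) / sOne q l - (hillDiscriminant q l' - 2 * e) / sOne q l' =
      (l' - l) * ∫ t in (0 : ℝ)..1, boundarySolution q e l t * boundarySolution q e l' t := by
    intro l l' hl hl'
    rw [← (hsol l).lagrange hq (hsol l')]
    -- The first part is the boundary value at `1`; the second, where `e ^ 2 = 1` and the Wronskian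
    -- enter, evaluates the boundary form.
    have alg : ∀ {c c' s s' : ℝ}, c * s' - c' * s = 1 → s ≠ 0 →
        1 * c + (e - c) / s * s = e ∧
          (1 * c' + (e - c) / s * s') * e - (e - c) / s = (c + s' - 2 * e) / s := by
      intro c c' s s' hw hs
      constructor
      · field_simp
        ring
      · field_simp
        linear_combination (-e) * hw + s' * he
    obtain ⟨w1, w2⟩ := alg (wronskian_eq_one hq l) hl
    obtain ⟨w3, w4⟩ := alg (wronskian_eq_one hq l') hl'
    have b1 : boundarySolution q e l 1 = e := w1
    have b2 : boundarySolution q e l' 1 = e := w3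
    rw [b1, b2]
    simp only [boundarySolution, (edgeSolution_spec hq l 1 0).2.1, (edgeSolution_spec hq l 0 1).2.1,
      (edgeSolution_spec hq l 1 0).2.2, (edgeSolution_spec hq l 0 1).2.2,
      (edgeSolution_spec hq l' 1 0).2.1, (edgeSolution_spec hq l' 0 1).2.1,
      (edgeSolution_spec hq l' 1 0).2.2, (edgeSolution_spec hq l' 0 1).2.2, hillDiscriminant,
      sOne]
    rw [← w2, ← w4]
    ring
  have hcont : ContinuousAt (fun l => ∫ t in (0 : ℝ)..1,
      boundarySolution q e lam t * boundarySolution q e l t) lam := by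
    have hu : ContinuousOn (boundarySolution q e lam) (Icc 0 1) := (hsol lam).continuousOn_fst
    have e1 : ∀ l, ∫ t in (0 : ℝ)..1, boundarySolution q e lam t * boundarySolution q e l t =
        (∫ t in (0 : ℝ)..1, boundarySolution q e lam t * (edgeSolution q l 1 0).1 t) +
        ((e - (edgeSolution q l 1 0).1 1) / sOne q l) *
          ∫ t in (0 : ℝ)..1, boundarySolution q e lam t * (edgeSolution q l 0 1).1 t := by
      intro l
      rw [← intervalIntegral.integral_const_mul, ← intervalIntegral.integral_add]
      · refine intervalIntegral.integral_congr fun t _ => ?_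
        simp only [boundarySolution]
        ring
      · exact (hu.mul (edgeSolution_spec hq l 1 0).1.continuousOn_fst
          ).intervalIntegrable_unitInterval
      · exact (hu.mul (edgeSolution_spec hq l 0 1).1.continuousOn_fst
          ).intervalIntegrable_unitInterval.const_mul _
    simp only [e1]
    exact (continuous_integral_mul_edgeSolution hq 1 0 hu).continuousAt.add
      (((continuousAt_const.sub
        (continuous_edgeSolution hq 1 0 (x := 1) (by simp)).1.continuousAt).div
        (continuous_sOne hq).continuousAt hs).mul
        (continuous_integral_mul_edgeSolution hq 0 1 hu).continuousAt)
  rw [hasDerivAt_iff_tendsto_slope]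
  refine Filter.Tendsto.congr' ?_ (hcont.neg.tendsto.mono_left nhdsWithin_le_nhds)
  have hne : ∀ᶠ l in nhdsWithin lam {lam}ᶜ, sOne q l ≠ 0 :=
    ((continuous_sOne hq).continuousAt.eventually_ne hs).filter_mono nhdsWithin_le_nhds
  filter_upwards [hne, self_mem_nhdsWithin] with l hl hlne
  have := hid lam l hs hl
  have hd : l - lam ≠ 0 := sub_ne_zero.2 hlne
  rw [slope_def_field, eq_div_iff hd]
  simp only [Pi.neg_apply]
  linarith

/-- Between Dirichlet eigenvalues, `(η - τ) / s(1;·)` is strictly decreasing for `τ ∈ [-2, 2]`. -/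
theorem strictAntiOn_hillDiscriminant_sub_div {q : ℝ → ℝ}
    (hq : MemLp q 2 (volume.restrict (Icc (0 : ℝ) 1))) {a b τ : ℝ} (hτ : |τ| ≤ 2)
    (hs : ∀ lam ∈ Icc a b, sOne q lam ≠ 0) :
    StrictAntiOn (fun l => (hillDiscriminant q l - τ) / sOne q l) (Icc a b) := by
  have main : ∀ e : ℝ, e ^ 2 = 1 →
      StrictAntiOn (fun l => (hillDiscriminant q l - 2 * e) / sOne q l) (Icc a b) := by
    intro e he
    refine strictAntiOn_of_deriv_neg (convex_Icc a b)
      (((continuous_hillDiscriminant hq).sub continuous_const).continuousOn.div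
        (continuous_sOne hq).continuousOn hs) fun l hl => ?_
    rw [interior_Icc] at hl
    have hl' := hs l (Ioo_subset_Icc_self hl)
    rw [(hasDerivAt_hillDiscriminant_div hq he hl').deriv, neg_lt_zero]
    have hsol : IsSolution q l (boundarySolution q e l) _ :=
      (edgeSolution_spec hq l 1 0).1.comb hq (edgeSolution_spec hq l 0 1).1 1
        ((e - (edgeSolution q l 1 0).1 1) / sOne q l)
    have h0 : boundarySolution q e l 0 = 1 := by
      simp [boundarySolution, (edgeSolution_spec hq l 1 0).2.1, (edgeSolution_spec hq l 0 1).2.1]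
    refine intervalIntegral.integral_pos zero_lt_one
      (hsol.continuousOn_fst.mul hsol.continuousOn_fst) (fun x _ => mul_self_nonneg _)
      ⟨0, by simp, ?_⟩
    rw [h0]
    norm_num
  intro x hx y hy hxy
  have h1 := main 1 (by norm_num) hx hy hxy
  have h2 := main (-1) (by norm_num) hx hy hxy
  obtain ⟨hτ1, hτ2⟩ := abs_le.1 hτ
  -- Every `τ ∈ [-2, 2]` is a convex combination of the endpoints, where the derivative is explicit.
  have e : ∀ l, (hillDiscriminant q l - τ) / sOne q l =
      ((2 + τ) / 4) * ((hillDiscriminant q l - 2 * 1) / sOne q l) +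
      ((2 - τ) / 4) * ((hillDiscriminant q l - 2 * (-1)) / sOne q l) := fun l => by ring
  simp only [e]
  -- At `τ = -2` the weight of the first term vanishes, and strictness has to come from the second.
  rcases hτ1.eq_or_lt with h | h
  · have h3 : (2 + τ) / 4 = 0 := by rw [← h]; norm_num
    have h4 : (2 - τ) / 4 = 1 := by rw [← h]; norm_num
    simpa [h3, h4] using h2
  · exact add_lt_add_of_lt_of_le (mul_lt_mul_of_pos_left h1 (by linarith))
      (mul_le_mul_of_nonneg_left h2.le (by linarith))

/-! ### The fundamental system in `L²[0,1]` -/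

/-- A real function on `[0,1]` as an element of `L²[0,1]` (zero if it is not square integrable). -/
def toL2 (f : ℝ → ℝ) : L2 :=
  open Classical in
  if h : MemLp (fun t => (f t : ℂ)) 2 (volume.restrict (Icc (0 : ℝ) 1)) then h.toLp else 0

theorem coeFn_toL2 {f : ℝ → ℝ} (hf : MemLp f 2 (volume.restrict (Icc (0 : ℝ) 1))) :
    toL2 f =ᵐ[volume.restrict (Icc (0 : ℝ) 1)] fun t => (f t : ℂ) := by
  have h : MemLp (fun t => (f t : ℂ)) 2 (volume.restrict (Icc (0 : ℝ) 1)) := hf.ofReal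
  rw [toL2, dif_pos h]
  exact h.coeFn_toLp

theorem _root_.ContinuousOn.memLp_unitInterval {f : ℝ → ℝ} (hf : ContinuousOn f (Icc 0 1)) :
    MemLp f 2 (volume.restrict (Icc (0 : ℝ) 1)) := by
  obtain ⟨C, hC⟩ := isCompact_Icc.exists_bound_of_continuousOn hf
  refine MemLp.of_bound (hf.aestronglyMeasurable measurableSet_Icc) C ?_
  filter_upwards [ae_restrict_mem measurableSet_Icc] with t ht using hC t ht

theorem memLp_mul_of_continuousOn {q f : ℝ → ℝ}
    (hq : MemLp q 2 (volume.restrict (Icc (0 : ℝ) 1))) (hf : ContinuousOn f (Icc 0 1)) (lam : ℝ) :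
    MemLp (fun t => (q t - lam) * f t) 2 (volume.restrict (Icc (0 : ℝ) 1)) := by
  obtain ⟨C, hC⟩ := isCompact_Icc.exists_bound_of_continuousOn hf
  have hql : MemLp (fun t => q t - lam) 2 (volume.restrict (Icc (0 : ℝ) 1)) :=
    hq.sub (memLp_const lam)
  refine MemLp.of_le_mul (c := C) hql
    (hql.aestronglyMeasurable.mul (hf.aestronglyMeasurable measurableSet_Icc)) ?_
  filter_upwards [ae_restrict_mem measurableSet_Icc] with t ht
  rw [norm_mul, mul_comm]
  exact mul_le_mul_of_nonneg_right (hC t ht) (norm_nonneg _)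

theorem IsPrimitive.isH2 {y y' y'' : ℝ → ℝ} (h1 : IsPrimitive y y') (h2 : IsPrimitive y' y'')
    (h : MemLp y'' 2 (volume.restrict (Icc (0 : ℝ) 1))) :
    IsH2 (toL2 y) (toL2 y') (toL2 y'') (fun t => (y t : ℂ)) (fun t => (y' t : ℂ)) where
  ae_fst := coeFn_toL2 h1.continuousOn.memLp_unitInterval
  ae_snd := coeFn_toL2 h2.continuousOn.memLp_unitInterval
  fst_eq := by
    intro x hx
    rw [intervalIntegral.integral_ofReal, h1.eq_add_integral x hx]
    push_cast
    rfl
  snd_eq := by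
    intro x hx
    rw [integral_congr_of_ae (coeFn_toL2 h) hx, intervalIntegral.integral_ofReal,
      h2.eq_add_integral x hx]
    push_cast
    rfl

/-- A function with vanishing boundary values, and with derivative `1` at `0` and `0` at `1`. -/
def bump (x : ℝ) : ℝ := x - 2 * x ^ 2 + x ^ 3

/-- The derivative of `bump`. -/
def bumpDeriv (x : ℝ) : ℝ := 1 - 4 * x + 3 * x ^ 2

/-- The second derivative of `bump`. -/
def bumpDeriv₂ (x : ℝ) : ℝ := -4 + 6 * x

theorem isPrimitive_of_hasDerivAt {F f : ℝ → ℝ} (hf : Continuous f)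
    (h : ∀ x, HasDerivAt F (f x) x) : IsPrimitive F f := by
  refine ⟨hf.intervalIntegrable _ _, fun x _ => ?_⟩
  rw [intervalIntegral.integral_eq_sub_of_hasDerivAt (fun t _ => h t) (hf.intervalIntegrable _ _)]
  ring

theorem isPrimitive_bump : IsPrimitive bump bumpDeriv := by
  refine isPrimitive_of_hasDerivAt (by unfold bumpDeriv; fun_prop) fun x => ?_
  have := ((hasDerivAt_id x).sub ((hasDerivAt_pow 2 x).const_mul 2)).add (hasDerivAt_pow 3 x)
  convert! this using 1
  simp [bumpDeriv]
  ring

theorem isPrimitive_bumpDeriv : IsPrimitive bumpDeriv bumpDeriv₂ := by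
  refine isPrimitive_of_hasDerivAt (by unfold bumpDeriv₂; fun_prop) fun x => ?_
  have := ((hasDerivAt_const x (1 : ℝ)).sub ((hasDerivAt_id x).const_mul 4)).add
    ((hasDerivAt_pow 2 x).const_mul 3)
  convert! this using 1
  simp [bumpDeriv₂]
  ring

/-- `c(·;λ)` as an element of `L²[0,1]`. -/
def cosL2 (q : ℝ → ℝ) (lam : ℝ) : L2 := toL2 (edgeSolution q lam 1 0).1

/-- `s(·;λ)` as an element of `L²[0,1]`. -/
def sinL2 (q : ℝ → ℝ) (lam : ℝ) : L2 := toL2 (edgeSolution q lam 0 1).1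

/-- The image of `bump` under `-d²/dx² + q - λ`. -/
def bumpImage (q : ℝ → ℝ) (lam : ℝ) : L2 := toL2 fun t => (q t - lam) * bump t - bumpDeriv₂ t

section Edge

variable {q : ℝ → ℝ}

theorem edgeSolution_isH2 (hq : MemLp q 2 (volume.restrict (Icc (0 : ℝ) 1))) (lam y₀ y₁ : ℝ) :
    IsH2 (toL2 (edgeSolution q lam y₀ y₁).1) (toL2 (edgeSolution q lam y₀ y₁).2)
      (toL2 fun t => (q t - lam) * (edgeSolution q lam y₀ y₁).1 t)
      (fun t => ((edgeSolution q lam y₀ y₁).1 t : ℂ))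
      (fun t => ((edgeSolution q lam y₀ y₁).2 t : ℂ)) := by
  have h := (edgeSolution_spec hq lam y₀ y₁).1
  exact h.isPrimitive_fst.isH2 (h.isPrimitive_snd hq)
    (memLp_mul_of_continuousOn hq h.continuousOn_fst lam)

/-- A multiple of this function changes the derivative at the initial end of an edge and nothing
else in the boundary data. It can therefore absorb a defect in the vertex condition without
affecting continuity. -/
theorem bump_isH2 : IsH2 (toL2 bump) (toL2 bumpDeriv) (toL2 bumpDeriv₂)
    (fun t => (bump t : ℂ)) (fun t => (bumpDeriv t : ℂ)) := by
  refine isPrimitive_bump.isH2 isPrimitive_bumpDeriv (ContinuousOn.memLp_unitInterval ?_)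
  unfold bumpDeriv₂
  fun_prop

/-- The function `X c + A s + B bump` on an edge belongs to `H²`. -/
theorem edgeComb_isH2 (hq : MemLp q 2 (volume.restrict (Icc (0 : ℝ) 1))) (lam : ℝ) (X A B : ℂ) :
    IsH2 (X • cosL2 q lam + A • sinL2 q lam + B • toL2 bump)
      (X • toL2 (edgeSolution q lam 1 0).2 + A • toL2 (edgeSolution q lam 0 1).2 +
        B • toL2 bumpDeriv)
      (X • toL2 (fun t => (q t - lam) * (edgeSolution q lam 1 0).1 t) +
        A • toL2 (fun t => (q t - lam) * (edgeSolution q lam 0 1).1 t) + B • toL2 bumpDeriv₂)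
      (X • (fun t => ((edgeSolution q lam 1 0).1 t : ℂ)) +
        A • (fun t => ((edgeSolution q lam 0 1).1 t : ℂ)) + B • (fun t => (bump t : ℂ)))
      (X • (fun t => ((edgeSolution q lam 1 0).2 t : ℂ)) +
        A • (fun t => ((edgeSolution q lam 0 1).2 t : ℂ)) + B • (fun t => (bumpDeriv t : ℂ))) :=
  (((edgeSolution_isH2 hq lam 1 0).smul X).add ((edgeSolution_isH2 hq lam 0 1).smul A)).add
    (bump_isH2.smul B)

theorem coeFn_comb₃ (f g h : L2) (X A B : ℂ) :
    ((X • f + A • g + B • h : L2) : ℝ → ℂ) =ᵐ[volume.restrict (Icc (0 : ℝ) 1)]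
      fun t => X * f t + A * g t + B * h t := by
  filter_upwards [Lp.coeFn_add (X • f + A • g) (B • h), Lp.coeFn_add (X • f) (A • g),
    Lp.coeFn_smul X f, Lp.coeFn_smul A g, Lp.coeFn_smul B h] with t h1 h2 h3 h4 h5
  rw [h1, Pi.add_apply, h2, Pi.add_apply, h3, h4, h5]
  rfl

/-- Since `c` and `s` solve the edge equation, only the bump contributes to the defect of the
eigenvalue equation. -/
theorem edgeComb_operator (hq : MemLp q 2 (volume.restrict (Icc (0 : ℝ) 1))) (lam : ℝ)
    (X A B : ℂ) :
    (((lam : ℂ) • (X • cosL2 q lam + A • sinL2 q lam + B • toL2 bump) + B • bumpImage q lam : L2) :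
      ℝ → ℂ) =ᵐ[volume.restrict (Icc (0 : ℝ) 1)]
    fun t => -((X • toL2 (fun t => (q t - lam) * (edgeSolution q lam 1 0).1 t) +
        A • toL2 (fun t => (q t - lam) * (edgeSolution q lam 0 1).1 t) +
        B • toL2 bumpDeriv₂ : L2) : ℝ → ℂ) t + (q t : ℂ) *
        (X • (fun t => ((edgeSolution q lam 1 0).1 t : ℂ)) +
        A • (fun t => ((edgeSolution q lam 0 1).1 t : ℂ)) + B • (fun t => (bump t : ℂ))) t := by
  have hc := (edgeSolution_spec hq lam 1 0).1.continuousOn_fst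
  have hs := (edgeSolution_spec hq lam 0 1).1.continuousOn_fst
  have hb : ContinuousOn bump (Icc 0 1) := isPrimitive_bump.continuousOn
  have hb2 : ContinuousOn bumpDeriv₂ (Icc 0 1) := by unfold bumpDeriv₂; fun_prop
  have e1 := coeFn_toL2 (memLp_mul_of_continuousOn hq hc lam)
  have e2 := coeFn_toL2 (memLp_mul_of_continuousOn hq hs lam)
  have e3 := coeFn_toL2 hb2.memLp_unitInterval
  have e4 := coeFn_toL2 hc.memLp_unitInterval
  have e5 := coeFn_toL2 hs.memLp_unitInterval
  have e6 := coeFn_toL2 hb.memLp_unitInterval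
  have e7 := coeFn_toL2 ((memLp_mul_of_continuousOn hq hb lam).sub hb2.memLp_unitInterval)
  filter_upwards [coeFn_comb₃ _ _ _ X A B, coeFn_comb₃ (cosL2 q lam) (sinL2 q lam) (toL2 bump) X A B,
    Lp.coeFn_add ((lam : ℂ) • (X • cosL2 q lam + A • sinL2 q lam + B • toL2 bump))
      (B • bumpImage q lam),
    Lp.coeFn_smul (lam : ℂ) (X • cosL2 q lam + A • sinL2 q lam + B • toL2 bump),
    Lp.coeFn_smul B (bumpImage q lam), e1, e2, e3, e4, e5, e6, e7]
    with t h1 h2 h3 h4 h5 h6 h7 h8 h9 h10 h11 h12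
  have h12' : (bumpImage q lam : ℝ → ℂ) t = (((q t - lam) * bump t - bumpDeriv₂ t : ℝ) : ℂ) := h12
  have h9' : (cosL2 q lam : ℝ → ℂ) t = _ := h9
  have h10' : (sinL2 q lam : ℝ → ℂ) t = _ := h10
  rw [h1, h3, Pi.add_apply, h4, h5, Pi.smul_apply, Pi.smul_apply, h2, h6, h7, h8, h9', h10', h11,
    h12']
  simp only [Pi.add_apply, Pi.smul_apply, smul_eq_mul]
  push_cast
  ring

theorem sinL2_ne_zero (hq : MemLp q 2 (volume.restrict (Icc (0 : ℝ) 1))) (lam : ℝ) :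
    sinL2 q lam ≠ 0 := by
  intro h0
  obtain ⟨hs, hs0, hs1⟩ := edgeSolution_spec hq lam 0 1
  have h := edgeSolution_isH2 hq lam 0 1
  rw [show toL2 (edgeSolution q lam 0 1).1 = 0 from h0] at h
  have hz : ∀ x ∈ Icc (0 : ℝ) 1, (edgeSolution q lam 0 1).1 x = 0 := fun x hx => by
    exact_mod_cast h.eq_zero.1 x hx
  have hd : ∀ x ∈ Icc (0 : ℝ) 1, (edgeSolution q lam 0 1).2 x = 1 := by
    intro x hx
    rw [hs.snd_eq x hx, hs1, add_eq_left]
    refine (intervalIntegral.integral_congr (g := fun _ => 0) fun t ht => ?_).trans (by simp)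
    rw [uIcc_of_le hx.1] at ht
    simp [hz t ⟨ht.1, ht.2.trans hx.2⟩]
  have h1 := hs.fst_eq 1 (by simp)
  rw [hz 1 (by simp), hs0, zero_add,
    intervalIntegral.integral_congr (g := fun _ => 1) fun t ht => by
      rw [uIcc_of_le zero_le_one] at ht
      exact hd t ht] at h1
  simp at h1

/-- The coefficients of an edge solution are controlled by its norm. -/
theorem exists_norm_le_edgeComb (hq : MemLp q 2 (volume.restrict (Icc (0 : ℝ) 1))) (lam : ℝ) :
    ∃ K > 0, ∀ X A : ℂ, ‖X‖ ≤ K * ‖X • cosL2 q lam + A • sinL2 q lam‖ ∧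
      ‖A‖ ≤ K * ‖X • cosL2 q lam + A • sinL2 q lam‖ := by
  -- An injective linear map on a finite-dimensional space is bounded below. Injectivity is the
  -- linear independence of `c` and `s`.
  let Φ : ℂ × ℂ →ₗ[ℂ] L2 :=
    (LinearMap.toSpanSingleton ℂ L2 (cosL2 q lam)).coprod
      (LinearMap.toSpanSingleton ℂ L2 (sinL2 q lam))
  have hΦ : ∀ X A, Φ (X, A) = X • cosL2 q lam + A • sinL2 q lam := fun X A => by
    simp [Φ]
  have hker : LinearMap.ker Φ = ⊥ := by
    rw [LinearMap.ker_eq_bot']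
    rintro ⟨X, A⟩ h
    rw [hΦ] at h
    have hH := edgeComb_isH2 hq lam X A 0
    rw [zero_smul, add_zero, h] at hH
    have h0 := hH.eq_zero.1 0 (by simp)
    have hX : X = 0 := by
      simpa [(edgeSolution_spec hq lam 1 0).2.1, (edgeSolution_spec hq lam 0 1).2.1, bump] using h0
    rw [hX, zero_smul, zero_add, smul_eq_zero] at h
    rw [hX, h.resolve_right (sinL2_ne_zero hq lam)]
    rfl
  obtain ⟨K, hK, h⟩ := Φ.exists_antilipschitzWith hker
  refine ⟨K, hK, fun X A => ?_⟩
  have := h.le_mul_norm (map_zero Φ) (X, A)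
  rw [hΦ] at this
  exact ⟨(norm_fst_le (X, A)).trans this, (norm_snd_le (X, A)).trans this⟩

end Edge

/-! ### From states to vertex functions and back -/

section Graph

variable {d₁ d₂ : ℕ} {q : ℝ → ℝ}

theorem memlp_smul_const {ι : Type*} {X : ι → ℂ} (hX : Memℓp X 2) (g : L2) :
    Memℓp (fun e => X e • g) 2 := by
  refine memℓp_gen ?_
  have := (hX.summable (by norm_num)).mul_right (‖g‖ ^ (2 : ENNReal).toReal)
  refine this.congr fun e => ?_
  rw [norm_smul, Real.mul_rpow (norm_nonneg _) (norm_nonneg _)]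

theorem memlp_of_norm_le {ι : Type*} {E F : ι → Type*} [∀ i, NormedAddCommGroup (E i)]
    [∀ i, NormedAddCommGroup (F i)] {x : ∀ i, E i} {y : ∀ i, F i} (hy : Memℓp y 2) (K : ℝ)
    (h : ∀ i, ‖x i‖ ≤ K * ‖y i‖) : Memℓp x 2 := by
  refine memℓp_gen ?_
  have := (hy.summable (by norm_num)).mul_left (|K| ^ (2 : ENNReal).toReal)
  refine Summable.of_nonneg_of_le (fun i => by positivity) (fun i => ?_) this
  rw [← Real.mul_rpow (abs_nonneg _) (norm_nonneg _)]
  refine Real.rpow_le_rpow (norm_nonneg _) ((h i).trans ?_) (by norm_num)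
  gcongr
  exact le_abs_self K

theorem memlp_comp_injective {ι κ : Type*} {X : ι → ℂ} (hX : Memℓp X 2) {σ : κ → ι}
    (hσ : Function.Injective σ) : Memℓp (fun k => X (σ k)) 2 :=
  memℓp_gen ((hX.summable (by norm_num)).comp_injective hσ)

theorem summable_prod_fintype {ι κ : Type*} [Finite ι] {F : ι × κ → ℝ} (hF : ∀ p, 0 ≤ F p)
    (h : ∀ i, Summable fun k => F (i, k)) : Summable F := by
  rw [summable_prod_of_nonneg hF]
  exact ⟨h, summable_of_hasFiniteSupport (Set.toFinite _)⟩

theorem memlp_edge {ξ : Vertex d₁ d₂ → ℂ} (hξ : Memℓp ξ 2) (σ : Dir d₁ d₂ → Vertex d₁ d₂) :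
    Memℓp (fun e : Edge d₁ d₂ => ξ (e.1 + σ e.2)) 2 := by
  have h2 : Summable fun p : Dir d₁ d₂ × Vertex d₁ d₂ =>
      ‖ξ (p.2 + σ p.1)‖ ^ (2 : ENNReal).toReal :=
    summable_prod_fintype (fun p => by positivity) fun j =>
      (memlp_comp_injective hξ (add_left_injective (σ j))).summable (by norm_num)
  have h3 := h2.comp_injective (Equiv.prodComm (Vertex d₁ d₂) (Dir d₁ d₂)).injective
  exact memℓp_gen h3

/-- The state with edge components `X e c + A e s + B e bump` belongs to the domain as soon as it
satisfies the vertex conditions. -/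
theorem exists_mem_opGraph (hq : MemLp q 2 (volume.restrict (Icc (0 : ℝ) 1))) (lam : ℝ)
    (α : Vertex d₁ d₂ → ℝ) {ξ : Vertex d₁ d₂ → ℂ} {A B : Edge d₁ d₂ → ℂ} (hξ : Memℓp ξ 2)
    (hA : Memℓp A 2) (hB : Memℓp B 2)
    (h1 : ∀ m j, ξ m * (edgeSolution q lam 1 0).1 1 + A (m, j) * (edgeSolution q lam 0 1).1 1 =
      ξ (m + basisVec j))
    (h2 : ∀ m, ∑ j, (A (m, j) + B (m, j)) -
      ∑ j, (ξ (m - basisVec j) * (edgeSolution q lam 1 0).2 1 +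
        A (m - basisVec j, j) * (edgeSolution q lam 0 1).2 1) = α m * ξ m) :
    ∃ p ∈ opGraph q α,
      (∀ e, p.1 e = ξ e.1 • cosL2 q lam + A e • sinL2 q lam + B e • toL2 bump) ∧
      ∀ e, p.2 e = (lam : ℂ) • p.1 e + B e • bumpImage q lam := by
  have hX : Memℓp (fun e : Edge d₁ d₂ => ξ e.1) 2 := by
    simpa using memlp_edge hξ (fun _ => 0)
  have mem : ∀ f g h : L2, Memℓp (fun e : Edge d₁ d₂ => ξ e.1 • f + A e • g + B e • h) 2 :=
    fun f g h => ((memlp_smul_const hX f).add (memlp_smul_const hA g)).add (memlp_smul_const hB h)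
  let mk : ∀ f g h : L2, StateSpace d₁ d₂ := fun f g h => ⟨_, mem f g h⟩
  let r : StateSpace d₁ d₂ := ⟨_, memlp_smul_const hB (bumpImage q lam)⟩
  let F := mk (cosL2 q lam) (sinL2 q lam) (toL2 bump)
  refine ⟨(F, (lam : ℂ) • F + r), ⟨mk (toL2 (edgeSolution q lam 1 0).2)
    (toL2 (edgeSolution q lam 0 1).2) (toL2 bumpDeriv),
    mk (toL2 (fun t => (q t - lam) * (edgeSolution q lam 1 0).1 t))
      (toL2 (fun t => (q t - lam) * (edgeSolution q lam 0 1).1 t)) (toL2 bumpDeriv₂),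
    fun e => ξ e.1 • (fun t => ((edgeSolution q lam 1 0).1 t : ℂ)) +
        A e • (fun t => ((edgeSolution q lam 0 1).1 t : ℂ)) + B e • (fun t => (bump t : ℂ)),
    fun e => ξ e.1 • (fun t => ((edgeSolution q lam 1 0).2 t : ℂ)) +
        A e • (fun t => ((edgeSolution q lam 0 1).2 t : ℂ)) + B e • (fun t => (bumpDeriv t : ℂ)),
    ξ, fun e => edgeComb_isH2 hq lam _ _ _, fun m j => ⟨?_, ?_⟩, fun m => ?_,
    fun e => edgeComb_operator hq lam _ _ _⟩, fun e => rfl, fun e => rfl⟩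
  · simp [(edgeSolution_spec hq lam 1 0).2.1, (edgeSolution_spec hq lam 0 1).2.1, bump]
  · rw [← h1 m j]
    simp [bump]
    norm_num
  · rw [← h2 m]
    simp [(edgeSolution_spec hq lam 1 0).2.2, (edgeSolution_spec hq lam 0 1).2.2, bumpDeriv]
    norm_num

/-! ### The difference equation for the vertex values -/

/-- The sum over the nearest neighbours of a vertex. -/
def neighborSum (ξ : Vertex d₁ d₂ → ℂ) (m : Vertex d₁ d₂) : ℂ :=
  ∑ j, (ξ (m + basisVec j) + ξ (m - basisVec j))

/-- The edge component of an eigenfunction with given vertex values. -/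
def edgeComponent (q : ℝ → ℝ) (lam : ℝ) (ξ : Vertex d₁ d₂ → ℂ) (e : Edge d₁ d₂) : L2 :=
  ξ e.1 • cosL2 q lam +
    ((ξ (e.1 + basisVec e.2) - (edgeSolution q lam 1 0).1 1 * ξ e.1) / sOne q lam) • sinL2 q lam

/-- `ξ` solves the difference equation of the vertex values of eigenfunctions. -/
def SolvesDifference (q : ℝ → ℝ) (α : Vertex d₁ d₂ → ℝ) (lam : ℝ) (ξ : Vertex d₁ d₂ → ℂ) : Prop :=
  ∀ m, neighborSum ξ m - ((d₁ + d₂ : ℕ) : ℂ) * hillDiscriminant q lam * ξ m =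
    sOne q lam * α m * ξ m

theorem card_dir : ((Finset.univ : Finset (Dir d₁ d₂)).card : ℂ) = ((d₁ + d₂ : ℕ) : ℂ) := by
  simp

/-- Continuity at the far end forces the coefficient of `s` on each edge. The derivatives at a
vertex then combine, through the Wronskian, into the difference equation, so a square-summable
solution of the latter extends to an eigenfunction. -/
theorem exists_eigenvector (hq : MemLp q 2 (volume.restrict (Icc (0 : ℝ) 1))) {lam : ℝ}
    (hs : sOne q lam ≠ 0) {α : Vertex d₁ d₂ → ℝ} {ξ : Vertex d₁ d₂ → ℂ} (hξ : Memℓp ξ 2)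
    (h : SolvesDifference q α lam ξ) :
    ∃ f : StateSpace d₁ d₂, (f, (lam : ℂ) • f) ∈ opGraph q α ∧
      ∀ e, f e = edgeComponent q lam ξ e := by
  have hs' : (sOne q lam : ℂ) ≠ 0 := by exact_mod_cast hs
  have hw : ((edgeSolution q lam 1 0).1 1 : ℂ) * (edgeSolution q lam 0 1).2 1 -
      (edgeSolution q lam 1 0).2 1 * (edgeSolution q lam 0 1).1 1 = 1 := by
    exact_mod_cast wronskian_eq_one hq lam
  have hX : Memℓp (fun e : Edge d₁ d₂ => ξ e.1) 2 := by
    simpa using memlp_edge hξ (fun _ => 0)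
  have hA : Memℓp (fun e : Edge d₁ d₂ =>
      (ξ (e.1 + basisVec e.2) - (edgeSolution q lam 1 0).1 1 * ξ e.1) / sOne q lam) 2 := by
    have := ((memlp_edge hξ basisVec).sub (hX.const_mul ((edgeSolution q lam 1 0).1 1 : ℂ))).const_mul
      ((sOne q lam : ℂ)⁻¹)
    convert! this using 2 with e
    simp [div_eq_inv_mul]
  obtain ⟨p, hp, hp1, hp2⟩ := exists_mem_opGraph hq lam α (B := 0) hξ hA zero_memℓp
    (fun m j => by
      change _ + _ * (sOne q lam : ℂ) = _
      field_simp
      ring)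
    (fun m => by
      -- The contribution of the direction `j` to the vertex condition; the Wronskian reduces the
      -- coefficient of `ξ (m - basisVec j)` to `1 / s`.
      have key : ∀ j, ((ξ (m + basisVec j) - (edgeSolution q lam 1 0).1 1 * ξ m) / sOne q lam +
          (0 : ℂ)) - (ξ (m - basisVec j) * (edgeSolution q lam 1 0).2 1 +
          (ξ (m - basisVec j + basisVec j) - (edgeSolution q lam 1 0).1 1 * ξ (m - basisVec j)) /
            sOne q lam * (edgeSolution q lam 0 1).2 1) =
          (sOne q lam : ℂ)⁻¹ * ((ξ (m + basisVec j) + ξ (m - basisVec j)) -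
            hillDiscriminant q lam * ξ m) := by
        intro j
        rw [sub_add_cancel, hillDiscriminant]
        push_cast
        have e : (sOne q lam : ℂ) = (edgeSolution q lam 0 1).1 1 := rfl
        rw [← e] at hw
        field_simp
        linear_combination (ξ (m - basisVec j)) * hw
      rw [← Finset.sum_sub_distrib]
      refine (Finset.sum_congr rfl fun j _ => key j).trans ?_
      rw [← Finset.mul_sum, Finset.sum_sub_distrib, Finset.sum_const, nsmul_eq_mul, card_dir]
      have := h m
      simp only [neighborSum] at this
      rw [← mul_assoc, this]
      field_simp)
  refine ⟨p.1, ?_, fun e => ?_⟩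
  · have : p.2 = (lam : ℂ) • p.1 := by
      ext1
      funext e
      rw [hp2 e, Pi.zero_apply, zero_smul, add_zero]
      rfl
    rwa [← this]
  · rw [hp1 e]
    simp [edgeComponent]

/-- The eigenvalue equation identifies the second derivative with `(q - λ) u`, so `u` and `v` solve
the edge equation and uniqueness for it applies. -/
theorem eigenvector_edges (hq : MemLp q 2 (volume.restrict (Icc (0 : ℝ) 1))) {lam : ℝ}
    {f f₁ f₂ : L2} {u v : ℝ → ℂ} (h : IsH2 f f₁ f₂ u v)
    (hf : ((lam : ℂ) • f : L2) =ᵐ[volume.restrict (Icc (0 : ℝ) 1)]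
      fun t => -(f₂ : ℝ → ℂ) t + (q t : ℂ) * u t) :
    (∀ x ∈ Icc (0 : ℝ) 1,
      u x = u 0 * (edgeSolution q lam 1 0).1 x + v 0 * (edgeSolution q lam 0 1).1 x ∧
      v x = u 0 * (edgeSolution q lam 1 0).2 x + v 0 * (edgeSolution q lam 0 1).2 x) ∧
    f = u 0 • cosL2 q lam + v 0 • sinL2 q lam := by
  have hv : IntervalIntegrable v volume 0 1 := intervalIntegrable_of_ae h.ae_snd (by simp)
  have hf2 : f₂ =ᵐ[volume.restrict (Icc (0 : ℝ) 1)] fun t => ((q t - lam : ℝ) : ℂ) * u t := by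
    filter_upwards [hf, Lp.coeFn_smul (lam : ℂ) f, h.ae_fst] with t h1 h2 h3
    rw [h2, Pi.smul_apply, h3, smul_eq_mul] at h1
    push_cast
    linear_combination h1
  have key : ∀ x ∈ Icc (0 : ℝ) 1,
      u x = u 0 * (edgeSolution q lam 1 0).1 x + v 0 * (edgeSolution q lam 0 1).1 x ∧
      v x = u 0 * (edgeSolution q lam 1 0).2 x + v 0 * (edgeSolution q lam 0 1).2 x := fun x hx =>
    eq_comb_of_integral_eq hq hv h.fst_eq (fun x hx => by
      rw [h.snd_eq x hx, integral_congr_of_ae hf2 hx]) hx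
  refine ⟨key, Lp.ext ?_⟩
  have hc := coeFn_toL2 (edgeSolution_spec hq lam 1 0).1.continuousOn_fst.memLp_unitInterval
  have hs := coeFn_toL2 (edgeSolution_spec hq lam 0 1).1.continuousOn_fst.memLp_unitInterval
  filter_upwards [h.ae_fst, coeFn_comb₃ (cosL2 q lam) (sinL2 q lam) 0 (u 0) (v 0) 0, hc, hs,
    ae_restrict_mem measurableSet_Icc] with t h1 h2 h3 h4 ht
  have h3' : (cosL2 q lam : ℝ → ℂ) t = _ := h3
  have h4' : (sinL2 q lam : ℝ → ℂ) t = _ := h4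
  rw [smul_zero, add_zero] at h2
  rw [h1, (key t ht).1, h2, h3', h4', zero_mul, add_zero]

/-- The vertex values of an eigenfunction. -/
theorem exists_vertexValues (hq : MemLp q 2 (volume.restrict (Icc (0 : ℝ) 1))) {lam : ℝ}
    (hd : 1 ≤ d₁) (hs : sOne q lam ≠ 0) {α : Vertex d₁ d₂ → ℝ} {f : StateSpace d₁ d₂}
    (hf : (f, (lam : ℂ) • f) ∈ opGraph q α) :
    ∃ ξ : Vertex d₁ d₂ → ℂ, Memℓp ξ 2 ∧ SolvesDifference q α lam ξ ∧
      ∀ e, f e = edgeComponent q lam ξ e := by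
  obtain ⟨f₁, f₂, u, v, ξ, h1, h2, h3, h4⟩ := hf
  have hs' : (sOne q lam : ℂ) ≠ 0 := by exact_mod_cast hs
  have hw : ((edgeSolution q lam 1 0).1 1 : ℂ) * (edgeSolution q lam 0 1).2 1 -
      (edgeSolution q lam 1 0).2 1 * (edgeSolution q lam 0 1).1 1 = 1 := by
    exact_mod_cast wronskian_eq_one hq lam
  have hE : ∀ e, _ := fun e => eigenvector_edges hq (h1 e) (h4 e)
  have hv : ∀ m j, v (m, j) 0 =
      (ξ (m + basisVec j) - (edgeSolution q lam 1 0).1 1 * ξ m) / sOne q lam := by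
    intro m j
    have := ((hE (m, j)).1 1 (by simp)).1
    rw [(h2 m j).1, (h2 m j).2] at this
    rw [eq_div_iff hs', this]
    simp only [sOne]
    ring
  have hfe : ∀ e, f e = edgeComponent q lam ξ e := by
    rintro ⟨m, j⟩
    rw [edgeComponent, ← hv m j, ← (h2 m j).1]
    exact (hE (m, j)).2
  refine ⟨ξ, ?_, fun m => ?_, hfe⟩
  -- One outgoing edge at each vertex is enough to control `ξ` by the norm of `f`; the first
  -- surface-transversal direction is used.
  · obtain ⟨K, hK, hb⟩ := exists_norm_le_edgeComb hq lam
    refine memlp_of_norm_le (memℓp_gen (((lp.memℓp f).summable (by norm_num)).comp_injective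
      (Prod.mk_left_injective (Sum.inl ⟨0, hd⟩ : Dir d₁ d₂)))
      (f := fun m : Vertex d₁ d₂ => f (m, Sum.inl ⟨0, hd⟩))) K fun m => ?_
    rw [hfe]
    exact (hb _ _).1
  · have hv1 : ∀ m j, v (m, j) 1 =
        ((edgeSolution q lam 0 1).2 1 * ξ (m + basisVec j) - ξ m) / sOne q lam := by
      intro m j
      rw [((hE (m, j)).1 1 (by simp)).2, hv m j, (h2 m j).1, eq_div_iff hs', add_mul]
      have e : (sOne q lam : ℂ) = (edgeSolution q lam 0 1).1 1 := rfl
      rw [← e] at hw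
      field_simp
      linear_combination (-ξ m) * hw
    have h := h3 m
    rw [← Finset.sum_sub_distrib] at h
    have key : ∀ j, v (m, j) 0 - v (m - basisVec j, j) 1 =
        (sOne q lam : ℂ)⁻¹ * ((ξ (m + basisVec j) + ξ (m - basisVec j)) -
            hillDiscriminant q lam * ξ m) := by
      intro j
      rw [hv m j, hv1 (m - basisVec j) j, sub_add_cancel, hillDiscriminant]
      push_cast
      field_simp
      ring
    rw [Finset.sum_congr rfl fun j _ => key j, ← Finset.mul_sum, Finset.sum_sub_distrib,
      Finset.sum_const, nsmul_eq_mul, card_dir] at h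
    rw [neighborSum, mul_assoc, mul_assoc, ← h, mul_inv_cancel_left₀ hs']

end Graph

section Spectrum

variable {d₁ d₂ : ℕ} {q : ℝ → ℝ}

/-! ### The spectrum of the unperturbed operator -/

/-- Off the spectrum the operator minus `z` is bounded below, because the resolvent is a bounded
left inverse. Both exact and approximate eigenfunctions are excluded by this bound. -/
theorem exists_norm_le_of_notMem_opSpectrum {α : Vertex d₁ d₂ → ℝ} {z : ℂ}
    (h : z ∉ opSpectrum (schrodinger q α)) :
    ∃ K : ℝ, ∀ p ∈ opGraph q α, ‖p.1‖ ≤ K * ‖p.2 - z • p.1‖ := by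
  rw [opSpectrum, notMem_compl_iff] at h
  obtain ⟨R, -, hR⟩ := h
  refine ⟨‖R‖, fun p hp => ?_⟩
  rw [← schrodinger_graph, LinearPMap.mem_graph_iff] at hp
  obtain ⟨y, hy1, hy2⟩ := hp
  have := hR y
  rw [hy1, hy2] at this
  calc ‖p.1‖ = ‖R (p.2 - z • p.1)‖ := by rw [this]
    _ ≤ _ := R.le_opNorm _

/-- The coefficients of the eigenfunction supported on an elementary square, when `s(1;λ) = 0`. -/
def squareCoeff (t : ℂ) (i j : Dir d₁ d₂) (e : Edge d₁ d₂) : ℂ :=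
  if e.2 = i then (if e.1 = 0 then 1 else 0) - t * (if e.1 = basisVec j then 1 else 0)
  else if e.2 = j then -((if e.1 = 0 then 1 else 0) - t * (if e.1 = basisVec i then 1 else 0))
  else 0

theorem sum_dir_of_support {i j : Dir d₁ d₂} (hij : i ≠ j) {F : Dir d₁ d₂ → ℂ}
    (hF : ∀ k, k ≠ i → k ≠ j → F k = 0) : ∑ k, F k = F i + F j := by
  rw [← Finset.sum_pair hij]
  refine (Finset.sum_subset (Finset.subset_univ _) fun k _ hk => ?_).symm
  simp only [Finset.mem_insert, Finset.mem_singleton, not_or] at hk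
  exact hF k hk.1 hk.2

/-- If `s(1;λ) = 0`, multiples of `s` vanish at both ends of an edge and continuity is automatic
with zero vertex values. Around the elementary square spanned by one direction of each kind the
coefficients `1, t, -t, -1`, with `t = s'(1;λ)`, make the derivatives cancel at all four corners,
and a finitely supported eigenfunction arises. -/
theorem sOne_ne_zero_of_notMem_opSpectrum (hq : MemLp q 2 (volume.restrict (Icc (0 : ℝ) 1)))
    (hd₁ : 1 ≤ d₁) (hd₂ : 1 ≤ d₂) {lam : ℝ}
    (h : (lam : ℂ) ∉ opSpectrum (schrodinger q (fun _ : Vertex d₁ d₂ => 0))) :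
    sOne q lam ≠ 0 := by
  intro hs
  have hs' : (edgeSolution q lam 0 1).1 1 = 0 := hs
  set t : ℂ := Complex.ofReal ((edgeSolution q lam 0 1).2 1) with ht
  set i : Dir d₁ d₂ := Sum.inl ⟨0, hd₁⟩ with hi
  set j : Dir d₁ d₂ := Sum.inr ⟨0, hd₂⟩ with hj
  have hij : i ≠ j := by simp [hi, hj]
  have hAfin : (Function.support (squareCoeff t i j)).Finite := by
    refine ((({0, basisVec i, basisVec j} : Set (Vertex d₁ d₂)).toFinite).prod
      (Set.toFinite (univ : Set (Dir d₁ d₂)))).subset ?_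
    rintro ⟨m, k⟩ hmk
    simp only [mem_prod, mem_univ, and_true, mem_insert_iff, mem_singleton_iff]
    by_contra hcon
    push Not at hcon
    apply hmk
    simp [squareCoeff, hcon.1, hcon.2.1, hcon.2.2]
  have hA : Memℓp (squareCoeff t i j) 2 := (memℓp_zero hAfin).of_exponent_ge zero_le
  obtain ⟨K, hK⟩ := exists_norm_le_of_notMem_opSpectrum h
  obtain ⟨p, hp, hp1, hp2⟩ := exists_mem_opGraph hq lam (fun _ : Vertex d₁ d₂ => 0) (ξ := 0) (B := 0)
    zero_memℓp hA zero_memℓp (fun m k => by simp [hs']) (fun m => by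
      simp only [Pi.zero_apply, add_zero, zero_mul, zero_add, mul_zero]
      rw [← ht, sum_dir_of_support hij, sum_dir_of_support hij]
      · have e1 : m - basisVec i = basisVec j ↔ m - basisVec j = basisVec i := by
          rw [sub_eq_iff_eq_add, sub_eq_iff_eq_add, add_comm]
        simp only [squareCoeff, if_true, hij.symm, if_false, sub_eq_zero, e1]
        ring
      · intro k h1 h2
        simp [squareCoeff, h1, h2]
      · intro k h1 h2
        simp [squareCoeff, h1, h2])
  have hz : p.2 - (lam : ℂ) • p.1 = 0 := by
    rw [sub_eq_zero]
    ext1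
    funext e
    rw [hp2 e, Pi.zero_apply, zero_smul, add_zero]
    rfl
  have hp0 : p.1 = 0 := by
    have := hK p hp
    rw [hz, norm_zero, mul_zero] at this
    exact norm_le_zero_iff.1 this
  have h1 := hp1 (0, i)
  have hb : ∀ k : Dir d₁ d₂, (0 : Vertex d₁ d₂) ≠ basisVec k := by
    intro k hk
    rcases k with k | k
    · have := congrFun (congrArg Prod.fst hk) k
      simp [basisVec] at this
    · have := congrFun (congrArg Prod.snd hk) k
      simp [basisVec] at this
  rw [hp0] at h1
  simp only [squareCoeff, hb, if_true, if_false, Pi.zero_apply, zero_smul, zero_add, add_zero,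
    mul_zero, sub_zero, one_smul] at h1
  exact sinL2_ne_zero hq lam h1.symm

/-! ### Damped plane waves as approximate eigenfunctions -/

theorem summable_prod_pi {ι : Type*} [Fintype ι] [DecidableEq ι] {κ : Type*} {f : κ → ℝ}
    (hf0 : ∀ k, 0 ≤ f k) (hf : Summable f) : Summable fun m : ι → κ => ∏ i, f (m i) := by
  classical
  refine summable_of_sum_le (c := (∑' k, f k) ^ Fintype.card ι)
    (fun m => Finset.prod_nonneg fun i _ => hf0 _) fun u => ?_
  have hsub : u ⊆ Fintype.piFinset fun i => u.image fun m => m i := fun m hm =>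
    Fintype.mem_piFinset.2 fun i => Finset.mem_image_of_mem _ hm
  refine (Finset.sum_le_sum_of_subset_of_nonneg hsub fun m _ _ =>
    Finset.prod_nonneg fun i _ => hf0 _).trans ?_
  rw [← Finset.prod_univ_sum (fun i => u.image fun m => m i) fun _ k => f k]
  refine (Finset.prod_le_prod (fun i _ => Finset.sum_nonneg fun k _ => hf0 k)
    fun i _ => hf.sum_le_tsum _ fun k _ => hf0 k).trans ?_
  simp

theorem summable_exp_neg_mul_abs {ε : ℝ} (hε : 0 < ε) :
    Summable fun n : ℤ => Real.exp (-ε * |(n : ℝ)|) := by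
  have h : Summable fun n : ℕ => Real.exp (-ε * |(n : ℝ)|) := by
    have := summable_geometric_of_lt_one (Real.exp_nonneg (-ε)) (Real.exp_lt_one_iff.2 (by linarith))
    refine this.congr fun n => ?_
    rw [← Real.exp_nat_mul, abs_of_nonneg (Nat.cast_nonneg n), mul_comm]
  refine Summable.of_nat_of_neg (f := fun n : ℤ => Real.exp (-ε * |(n : ℝ)|)) ?_ ?_
  · simpa using h
  · simpa using h

/-- The sum of the coordinates of a vertex. -/
def coordSum (m : Vertex d₁ d₂) : ℤ := ∑ i, m.1 i + ∑ i, m.2 i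

/-- The `ℓ¹` norm of a vertex. -/
def coordNorm (m : Vertex d₁ d₂) : ℝ := ∑ i, |(m.1 i : ℝ)| + ∑ i, |(m.2 i : ℝ)|

theorem coordSum_add_basisVec (m : Vertex d₁ d₂) (j : Dir d₁ d₂) :
    coordSum (m + basisVec j) = coordSum m + 1 := by
  rcases j with j | j <;> simp [coordSum, basisVec, Finset.sum_add_distrib] <;> ring

theorem abs_coordNorm_add_basisVec_sub (m : Vertex d₁ d₂) (j : Dir d₁ d₂) :
    |coordNorm (m + basisVec j) - coordNorm m| ≤ 1 := by
  have aux : ∀ {n : ℕ} (a : Fin n → ℤ) (i : Fin n),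
      |(∑ k, |((a + Pi.single i 1 : Fin n → ℤ) k : ℝ)|) - (∑ k, |(a k : ℝ)|)| ≤ 1 := by
    intro n a i
    rw [← Finset.sum_sub_distrib]
    refine (Finset.abs_sum_le_sum_abs _ _).trans ?_
    have h1 : ∀ k, |(|((a + Pi.single i 1 : Fin n → ℤ) k : ℝ)| - |(a k : ℝ)|)| ≤
        (Pi.single i 1 : Fin n → ℝ) k := by
      intro k
      refine (abs_abs_sub_abs_le_abs_sub _ _).trans ?_
      rcases eq_or_ne k i with rfl | hk
      · simp
      · simp [hk]
    refine (Finset.sum_le_sum fun k _ => h1 k).trans ?_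
    simp
  rcases j with j | j
  · have := aux m.1 j
    simpa [coordNorm, basisVec] using this
  · have := aux m.2 j
    simpa [coordNorm, basisVec] using this

theorem summable_exp_neg_mul_coordNorm {ε : ℝ} (hε : 0 < ε) :
    Summable fun m : Vertex d₁ d₂ => Real.exp (-ε * coordNorm m) := by
  have h1 : ∀ n : ℕ, Summable fun m : Fin n → ℤ => Real.exp (-ε * ∑ i, |(m i : ℝ)|) := by
    intro n
    refine (summable_prod_pi (ι := Fin n) (fun _ => Real.exp_nonneg _)
      (summable_exp_neg_mul_abs hε)).congr fun m => ?_
    rw [Finset.mul_sum, Real.exp_sum]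
  refine ((h1 d₁).mul_of_nonneg (h1 d₂) (fun _ => Real.exp_nonneg _)
    (fun _ => Real.exp_nonneg _)).congr fun m => ?_
  rw [coordNorm, mul_add, Real.exp_add]

/-- A damped plane wave. -/
def planeWave (z : Circle) (ε : ℝ) (m : Vertex d₁ d₂) : ℂ :=
  ((z ^ coordSum m : Circle) : ℂ) * (Real.exp (-ε * coordNorm m) : ℝ)

theorem norm_planeWave (z : Circle) (ε : ℝ) (m : Vertex d₁ d₂) :
    ‖planeWave z ε m‖ = Real.exp (-ε * coordNorm m) := by
  rw [planeWave, norm_mul, Circle.norm_coe, one_mul, Complex.norm_real, Real.norm_eq_abs,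
    abs_of_nonneg (Real.exp_nonneg _)]

theorem memlp_planeWave (z : Circle) {ε : ℝ} (hε : 0 < ε) :
    Memℓp (planeWave z ε : Vertex d₁ d₂ → ℂ) 2 := by
  refine memℓp_gen ((summable_exp_neg_mul_coordNorm (mul_pos two_pos hε)).congr fun m => ?_)
  rw [norm_planeWave, ← Real.exp_mul]
  congr 1
  norm_num
  ring

theorem abs_exp_sub_exp_le {a b ε : ℝ} (hε : 0 ≤ ε) (h : |b - a| ≤ 1) :
    |Real.exp (-ε * b) - Real.exp (-ε * a)| ≤ (Real.exp ε - 1) * Real.exp (-ε * a) := by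
  obtain ⟨h1, h2⟩ := abs_le.1 h
  have e : Real.exp (-ε * b) - Real.exp (-ε * a) =
      (Real.exp (-ε * (b - a)) - 1) * Real.exp (-ε * a) := by
    rw [sub_mul, ← Real.exp_add, one_mul]
    ring_nf
  rw [e, abs_mul, abs_of_nonneg (Real.exp_nonneg (-ε * a))]
  refine mul_le_mul_of_nonneg_right ?_ (Real.exp_nonneg _)
  have u1 : Real.exp (-ε * (b - a)) ≤ Real.exp ε := Real.exp_le_exp.2 (by nlinarith)
  have u2 : Real.exp (-ε) ≤ Real.exp (-ε * (b - a)) := Real.exp_le_exp.2 (by nlinarith)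
  have u3 := Real.add_one_le_exp ε
  have u4 := Real.add_one_le_exp (-ε)
  rw [abs_le]
  constructor <;> linarith

/-- The undamped wave satisfies the relation exactly in every single direction. A step to a
neighbour changes the `ℓ¹` norm by at most one, hence the damping factor by a relative amount of at
most `exp ε - 1`, uniformly in the vertex. -/
theorem norm_planeWave_neighbor (z : Circle) {ε : ℝ} (hε : 0 ≤ ε) (m : Vertex d₁ d₂)
    (j : Dir d₁ d₂) :
    ‖planeWave z ε (m + basisVec j) + planeWave z ε (m - basisVec j) -
      ((z : ℂ) + (z : ℂ)⁻¹) * planeWave z ε m‖ ≤ 2 * (Real.exp ε - 1) * ‖planeWave z ε m‖ := by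
  have s1 := coordSum_add_basisVec m j
  have s2 : coordSum (m - basisVec j) = coordSum m - 1 := by
    have := coordSum_add_basisVec (m - basisVec j) j
    rw [sub_add_cancel] at this
    linarith
  have n1 := abs_exp_sub_exp_le hε (abs_coordNorm_add_basisVec_sub m j)
  have n2 : |Real.exp (-ε * coordNorm (m - basisVec j)) - Real.exp (-ε * coordNorm m)| ≤
      (Real.exp ε - 1) * Real.exp (-ε * coordNorm m) := by
    refine abs_exp_sub_exp_le hε ?_
    have := abs_coordNorm_add_basisVec_sub (m - basisVec j) j
    rwa [sub_add_cancel, abs_sub_comm] at this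
  have e : planeWave z ε (m + basisVec j) + planeWave z ε (m - basisVec j) -
      ((z : ℂ) + (z : ℂ)⁻¹) * planeWave z ε m =
      ((z ^ (coordSum m + 1) : Circle) : ℂ) *
        ((Real.exp (-ε * coordNorm (m + basisVec j)) - Real.exp (-ε * coordNorm m) : ℝ) : ℂ) +
      ((z ^ (coordSum m - 1) : Circle) : ℂ) *
        ((Real.exp (-ε * coordNorm (m - basisVec j)) - Real.exp (-ε * coordNorm m) : ℝ) : ℂ) := by
    simp only [planeWave, s1, s2, zpow_add, zpow_sub, zpow_one, Circle.coe_mul, Circle.coe_inv,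
      Complex.ofReal_sub]
    ring
  rw [e, norm_planeWave]
  refine (norm_add_le _ _).trans ?_
  rw [norm_mul, norm_mul, Circle.norm_coe, Circle.norm_coe, Complex.norm_real, Complex.norm_real,
    Real.norm_eq_abs, Real.norm_eq_abs]
  linarith

theorem exists_circle_add_inv {η : ℝ} (h : |η| ≤ 2) : ∃ z : Circle, (z : ℂ) + (z : ℂ)⁻¹ = η := by
  obtain ⟨h1, h2⟩ := abs_le.1 h
  refine ⟨Circle.exp (Real.arccos (η / 2)), ?_⟩
  rw [← Circle.coe_inv, ← Circle.exp_neg, Circle.coe_exp, Circle.coe_exp]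
  have := Complex.two_cos (Real.arccos (η / 2) : ℂ)
  push_cast
  rw [← this, ← Complex.ofReal_cos, Real.cos_arccos (by linarith) (by linarith)]
  push_cast
  ring

theorem norm_le_of_pointwise {f g : StateSpace d₁ d₂} {K : ℝ} (hK : 0 ≤ K)
    (h : ∀ e, ‖g e‖ ≤ K * ‖f e‖) : ‖g‖ ≤ K * ‖f‖ := by
  refine lp.norm_le_of_tsum_le (by norm_num) (by positivity) ?_
  have hf := (lp.memℓp f).summable (p := 2) (by norm_num)
  have hg := (lp.memℓp g).summable (p := 2) (by norm_num)
  have hp : (0 : ℝ) < (2 : ENNReal).toReal := by norm_num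
  rw [Real.mul_rpow hK (norm_nonneg _), lp.norm_rpow_eq_tsum hp, ← tsum_mul_left]
  refine hg.tsum_le_tsum (fun e => ?_) (hf.mul_left _)
  rw [← Real.mul_rpow hK (norm_nonneg _)]
  exact Real.rpow_le_rpow (norm_nonneg _) (h e) hp.le

/-- If `|η| ≤ 2`, then `η = z + z⁻¹` with `|z| = 1`, and the plane wave with phase `z` in every
direction solves the free difference equation. Damping makes it square summable at the cost of an
error in the vertex conditions, which the bumps correct. The resulting state lies in the domain, and
its defect relative to its norm tends to zero with the damping, which contradicts boundedness below.
-/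
theorem two_lt_abs_hillDiscriminant (hq : MemLp q 2 (volume.restrict (Icc (0 : ℝ) 1)))
    (hd₁ : 1 ≤ d₁) {lam : ℝ} (hs : sOne q lam ≠ 0)
    (h : (lam : ℂ) ∉ opSpectrum (schrodinger q (fun _ : Vertex d₁ d₂ => 0))) :
    2 < |hillDiscriminant q lam| := by
  by_contra! hη
  obtain ⟨z, hz⟩ := exists_circle_add_inv hη
  have hs' : (sOne q lam : ℂ) ≠ 0 := by exact_mod_cast hs
  have hw : ((edgeSolution q lam 1 0).1 1 : ℂ) * (edgeSolution q lam 0 1).2 1 -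
      (edgeSolution q lam 1 0).2 1 * (edgeSolution q lam 0 1).1 1 = 1 := by
    exact_mod_cast wronskian_eq_one hq lam
  obtain ⟨K, hK0, hK⟩ := exists_norm_le_edgeComb hq lam
  obtain ⟨R, hR⟩ := exists_norm_le_of_notMem_opSpectrum h
  -- the size of the defect of the damped plane wave
  obtain ⟨ε, hε, h1, h2⟩ : ∃ ε > 0,
      2 * (Real.exp ε - 1) / |sOne q lam| * K * ‖toL2 bump‖ < 1 / 2 ∧
      |R| * (2 * (Real.exp ε - 1) / |sOne q lam| * ‖bumpImage q lam‖ * (2 * K)) < 1 := by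
    have hc : Continuous fun ε : ℝ => 2 * (Real.exp ε - 1) / |sOne q lam| := by fun_prop
    have t1 : Filter.Tendsto (fun ε : ℝ => 2 * (Real.exp ε - 1) / |sOne q lam|)
        (nhdsWithin 0 (Ioi 0)) (nhds 0) := by
      have := (hc.tendsto 0).mono_left (nhdsWithin_le_nhds (s := Ioi 0))
      simpa using this
    have t2 := (t1.mul_const K).mul_const ‖toL2 bump‖
    have t3 := ((t1.mul_const ‖bumpImage q lam‖).mul_const (2 * K)).const_mul |R|
    simp only [zero_mul, mul_zero] at t2 t3
    obtain ⟨ε, h1, h2, h3⟩ := ((t2.eventually_lt_const (by norm_num : (0 : ℝ) < 1 / 2)).and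
      ((t3.eventually_lt_const one_pos).and self_mem_nhdsWithin)).exists
    exact ⟨ε, h3, h1, h2⟩
  set δ : ℝ := 2 * (Real.exp ε - 1) / |sOne q lam| with hδ
  have hδ0 : 0 ≤ δ := by
    have := Real.add_one_le_exp ε
    exact div_nonneg (by linarith) (abs_nonneg _)
  set ξ : Vertex d₁ d₂ → ℂ := planeWave z ε with hξdef
  have hξ : Memℓp ξ 2 := memlp_planeWave z hε
  set A : Edge d₁ d₂ → ℂ := fun e =>
    (ξ (e.1 + basisVec e.2) - (edgeSolution q lam 1 0).1 1 * ξ e.1) / sOne q lam with hA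
  -- Chosen so that the derivatives at a vertex cancel in each direction separately.
  set B : Edge d₁ d₂ → ℂ := fun e =>
    -((ξ (e.1 + basisVec e.2) + ξ (e.1 - basisVec e.2) - hillDiscriminant q lam * ξ e.1) /
      sOne q lam) with hB
  have hX : Memℓp (fun e : Edge d₁ d₂ => ξ e.1) 2 := by
    simpa using memlp_edge hξ (fun _ => 0)
  have hBle : ∀ e, ‖B e‖ ≤ δ * ‖ξ e.1‖ := by
    intro e
    have := norm_planeWave_neighbor z hε.le e.1 e.2
    rw [hz] at this
    simp only [hB]
    rw [norm_neg, norm_div, Complex.norm_real, Real.norm_eq_abs, hδ, div_mul_eq_mul_div]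
    exact div_le_div_of_nonneg_right this (abs_nonneg _)
  have hAm : Memℓp A 2 := by
    have := ((memlp_edge hξ basisVec).sub (hX.const_mul ((edgeSolution q lam 1 0).1 1 : ℂ))).const_mul
      ((sOne q lam : ℂ)⁻¹)
    convert! this using 2 with e
    simp [hA, div_eq_inv_mul]
  obtain ⟨p, hp, hp1, hp2⟩ := exists_mem_opGraph hq lam (fun _ : Vertex d₁ d₂ => 0) hξ hAm
    (memlp_of_norm_le hX δ hBle)
    (fun m j => by
      change _ + _ * (sOne q lam : ℂ) = _
      simp only [hA]
      field_simp
      ring)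
    (fun m => by
      rw [← Finset.sum_sub_distrib]
      refine (Finset.sum_eq_zero fun j _ => ?_).trans (by simp)
      simp only [hA, hB]
      rw [sub_add_cancel, hillDiscriminant]
      push_cast
      have e : (sOne q lam : ℂ) = (edgeSolution q lam 0 1).1 1 := rfl
      rw [← e] at hw
      field_simp
      linear_combination (ξ (m - basisVec j)) * hw)
  -- The bump part of the state is at most half of `‖ξ‖` after multiplication by `K`, by the choice
  -- of `ε`, and is absorbed; this gives the factor `2 * K`.
  have hξle : ∀ e, ‖ξ e.1‖ ≤ 2 * K * ‖p.1 e‖ := by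
    intro e
    have k1 := (hK (ξ e.1) (A e)).1
    have k2 : ξ e.1 • cosL2 q lam + A e • sinL2 q lam = p.1 e - B e • toL2 bump := by
      rw [hp1 e, add_sub_cancel_right]
    rw [k2] at k1
    have k3 : ‖p.1 e - B e • toL2 bump‖ ≤ ‖p.1 e‖ + δ * ‖ξ e.1‖ * ‖toL2 bump‖ := by
      refine (norm_sub_le _ _).trans (add_le_add le_rfl ?_)
      rw [norm_smul]
      exact mul_le_mul_of_nonneg_right (hBle e) (norm_nonneg _)
    have k4 := mul_le_mul_of_nonneg_left k3 hK0.le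
    have k5 : δ * K * ‖toL2 bump‖ * ‖ξ e.1‖ ≤ 1 / 2 * ‖ξ e.1‖ :=
      mul_le_mul_of_nonneg_right h1.le (norm_nonneg _)
    nlinarith
  have hdef : ‖p.2 - (lam : ℂ) • p.1‖ ≤ δ * ‖bumpImage q lam‖ * (2 * K) * ‖p.1‖ := by
    refine norm_le_of_pointwise (by positivity) fun e => ?_
    have : (p.2 - (lam : ℂ) • p.1) e = B e • bumpImage q lam := by
      change p.2 e - (lam : ℂ) • p.1 e = _
      rw [hp2 e, add_sub_cancel_left]
    rw [this, norm_smul]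
    calc ‖B e‖ * ‖bumpImage q lam‖ ≤ (δ * (2 * K * ‖p.1 e‖)) * ‖bumpImage q lam‖ := by
          gcongr
          exact (hBle e).trans (mul_le_mul_of_nonneg_left (hξle e) hδ0)
      _ = _ := by ring
  have hp0 : 0 < ‖p.1‖ := by
    rw [norm_pos_iff]
    intro h0
    have := hξle (0, Sum.inl ⟨0, hd₁⟩)
    rw [h0] at this
    simp only [hξdef, norm_planeWave] at this
    have h3 := Real.exp_pos (-ε * coordNorm (0 : Vertex d₁ d₂))
    have h4 : ‖((0 : StateSpace d₁ d₂) (0, Sum.inl ⟨0, hd₁⟩) : L2)‖ = 0 := norm_zero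
    rw [h4] at this
    linarith
  have hfin : ‖p.1‖ < ‖p.1‖ := by
    calc ‖p.1‖ ≤ R * ‖p.2 - (lam : ℂ) • p.1‖ := hR p hp
      _ ≤ |R| * ‖p.2 - (lam : ℂ) • p.1‖ :=
          mul_le_mul_of_nonneg_right (le_abs_self R) (norm_nonneg _)
      _ ≤ |R| * (δ * ‖bumpImage q lam‖ * (2 * K) * ‖p.1‖) :=
          mul_le_mul_of_nonneg_left hdef (abs_nonneg R)
      _ = (|R| * (δ * ‖bumpImage q lam‖ * (2 * K))) * ‖p.1‖ := by ring
      _ < 1 * ‖p.1‖ := mul_lt_mul_of_pos_right h2 hp0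
      _ = ‖p.1‖ := one_mul _
  exact lt_irrefl _ hfin

end Spectrum

/-! ### Fourier coefficients on the torus -/

section Torus

attribute [local instance] instMeasureSpaceUnitAddCircle instIsAddHaarMeasureUnitAddCircleVolume
  instIsProbabilityMeasureUnitAddCircleVolume

open UnitAddTorus

variable {ι κ : Type*} [Fintype ι] [Fintype κ]

theorem measurePreserving_torusSum :
    MeasurePreserving (fun θ : UnitAddTorus (ι ⊕ κ) =>
      ((fun i => θ (Sum.inl i), fun k => θ (Sum.inr k)) : UnitAddTorus ι × UnitAddTorus κ))
      volume volume :=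
  measurePreserving_sumPiEquivProdPi (X := fun _ : ι ⊕ κ => UnitAddCircle) fun _ => volume

theorem measurePreserving_torusInr :
    MeasurePreserving (fun θ : UnitAddTorus (ι ⊕ κ) => (fun k => θ (Sum.inr k) : UnitAddTorus κ))
      volume volume :=
  (measurePreserving_snd (μ := (volume : Measure (UnitAddTorus ι)))
    (ν := (volume : Measure (UnitAddTorus κ)))).comp measurePreserving_torusSum

theorem integral_torusSum {Φ : UnitAddTorus ι × UnitAddTorus κ → ℂ} (hΦ : Integrable Φ) :
    ∫ θ : UnitAddTorus (ι ⊕ κ), Φ (fun i => θ (Sum.inl i), fun k => θ (Sum.inr k)) =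
      ∫ y : UnitAddTorus κ, ∫ x : UnitAddTorus ι, Φ (x, y) := by
  rw [← integral_prod_symm Φ hΦ]
  exact measurePreserving_torusSum.integral_comp
    (MeasurableEquiv.sumPiEquivProdPi fun _ : ι ⊕ κ => UnitAddCircle).measurableEmbedding Φ

theorem mFourier_mul_memLp {F : UnitAddTorus ι → ℂ} (hF : MemLp F 2) {m : UnitAddTorus ι → ℂ}
    (hm : Continuous m) : MemLp (fun θ => m θ * F θ) 2 := by
  obtain ⟨C, hC⟩ := isCompact_univ.exists_bound_of_continuousOn hm.continuousOn
  refine MemLp.of_le_mul (c := C) hF (hm.aestronglyMeasurable.mul hF.aestronglyMeasurable) ?_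
  refine Filter.Eventually.of_forall fun θ => ?_
  rw [norm_mul]
  exact mul_le_mul_of_nonneg_right (hC θ (mem_univ _)) (norm_nonneg _)

theorem integrable_mFourier_mul {F : UnitAddTorus ι → ℂ} (hF : MemLp F 2) (n : ι → ℤ) :
    Integrable fun θ => mFourier n θ • F θ :=
  (mFourier_mul_memLp hF (mFourier n).continuous).integrable (by norm_num)

theorem mFourierCoeff_congr {F G : UnitAddTorus ι → ℂ} (h : F =ᵐ[volume] G) (n : ι → ℤ) :
    mFourierCoeff F n = mFourierCoeff G n :=
  integral_congr_ae (by filter_upwards [h] with θ hθ; rw [hθ])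

theorem mFourierCoeff_add {F G : UnitAddTorus ι → ℂ} (hF : MemLp F 2) (hG : MemLp G 2)
    (n : ι → ℤ) : mFourierCoeff (fun θ => F θ + G θ) n = mFourierCoeff F n + mFourierCoeff G n := by
  simp only [mFourierCoeff, smul_add]
  exact integral_add (integrable_mFourier_mul hF _) (integrable_mFourier_mul hG _)

theorem mFourierCoeff_const_mul (F : UnitAddTorus ι → ℂ) (c : ℂ) (n : ι → ℤ) :
    mFourierCoeff (fun θ => c * F θ) n = c * mFourierCoeff F n := by
  simp only [mFourierCoeff, smul_eq_mul, mul_left_comm _ c]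
  exact integral_const_mul _ _

theorem mFourierCoeff_sub {F G : UnitAddTorus ι → ℂ} (hF : MemLp F 2) (hG : MemLp G 2)
    (n : ι → ℤ) : mFourierCoeff (fun θ => F θ - G θ) n = mFourierCoeff F n - mFourierCoeff G n := by
  simp only [mFourierCoeff, smul_sub]
  exact integral_sub (integrable_mFourier_mul hF _) (integrable_mFourier_mul hG _)

theorem mFourierCoeff_sum {J : Type*} (s : Finset J) {F : J → UnitAddTorus ι → ℂ}
    (hF : ∀ j ∈ s, MemLp (F j) 2) (n : ι → ℤ) :
    mFourierCoeff (fun θ => ∑ j ∈ s, F j θ) n = ∑ j ∈ s, mFourierCoeff (F j) n := by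
  simp only [mFourierCoeff, Finset.smul_sum]
  exact integral_finsetSum _ fun j hj => integrable_mFourier_mul (hF j hj) _

theorem mFourierCoeff_mFourier_mul (F : UnitAddTorus ι → ℂ) (k n : ι → ℤ) :
    mFourierCoeff (fun θ => mFourier k θ * F θ) n = mFourierCoeff F (n - k) := by
  simp only [mFourierCoeff, smul_eq_mul, ← mul_assoc]
  refine integral_congr_ae (Filter.Eventually.of_forall fun θ => ?_)
  simp only
  rw [← mFourier_add]
  congr 3
  abel

/-- A quasiperiodic phase on the lattice is a translation of the torus. After the Cayley transform
this is what the tangent potential turns into. -/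
theorem mFourierCoeff_translate (F : UnitAddTorus ι → ℂ) (t : UnitAddTorus ι) (n : ι → ℤ) :
    mFourierCoeff (fun θ => F (θ + t)) n = mFourier n t * mFourierCoeff F n := by
  have e : ∀ θ : UnitAddTorus ι, mFourier (-n) θ • F (θ + t) =
      mFourier n t * (mFourier (-n) (θ + t) • F (θ + t)) := by
    intro θ
    have h1 : mFourier (-n) (θ + t) = mFourier (-n) θ * mFourier (-n) t := by
      simp [mFourier, fourier_apply, AddCircle.toCircle_add, Finset.prod_mul_distrib,
        smul_add]
    have h2 : mFourier n t * mFourier (-n) t = 1 := by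
      rw [← mFourier_add, add_neg_cancel, mFourier_zero]
      rfl
    rw [h1, smul_eq_mul, smul_eq_mul]
    linear_combination (-(mFourier (-n) θ * F (θ + t))) * h2
  simp only [mFourierCoeff, e]
  rw [integral_const_mul]
  congr 1
  exact integral_add_right_eq_self (fun θ => mFourier (-n) θ • F θ) t

theorem ae_eq_zero_of_mFourierCoeff {F : UnitAddTorus ι → ℂ} (hF : MemLp F 2)
    (h : ∀ n, mFourierCoeff F n = 0) : F =ᵐ[volume] 0 := by
  have h0 : hF.toLp = 0 := by
    apply (mFourierBasis (d := ι)).repr.injective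
    ext n
    rw [mFourierBasis_repr, mFourierCoeff_congr hF.coeFn_toLp, h n, map_zero]
    rfl
  have := hF.coeFn_toLp
  rw [h0] at this
  exact this.symm.trans (Lp.coeFn_zero _ _ _)

theorem ae_eq_of_mFourierCoeff {F G : UnitAddTorus ι → ℂ} (hF : MemLp F 2) (hG : MemLp G 2)
    (h : ∀ n, mFourierCoeff F n = mFourierCoeff G n) : F =ᵐ[volume] G := by
  have := ae_eq_zero_of_mFourierCoeff (hF.sub hG) fun n => by
    rw [← sub_eq_zero.2 (h n), ← mFourierCoeff_sub hF hG]
    rfl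
  filter_upwards [this] with θ hθ
  exact sub_eq_zero.1 hθ

theorem exists_mFourierCoeff_eq {ξ : (ι → ℤ) → ℂ} (hξ : Memℓp ξ 2) :
    ∃ F : UnitAddTorus ι → ℂ, MemLp F 2 ∧ ∀ n, mFourierCoeff F n = ξ n := by
  refine ⟨(mFourierBasis (d := ι)).repr.symm ⟨ξ, hξ⟩, Lp.memLp _, fun n => ?_⟩
  rw [← mFourierBasis_repr, LinearIsometryEquiv.apply_symm_apply]

theorem memlp_mFourierCoeff {F : UnitAddTorus ι → ℂ} (hF : MemLp F 2) :
    Memℓp (mFourierCoeff F) 2 := by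
  have := lp.memℓp ((mFourierBasis (d := ι)).repr hF.toLp)
  convert! this using 1
  funext n
  rw [mFourierBasis_repr, mFourierCoeff_congr hF.coeFn_toLp]

/-! ### The symbol of the discrete Laplacian -/

/-- The symbol `∑ⱼ (θⱼ + θⱼ⁻¹)` on the torus. -/
def torusSymbol (θ : UnitAddTorus ι) : ℝ := ∑ j, 2 * (fourier 1 (θ j) : ℂ).re

theorem continuous_torusSymbol : Continuous (torusSymbol : UnitAddTorus ι → ℝ) := by
  unfold torusSymbol
  fun_prop

theorem abs_torusSymbol_le (θ : UnitAddTorus ι) : |torusSymbol θ| ≤ 2 * Fintype.card ι := by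
  refine (Finset.abs_sum_le_sum_abs _ _).trans ?_
  refine (Finset.sum_le_sum (g := fun _ => (2 : ℝ)) fun j _ => ?_).trans (by simp [mul_comm])
  rw [abs_mul, abs_two]
  have := Complex.abs_re_le_norm (fourier 1 (θ j) : ℂ)
  rw [fourier_apply, Circle.norm_coe] at this
  rw [fourier_apply]
  linarith

theorem torusSymbol_coe [DecidableEq ι] (θ : UnitAddTorus ι) : (torusSymbol θ : ℂ) =
    ∑ j, (mFourier (Pi.single j 1) θ + mFourier (-Pi.single j 1) θ) := by
  rw [torusSymbol]
  push_cast
  refine Finset.sum_congr rfl fun j _ => ?_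
  rw [mFourier_neg, Complex.add_conj, mFourier_single]
  push_cast
  ring

theorem torusSymbol_mk {n : ℕ} (x : Fin n → ℝ) :
    torusSymbol (fun j => (x j : UnitAddCircle)) = latticeSymbol x := by
  refine Finset.sum_congr rfl fun j _ => ?_
  have h := AddCircle.toCircle_apply_mk (T := 1) (x j)
  rw [fourier_one, h, Circle.coe_exp, Complex.exp_ofReal_mul_I_re, div_one]

theorem mFourierCoeff_torusSymbol_mul [DecidableEq ι] {F : UnitAddTorus ι → ℂ} (hF : MemLp F 2)
    (n : ι → ℤ) : mFourierCoeff (fun θ => (torusSymbol θ : ℂ) * F θ) n =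
      ∑ j, (mFourierCoeff F (n + Pi.single j 1) + mFourierCoeff F (n - Pi.single j 1)) := by
  have h : ∀ k : ι → ℤ, MemLp (fun θ => mFourier k θ * F θ) 2 := fun k =>
    mFourier_mul_memLp hF (mFourier k).continuous
  simp only [torusSymbol_coe, Finset.sum_mul, add_mul]
  rw [mFourierCoeff_sum (F := fun j θ => mFourier (Pi.single j 1) θ * F θ +
    mFourier (-Pi.single j 1) θ * F θ) Finset.univ fun j _ => (h _).add (h _)]
  refine Finset.sum_congr rfl fun j _ => ?_
  rw [mFourierCoeff_add (h _) (h _), mFourierCoeff_mFourier_mul, mFourierCoeff_mFourier_mul,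
    sub_neg_eq_add, add_comm]

theorem torusSymbol_sum (θ : UnitAddTorus (ι ⊕ κ)) :
    torusSymbol θ = torusSymbol (fun i => θ (Sum.inl i)) + torusSymbol (fun k => θ (Sum.inr k)) := by
  simp [torusSymbol]

theorem mFourier_sum (n : ι ⊕ κ → ℤ) (θ : UnitAddTorus (ι ⊕ κ)) :
    mFourier n θ = mFourier (fun i => n (Sum.inl i)) (fun i => θ (Sum.inl i)) *
      mFourier (fun k => n (Sum.inr k)) (fun k => θ (Sum.inr k)) := by
  simp [mFourier]

/-! ### The lattice resolvent with a source on the surface -/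

/-- The function on the torus obtained from integrating out the first variables. -/
def torusGreen (ι : Type*) [Fintype ι] (μ : ℝ) : ℝ :=
  ∫ x : UnitAddTorus ι, (torusSymbol x - μ)⁻¹

theorem torusSymbol_sub_ne_zero {μ : ℝ} (hμ : 2 * (Fintype.card ι : ℝ) < |μ|) (θ : UnitAddTorus ι) :
    torusSymbol θ - μ ≠ 0 := by
  intro h
  have := abs_torusSymbol_le θ
  rw [sub_eq_zero.1 h] at this
  linarith

/-- Integration over the first variables kills every nonconstant character in them. A source on the
surface thus corresponds to a function on the torus that does not depend on the first variables. -/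
theorem mFourierCoeff_comp_inr [DecidableEq ι] {f : UnitAddTorus κ → ℂ} (hf : MemLp f 2)
    (n : ι ⊕ κ → ℤ) :
    mFourierCoeff (fun θ : UnitAddTorus (ι ⊕ κ) => f fun k => θ (Sum.inr k)) n =
      if (fun i => n (Sum.inl i)) = 0 then mFourierCoeff f (fun k => n (Sum.inr k)) else 0 := by
  have h1 : Integrable (fun p : UnitAddTorus ι × UnitAddTorus κ =>
      mFourier (-fun i => n (Sum.inl i)) p.1 *
        (mFourier (-fun k => n (Sum.inr k)) p.2 • f p.2)) :=
    Integrable.mul_prod (((mFourier _).continuous.integrable_of_hasCompactSupport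
      (HasCompactSupport.of_compactSpace _))) (integrable_mFourier_mul hf _)
  have h2 := integral_torusSum h1
  simp only [integral_const_mul, integral_mul_const] at h2
  have h3 : mFourierCoeff (fun θ : UnitAddTorus (ι ⊕ κ) => f fun k => θ (Sum.inr k)) n =
      (∫ x : UnitAddTorus ι, mFourier (-fun i => n (Sum.inl i)) x) *
        mFourierCoeff f (fun k => n (Sum.inr k)) := by
    rw [mFourierCoeff, mFourierCoeff, ← h2]
    refine integral_congr_ae (Filter.Eventually.of_forall fun θ => ?_)
    simp only [smul_eq_mul]
    rw [mFourier_sum, mul_assoc]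
    rfl
  have h4 : ∫ x : UnitAddTorus ι, mFourier (-fun i => n (Sum.inl i)) x =
      if (fun i => n (Sum.inl i)) = 0 then 1 else 0 := by
    have h5 := mFourierCoeff_toLp (mFourier (0 : ι → ℤ)) (fun i => n (Sum.inl i))
    have h6 : mFourierCoeff (mFourier (0 : ι → ℤ)) (fun i => n (Sum.inl i)) =
        ∫ x : UnitAddTorus ι, mFourier (-fun i => n (Sum.inl i)) x := by
      simp [mFourierCoeff, mFourier_zero]
    rw [← h6, ← h5, ← mFourierBasis_repr]
    have h7 : (mFourier (0 : ι → ℤ)).toLp 2 volume ℂ = mFourierBasis (d := ι) 0 := by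
      rw [coe_mFourierBasis]
    rw [h7, HilbertBasis.repr_self, lp.single_apply]
    simp only [Pi.single_apply]
  rw [h3, h4]
  split_ifs <;> simp

/-- The function `f(θ₂) / (Δ(θ) - μ)` on the torus. -/
def torusResolvent (ι : Type*) {κ : Type*} [Fintype ι] [Fintype κ] (μ : ℝ) (f : UnitAddTorus κ → ℂ)
    (θ : UnitAddTorus (ι ⊕ κ)) : ℂ :=
  ((torusSymbol θ - μ)⁻¹ : ℝ) * f fun k => θ (Sum.inr k)

theorem memLp_torusResolvent {μ : ℝ} (hμ : 2 * (Fintype.card (ι ⊕ κ) : ℝ) < |μ|)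
    {f : UnitAddTorus κ → ℂ} (hf : MemLp f 2) : MemLp (torusResolvent ι μ f) 2 :=
  mFourier_mul_memLp (hf.comp_measurePreserving measurePreserving_torusInr)
    (Complex.continuous_ofReal.comp ((continuous_torusSymbol.sub continuous_const).inv₀
      (torusSymbol_sub_ne_zero hμ)))

/-- The restriction to the surface corresponds to integrating out the other variables. -/
theorem mFourierCoeff_torusResolvent {μ : ℝ} (hμ : 2 * (Fintype.card (ι ⊕ κ) : ℝ) < |μ|)
    {f : UnitAddTorus κ → ℂ} (hf : MemLp f 2) (n : κ → ℤ) :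
    mFourierCoeff (torusResolvent ι μ f) (Sum.elim 0 n) =
      mFourierCoeff (fun y => (torusGreen ι (μ - torusSymbol y) : ℂ) * f y) n := by
  have hne : ∀ p : UnitAddTorus ι × UnitAddTorus κ, torusSymbol p.1 - (μ - torusSymbol p.2) ≠ 0 := by
    intro p h
    have h1 := torusSymbol_sub_ne_zero (ι := ι ⊕ κ) hμ (Sum.elim p.1 p.2)
    rw [torusSymbol_sum] at h1
    apply h1
    simp only [Sum.elim_inl, Sum.elim_inr]
    linarith
  have hc : Continuous fun p : UnitAddTorus ι × UnitAddTorus κ =>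
      (((torusSymbol p.1 - (μ - torusSymbol p.2))⁻¹ : ℝ) : ℂ) :=
    Complex.continuous_ofReal.comp ((((continuous_torusSymbol.comp continuous_fst).sub
      (continuous_const.sub (continuous_torusSymbol.comp continuous_snd)))).inv₀ hne)
  obtain ⟨C, hC⟩ := isCompact_univ.exists_bound_of_continuousOn hc.continuousOn
  have h0 : Integrable (fun p : UnitAddTorus ι × UnitAddTorus κ =>
      (1 : ℂ) * (mFourier (-n) p.2 • f p.2)) :=
    Integrable.mul_prod (f := fun _ => (1 : ℂ)) (integrable_const 1) (integrable_mFourier_mul hf _)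
  have h1 : Integrable (fun p : UnitAddTorus ι × UnitAddTorus κ =>
      (((torusSymbol p.1 - (μ - torusSymbol p.2))⁻¹ : ℝ) : ℂ) *
        ((1 : ℂ) * (mFourier (-n) p.2 • f p.2))) :=
    h0.bdd_mul hc.aestronglyMeasurable (Filter.Eventually.of_forall fun p => hC p (mem_univ _))
  have h2 := integral_torusSum h1
  simp only [one_mul, integral_mul_const, integral_complex_ofReal] at h2
  rw [mFourierCoeff, mFourierCoeff]
  refine Eq.trans ?_ (h2.trans ?_)
  · refine integral_congr_ae (Filter.Eventually.of_forall fun θ => ?_)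
    simp only [torusResolvent, smul_eq_mul]
    rw [mFourier_sum, torusSymbol_sum]
    have e1 : mFourier (fun i => (-Sum.elim (0 : ι → ℤ) n) (Sum.inl i))
        (fun i => θ (Sum.inl i)) = 1 := by
      have : (fun i => (-Sum.elim (0 : ι → ℤ) n) (Sum.inl i)) = 0 := by ext; simp
      rw [this, mFourier_zero]
      rfl
    have e2 : (fun k => (-Sum.elim (0 : ι → ℤ) n) (Sum.inr k)) = -n := by ext; simp
    rw [e1, e2]
    push_cast
    ring
  · refine integral_congr_ae (Filter.Eventually.of_forall fun y => ?_)
    simp only [torusGreen, smul_eq_mul]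
    ring

/-- The lattice equation `(Δ - μ) ξ = δ ⊗ ψ` in Fourier space. -/
theorem ae_eq_torusResolvent [DecidableEq ι] [DecidableEq κ] {μ : ℝ}
    (hμ : 2 * (Fintype.card (ι ⊕ κ) : ℝ) < |μ|) {f : UnitAddTorus κ → ℂ} (hf : MemLp f 2)
    {Ξ : UnitAddTorus (ι ⊕ κ) → ℂ} (hΞ : MemLp Ξ 2)
    (h : ∀ n : ι ⊕ κ → ℤ, ∑ j, (mFourierCoeff Ξ (n + Pi.single j 1) +
      mFourierCoeff Ξ (n - Pi.single j 1)) - μ * mFourierCoeff Ξ n =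
      if (fun i => n (Sum.inl i)) = 0 then mFourierCoeff f (fun k => n (Sum.inr k)) else 0) :
    Ξ =ᵐ[volume] torusResolvent ι μ f := by
  have h1 : MemLp (fun θ => (torusSymbol θ : ℂ) * Ξ θ) 2 :=
    mFourier_mul_memLp hΞ (Complex.continuous_ofReal.comp continuous_torusSymbol)
  have h2 := ae_eq_of_mFourierCoeff (h1.sub (hΞ.const_mul (μ : ℂ)))
    (hf.comp_measurePreserving measurePreserving_torusInr) fun n => by
      have e := mFourierCoeff_comp_inr hf n
      rw [← h n] at e
      refine Eq.trans ?_ e.symm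
      refine (mFourierCoeff_sub h1 (hΞ.const_mul (μ : ℂ)) n).trans ?_
      rw [mFourierCoeff_torusSymbol_mul hΞ, mFourierCoeff_const_mul]
  filter_upwards [h2] with θ hθ
  have hne : ((torusSymbol θ - μ : ℝ) : ℂ) ≠ 0 := by
    exact_mod_cast torusSymbol_sub_ne_zero hμ θ
  rw [torusResolvent, Complex.ofReal_inv, eq_inv_mul_iff_mul_eq₀ hne]
  have h3 : (torusSymbol θ : ℂ) * Ξ θ - μ * Ξ θ = f fun k => θ (Sum.inr k) := hθ
  rw [← h3]
  push_cast
  ring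

/-- The converse of `ae_eq_torusResolvent`: multiplication by `Δ - μ` cancels the denominator. -/
theorem mFourierCoeff_torusResolvent_equation [DecidableEq ι] [DecidableEq κ] {μ : ℝ}
    (hμ : 2 * (Fintype.card (ι ⊕ κ) : ℝ) < |μ|) {f : UnitAddTorus κ → ℂ} (hf : MemLp f 2)
    (n : ι ⊕ κ → ℤ) :
    ∑ j, (mFourierCoeff (torusResolvent ι μ f) (n + Pi.single j 1) +
      mFourierCoeff (torusResolvent ι μ f) (n - Pi.single j 1)) -
      μ * mFourierCoeff (torusResolvent ι μ f) n =
      if (fun i => n (Sum.inl i)) = 0 then mFourierCoeff f (fun k => n (Sum.inr k)) else 0 := by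
  have hΞ := memLp_torusResolvent hμ hf
  have h1 : MemLp (fun θ => (torusSymbol θ : ℂ) * torusResolvent ι μ f θ) 2 :=
    mFourier_mul_memLp hΞ (Complex.continuous_ofReal.comp continuous_torusSymbol)
  rw [← mFourierCoeff_torusSymbol_mul hΞ, ← mFourierCoeff_const_mul,
    ← mFourierCoeff_sub h1 (hΞ.const_mul (μ : ℂ)), ← mFourierCoeff_comp_inr hf]
  congr 1
  funext θ
  have hne : ((torusSymbol θ - μ : ℝ) : ℂ) ≠ 0 := by
    exact_mod_cast torusSymbol_sub_ne_zero hμ θ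
  rw [← sub_mul, torusResolvent, Complex.ofReal_inv, ← mul_assoc]
  push_cast at hne ⊢
  rw [mul_inv_cancel₀ hne, one_mul]

/-- The averages over the torus agree with the integrals over the unit cube. -/
theorem integral_torus_eq {n : ℕ} {E : Type*} [NormedAddCommGroup E] [NormedSpace ℝ E]
    (F : UnitAddTorus (Fin n) → E) :
    ∫ θ, F θ = ∫ x in Icc (0 : Fin n → ℝ) 1, F fun j => (x j : UnitAddCircle) := by
  rw [integral_preimage F 0]
  have h : {x : Fin n → ℝ | ∀ i, x i ∈ Ioc ((0 : Fin n → ℝ) i) ((0 : Fin n → ℝ) i + 1)} =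
      Set.univ.pi fun i => Ioc ((0 : Fin n → ℝ) i) ((1 : Fin n → ℝ) i) := by
    ext x
    simp
  rw [h]
  exact setIntegral_congr_set Measure.univ_pi_Ioc_ae_eq_Icc

theorem torusGreen_eq (n : ℕ) (μ : ℝ) : torusGreen (Fin n) μ = greenDiag n μ := by
  rw [torusGreen, greenDiag, torusAverage, integral_torus_eq]
  simp only [torusSymbol_mk]

end Torus

/-! ### Reduction of the difference equation to the surface -/

section Surface

attribute [local instance] instMeasureSpaceUnitAddCircle instIsAddHaarMeasureUnitAddCircleVolume
  instIsProbabilityMeasureUnitAddCircleVolume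

open UnitAddTorus

variable {d₁ d₂ : ℕ}

/-- A vertex as a function on the set of directions. -/
def vertexEquiv : Vertex d₁ d₂ ≃ (Dir d₁ d₂ → ℤ) :=
  (Equiv.sumArrowEquivProdArrow (Fin d₁) (Fin d₂) ℤ).symm

theorem vertexEquiv_apply (m : Vertex d₁ d₂) : vertexEquiv m = Sum.elim m.1 m.2 := rfl

theorem vertexEquiv_basisVec (j : Dir d₁ d₂) : vertexEquiv (basisVec j) = Pi.single j 1 := by
  rcases j with j | j <;> ext k <;> rcases k with k | k <;>
    simp [vertexEquiv_apply, basisVec, Pi.single_apply]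

theorem vertexEquiv_add (m n : Vertex d₁ d₂) :
    vertexEquiv (m + n) = vertexEquiv m + vertexEquiv n := by
  ext k
  rcases k with k | k <;> simp [vertexEquiv_apply]

theorem vertexEquiv_sub (m n : Vertex d₁ d₂) :
    vertexEquiv (m - n) = vertexEquiv m - vertexEquiv n := by
  ext k
  rcases k with k | k <;> simp [vertexEquiv_apply]

theorem neighborSum_comp_vertexEquiv (X : (Dir d₁ d₂ → ℤ) → ℂ) (m : Vertex d₁ d₂) :
    neighborSum (fun m => X (vertexEquiv m)) m =
      ∑ j, (X (vertexEquiv m + Pi.single j 1) + X (vertexEquiv m - Pi.single j 1)) := by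
  simp only [neighborSum, vertexEquiv_add, vertexEquiv_sub, vertexEquiv_basisVec]

theorem card_dir_real : (Fintype.card (Fin d₁ ⊕ Fin d₂) : ℝ) = ((d₁ + d₂ : ℕ) : ℝ) := by
  simp

/-- The decaying solution of `(Δ - μ) ξ = δ ⊗ ψ`. -/
def latticeResolvent (μ : ℝ) (f : UnitAddTorus (Fin d₂) → ℂ) (m : Vertex d₁ d₂) : ℂ :=
  mFourierCoeff (torusResolvent (Fin d₁) μ f) (vertexEquiv m)

/-- Because `|μ|` exceeds the maximum `2d` of the symbol, division in Fourier space leaves a single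
square-summable solution. -/
theorem eq_latticeResolvent {μ : ℝ} (hμ : 2 * ((d₁ + d₂ : ℕ) : ℝ) < |μ|)
    {f : UnitAddTorus (Fin d₂) → ℂ} (hf : MemLp f 2) {ξ : Vertex d₁ d₂ → ℂ} (hξ : Memℓp ξ 2)
    (h : ∀ m, neighborSum ξ m - μ * ξ m = if m.1 = 0 then mFourierCoeff f m.2 else 0) :
    ξ = latticeResolvent μ f := by
  obtain ⟨Ξ, hΞ, hc⟩ := exists_mFourierCoeff_eq (ξ := fun n => ξ (vertexEquiv.symm n))
    (memlp_comp_injective hξ vertexEquiv.symm.injective)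
  have hξe : ξ = fun m => mFourierCoeff Ξ (vertexEquiv m) := by
    funext m
    rw [hc, Equiv.symm_apply_apply]
  have := ae_eq_torusResolvent (by rwa [card_dir_real]) hf hΞ fun n => by
    have h1 := h (vertexEquiv.symm n)
    rw [hξe, neighborSum_comp_vertexEquiv] at h1
    simp only [Equiv.apply_symm_apply] at h1
    exact h1
  rw [hξe]
  funext m
  exact mFourierCoeff_congr this _

theorem latticeResolvent_memlp {μ : ℝ} (hμ : 2 * ((d₁ + d₂ : ℕ) : ℝ) < |μ|)
    {f : UnitAddTorus (Fin d₂) → ℂ} (hf : MemLp f 2) :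
    Memℓp (latticeResolvent μ f : Vertex d₁ d₂ → ℂ) 2 :=
  memlp_comp_injective (memlp_mFourierCoeff (memLp_torusResolvent (by rwa [card_dir_real]) hf))
    vertexEquiv.injective

theorem latticeResolvent_equation {μ : ℝ} (hμ : 2 * ((d₁ + d₂ : ℕ) : ℝ) < |μ|)
    {f : UnitAddTorus (Fin d₂) → ℂ} (hf : MemLp f 2) (m : Vertex d₁ d₂) :
    neighborSum (latticeResolvent μ f) m - μ * latticeResolvent μ f m =
      if m.1 = 0 then mFourierCoeff f m.2 else 0 := by
  have := mFourierCoeff_torusResolvent_equation (ι := Fin d₁) (by rwa [card_dir_real]) hf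
    (vertexEquiv m)
  rw [← neighborSum_comp_vertexEquiv (fun n => mFourierCoeff (torusResolvent (Fin d₁) μ f) n)]
    at this
  exact this

theorem latticeResolvent_surface {μ : ℝ} (hμ : 2 * ((d₁ + d₂ : ℕ) : ℝ) < |μ|)
    {f : UnitAddTorus (Fin d₂) → ℂ} (hf : MemLp f 2) (n : Fin d₂ → ℤ) :
    latticeResolvent μ f ((0, n) : Vertex d₁ d₂) =
      mFourierCoeff (fun y => (torusGreen (Fin d₁) (μ - torusSymbol y) : ℂ) * f y) n :=
  mFourierCoeff_torusResolvent (by rwa [card_dir_real]) hf n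

/-- `N(θ, λ)` as a function on the torus. -/
def torusN (d₁ : ℕ) {d₂ : ℕ} (q : ℝ → ℝ) (lam : ℝ) (θ : UnitAddTorus (Fin d₂)) : ℝ :=
  -sOne q lam * torusGreen (Fin d₁) (((d₁ + d₂ : ℕ) : ℝ) * hillDiscriminant q lam - torusSymbol θ)

theorem torusN_mk (q : ℝ → ℝ) (lam : ℝ) (x : Fin d₂ → ℝ) :
    torusN d₁ q lam (fun j => (x j : UnitAddCircle)) = symbolN d₁ q x lam := by
  rw [torusN, symbolN, torusGreen_eq, torusSymbol_mk]

/-- The equation `tan(x n) ψ(n) = (M ψ)(n)` in terms of the Fourier transform `f` of `ψ`. -/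
structure IsMarylandSolution {κ : Type*} [Fintype κ] (M : UnitAddTorus κ → ℝ) (x : (κ → ℤ) → ℝ)
    (f : UnitAddTorus κ → ℂ) : Prop where
  memLp : MemLp f 2
  equation : ∀ n, (Real.sin (x n) : ℂ) * mFourierCoeff f n =
    Real.cos (x n) * mFourierCoeff (fun θ => (M θ : ℂ) * f θ) n

/-- The dual phase `π (ω'·n + φ')`. -/
def dualPhase (g : ℝ) (ω : Fin d₂ → ℝ) (φ : ℝ) (n : Fin d₂ → ℤ) : ℝ :=
  Real.pi * (∑ i, Real.sign g * ω i * (n i : ℝ) + (Real.sign g * φ + 1 / 2))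

/-- The summand `1 / 2` in `φ'` is a quarter turn, which exchanges sine and cosine and so replaces
the tangent by its negative reciprocal; the sign of `g` keeps the new coupling `1 / |g|` positive.
-/
theorem dualPhase_eq (g : ℝ) (ω : Fin d₂ → ℝ) (φ : ℝ) (n : Fin d₂ → ℤ) :
    dualPhase g ω φ n =
      Real.sign g * (Real.pi * (∑ i, ω i * (n i : ℝ) + φ)) + Real.pi / 2 := by
  have : ∑ i, Real.sign g * ω i * (n i : ℝ) = Real.sign g * ∑ i, ω i * (n i : ℝ) := by
    rw [Finset.mul_sum]
    exact Finset.sum_congr rfl fun i _ => by ring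
  rw [dualPhase, this]
  ring

theorem sin_dualPhase {g : ℝ} (hg : g ≠ 0) (ω : Fin d₂ → ℝ) (φ : ℝ) (n : Fin d₂ → ℤ) :
    Real.sin (dualPhase g ω φ n) = Real.cos (Real.pi * (∑ i, ω i * (n i : ℝ) + φ)) := by
  rw [dualPhase_eq, Real.sin_add_pi_div_two]
  rcases hg.lt_or_gt with h | h
  · rw [Real.sign_of_neg h, neg_one_mul, Real.cos_neg]
  · rw [Real.sign_of_pos h, one_mul]

theorem cos_dualPhase {g : ℝ} (hg : g ≠ 0) (ω : Fin d₂ → ℝ) (φ : ℝ) (n : Fin d₂ → ℤ) :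
    Real.cos (dualPhase g ω φ n) =
      -(g / |g|) * Real.sin (Real.pi * (∑ i, ω i * (n i : ℝ) + φ)) := by
  rw [dualPhase_eq, Real.cos_add_pi_div_two]
  rcases hg.lt_or_gt with h | h
  · rw [Real.sign_of_neg h, neg_one_mul, Real.sin_neg, abs_of_neg h, div_neg, div_self hg]
    ring
  · rw [Real.sign_of_pos h, one_mul, abs_of_pos h, div_self hg]
    ring

theorem sin_phase_ne_zero {ω : Fin d₂ → ℝ} {φ : ℝ}
    (hφ : ∀ (m : Fin d₂ → ℤ) (k : ℤ), φ ≠ ∑ i, ω i * (m i : ℝ) + (k : ℝ) / 2) (n : Fin d₂ → ℤ) :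
    Real.sin (Real.pi * (∑ i, ω i * (n i : ℝ) + φ)) ≠ 0 ∧
      Real.cos (Real.pi * (∑ i, ω i * (n i : ℝ) + φ)) ≠ 0 := by
  have hneg : ∑ i, ω i * (((-n) i : ℤ) : ℝ) = -∑ i, ω i * (n i : ℝ) := by
    simp
  constructor
  · rw [Real.sin_ne_zero_iff]
    intro k hk
    -- Even multiples of `1 / 2` are the zeros of the tangent; the odd ones, treated below, are its
    -- poles.
    apply hφ (-n) (2 * k)
    rw [hneg]
    rw [mul_comm, mul_right_inj' Real.pi_ne_zero] at hk
    push_cast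
    linarith
  · rw [Real.cos_ne_zero_iff]
    intro k hk
    apply hφ (-n) (2 * k + 1)
    rw [hneg]
    have h2 : Real.pi * (∑ i, ω i * (n i : ℝ) + φ) = Real.pi * ((2 * k + 1) / 2) := by
      rw [hk]; ring
    rw [mul_right_inj' Real.pi_ne_zero] at h2
    push_cast
    linarith

section Reduction

variable {q : ℝ → ℝ} {lam g φ : ℝ} {ω : Fin d₂ → ℝ}

/-- On the surface the bulk disappears from the equation: its whole effect is the Fourier multiplier
`-N`. -/
theorem mul_latticeResolvent_surface (hd : 0 < ((d₁ + d₂ : ℕ) : ℝ))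
    (hη : 2 < |hillDiscriminant q lam|) {f : UnitAddTorus (Fin d₂) → ℂ} (hf : MemLp f 2)
    (n : Fin d₂ → ℤ) :
    (sOne q lam : ℂ) * latticeResolvent (((d₁ + d₂ : ℕ) : ℝ) * hillDiscriminant q lam) f
      ((0, n) : Vertex d₁ d₂) = -mFourierCoeff (fun θ => (torusN d₁ q lam θ : ℂ) * f θ) n := by
  rw [latticeResolvent_surface (by rw [abs_mul, abs_of_pos hd]; nlinarith) hf,
    ← mFourierCoeff_const_mul, neg_eq_neg_one_mul, ← mFourierCoeff_const_mul]
  congr 1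
  funext θ
  simp only [torusN]
  push_cast
  ring

/-- Solutions of the difference equation come from solutions of the Maryland equation on the
surface. -/
theorem exists_marylandSolution (hd : 0 < ((d₁ + d₂ : ℕ) : ℝ))
    (hs : sOne q lam ≠ 0) (hη : 2 < |hillDiscriminant q lam|) (hg : g ≠ 0)
    (hφ : ∀ (m : Fin d₂ → ℤ) (k : ℤ), φ ≠ ∑ i, ω i * (m i : ℝ) + (k : ℝ) / 2)
    {ξ : Vertex d₁ d₂ → ℂ} (hξ : Memℓp ξ 2)
    (h : SolvesDifference q (marylandCoupling g ω φ) lam ξ) :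
    ∃ f : UnitAddTorus (Fin d₂) → ℂ,
      IsMarylandSolution (fun θ => torusN d₁ q lam θ / (1 / |g|)) (dualPhase g ω φ) f ∧
      ∀ m, ξ m = sOne q lam *
        latticeResolvent (((d₁ + d₂ : ℕ) : ℝ) * hillDiscriminant q lam) f m := by
  have hs' : (sOne q lam : ℂ) ≠ 0 := by exact_mod_cast hs
  have hμ : 2 * ((d₁ + d₂ : ℕ) : ℝ) < |((d₁ + d₂ : ℕ) : ℝ) * hillDiscriminant q lam| := by
    rw [abs_mul, abs_of_pos hd]; nlinarith
  -- The source `α ξ`, rather than `ξ` itself, is the unknown of the reduced equation.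
  set ψ : (Fin d₂ → ℤ) → ℂ := fun n => marylandCoupling g ω φ ((0, n) : Vertex d₁ d₂) * ξ (0, n)
    with hψ
  -- The tangent is unbounded, so square summability of `α ξ` does not follow from that of `ξ`. It
  -- is read off from the difference equation, whose left-hand side is square summable.
  have hψm : Memℓp ψ 2 := by
    have h1 : Memℓp (fun m => neighborSum ξ m -
        ((d₁ + d₂ : ℕ) : ℂ) * hillDiscriminant q lam * ξ m) 2 := by
      have e : ∀ σ : Vertex d₁ d₂, Memℓp (fun m => ξ (m + σ)) 2 := fun σ =>
        memlp_comp_injective hξ (add_left_injective σ)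
      have h2 : Memℓp (fun m => neighborSum ξ m) 2 := by
        unfold neighborSum
        have := Memℓp.finsetSum Finset.univ (f := fun (j : Dir d₁ d₂) m =>
          ξ (m + basisVec j) + ξ (m - basisVec j)) (p := 2) fun j _ => by
            have e1 := (e (basisVec j)).add (e (-basisVec j))
            simp only [← sub_eq_add_neg] at e1
            exact e1
        exact this
      exact h2.sub (hξ.const_mul _)
    have h3 := (memlp_comp_injective (h1.const_mul ((sOne q lam : ℂ)⁻¹))
      (Prod.mk_right_injective (0 : Fin d₁ → ℤ)) : Memℓp _ 2)
    convert! h3 using 2 with n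
    rw [h (0, n), mul_assoc, inv_mul_cancel_left₀ hs']
  obtain ⟨f, hf, hc⟩ := exists_mFourierCoeff_eq hψm
  have hsf : MemLp (fun θ => (sOne q lam : ℂ) * f θ) 2 := hf.const_mul _
  -- The difference equation is the free lattice equation with source `s ψ` on the surface, so
  -- uniqueness recovers `ξ` everywhere from `ψ`.
  have hres := eq_latticeResolvent hμ hsf hξ fun m => by
    have := h m
    push_cast at this ⊢
    rw [this, mFourierCoeff_const_mul, hc]
    split_ifs with hm
    · obtain ⟨m1, m2⟩ := m
      simp only at hm
      subst hm
      simp only [hψ]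
      rw [mul_assoc]
    · simp [marylandCoupling, hm]
  have hlin : ∀ m : Vertex d₁ d₂, ξ m = sOne q lam *
      latticeResolvent (((d₁ + d₂ : ℕ) : ℝ) * hillDiscriminant q lam) f m := by
    intro m
    rw [hres, latticeResolvent, latticeResolvent, ← mFourierCoeff_const_mul]
    congr 1
    funext θ
    simp only [torusResolvent]
    ring
  refine ⟨f, ⟨hf, fun n => ?_⟩, hlin⟩
  obtain ⟨hsin, hcos⟩ := sin_phase_ne_zero hφ n
  have hdiv : ∀ θ, ((torusN d₁ q lam θ / (1 / |g|) : ℝ) : ℂ) * f θ =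
      ((|g| : ℝ) : ℂ) * ((torusN d₁ q lam θ : ℂ) * f θ) := by
    intro θ
    push_cast
    rw [div_div_eq_mul_div, div_one]
    ring
  simp only [hdiv]
  rw [mFourierCoeff_const_mul, sin_dualPhase hg, cos_dualPhase hg, hc]
  simp only [hψ]
  rw [hlin (0, n), mul_latticeResolvent_surface hd hη hf, marylandCoupling, if_pos rfl,
    Real.tan_eq_sin_div_cos]
  have hg' : ((|g| : ℝ) : ℂ) ≠ 0 := by exact_mod_cast abs_ne_zero.2 hg
  have hcos' : (Real.cos (Real.pi * (∑ i, ω i * (n i : ℝ) + φ)) : ℂ) ≠ 0 := by exact_mod_cast hcos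
  push_cast at hcos' ⊢
  field_simp

/-- The free resolvent extends a surface solution to the bulk. The Maryland equation states
precisely that the source `f` agrees with `α` times the extension on the surface, which closes the
difference equation. -/
theorem solvesDifference_of_marylandSolution (hd : 0 < ((d₁ + d₂ : ℕ) : ℝ))
    (hη : 2 < |hillDiscriminant q lam|) (hg : g ≠ 0)
    (hφ : ∀ (m : Fin d₂ → ℤ) (k : ℤ), φ ≠ ∑ i, ω i * (m i : ℝ) + (k : ℝ) / 2)
    {f : UnitAddTorus (Fin d₂) → ℂ}
    (hf : IsMarylandSolution (fun θ => torusN d₁ q lam θ / (1 / |g|)) (dualPhase g ω φ) f) :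
    ∃ ξ : Vertex d₁ d₂ → ℂ, Memℓp ξ 2 ∧ SolvesDifference q (marylandCoupling g ω φ) lam ξ ∧
      (∀ m, ξ m = sOne q lam *
        latticeResolvent (((d₁ + d₂ : ℕ) : ℝ) * hillDiscriminant q lam) f m) ∧
      ∀ n, mFourierCoeff f n = marylandCoupling g ω φ ((0, n) : Vertex d₁ d₂) * ξ (0, n) := by
  have hμ : 2 * ((d₁ + d₂ : ℕ) : ℝ) < |((d₁ + d₂ : ℕ) : ℝ) * hillDiscriminant q lam| := by
    rw [abs_mul, abs_of_pos hd]; nlinarith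
  have hco : ∀ n, mFourierCoeff f n = marylandCoupling g ω φ ((0, n) : Vertex d₁ d₂) *
      (sOne q lam * latticeResolvent (((d₁ + d₂ : ℕ) : ℝ) * hillDiscriminant q lam) f
        ((0, n) : Vertex d₁ d₂)) := by
    intro n
    obtain ⟨hsin, hcos⟩ := sin_phase_ne_zero hφ n
    have hdiv : ∀ θ, ((torusN d₁ q lam θ / (1 / |g|) : ℝ) : ℂ) * f θ =
        ((|g| : ℝ) : ℂ) * ((torusN d₁ q lam θ : ℂ) * f θ) := by
      intro θ
      push_cast
      rw [div_div_eq_mul_div, div_one]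
      ring
    have h := hf.equation n
    simp only [hdiv] at h
    rw [mFourierCoeff_const_mul, sin_dualPhase hg, cos_dualPhase hg] at h
    rw [mul_latticeResolvent_surface hd hη hf.memLp, marylandCoupling, if_pos rfl,
      Real.tan_eq_sin_div_cos]
    have hg' : ((|g| : ℝ) : ℂ) ≠ 0 := by exact_mod_cast abs_ne_zero.2 hg
    have hcos' : (Real.cos (Real.pi * (∑ i, ω i * (n i : ℝ) + φ)) : ℂ) ≠ 0 := by
      exact_mod_cast hcos
    push_cast at hcos' h ⊢
    field_simp at h ⊢
    linear_combination h
  refine ⟨fun m => sOne q lam *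
    latticeResolvent (((d₁ + d₂ : ℕ) : ℝ) * hillDiscriminant q lam) f m,
    (latticeResolvent_memlp hμ hf.memLp).const_mul _, fun m => ?_, fun _ => rfl, hco⟩
  have h := latticeResolvent_equation hμ hf.memLp m
  have e : neighborSum (fun m => (sOne q lam : ℂ) *
      latticeResolvent (((d₁ + d₂ : ℕ) : ℝ) * hillDiscriminant q lam) f m) m =
      sOne q lam * neighborSum
        (latticeResolvent (((d₁ + d₂ : ℕ) : ℝ) * hillDiscriminant q lam) f) m := by
    simp only [neighborSum, Finset.mul_sum, mul_add]
  rw [e]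
  have h' : neighborSum (latticeResolvent (((d₁ + d₂ : ℕ) : ℝ) * hillDiscriminant q lam) f) m -
      ((d₁ + d₂ : ℕ) : ℂ) * hillDiscriminant q lam *
        latticeResolvent (((d₁ + d₂ : ℕ) : ℝ) * hillDiscriminant q lam) f m =
      marylandCoupling g ω φ m * (sOne q lam *
        latticeResolvent (((d₁ + d₂ : ℕ) : ℝ) * hillDiscriminant q lam) f m) := by
    rw [Complex.ofReal_mul, Complex.ofReal_natCast] at h
    rw [h]
    split_ifs with hm
    · obtain ⟨m1, m2⟩ := m
      simp only at hm
      subst hm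
      exact hco m2
    · simp [marylandCoupling, hm]
  linear_combination (sOne q lam : ℂ) * h'

end Reduction

end Surface

/-! ### The Maryland equation on the surface -/

section Maryland

attribute [local instance] instMeasureSpaceUnitAddCircle instIsAddHaarMeasureUnitAddCircleVolume
  instIsProbabilityMeasureUnitAddCircleVolume

open UnitAddTorus

variable {κ : Type*} [Fintype κ]

/-- The Cayley transform `(1 + iM)/(1 - iM)` of a real number is the unimodular number with argument
`2 arctan M`. -/
theorem one_add_I_mul_eq (M : ℝ) :
    1 + Complex.I * M = Complex.exp (2 * Complex.I * Real.arctan M) * (1 - Complex.I * M) := by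
  have hc : (Real.cos (Real.arctan M) : ℂ) ≠ 0 := by
    exact_mod_cast (Real.cos_arctan_pos M).ne'
  have hs : (M : ℂ) * Real.cos (Real.arctan M) = Real.sin (Real.arctan M) := by
    have h := Real.tan_arctan M
    rw [Real.tan_eq_sin_div_cos, div_eq_iff (Real.cos_arctan_pos M).ne'] at h
    exact_mod_cast h.symm
  set a := Real.arctan M
  have e1 : Complex.exp (2 * Complex.I * a) = (Real.cos a + Real.sin a * Complex.I) ^ 2 := by
    rw [Complex.ofReal_cos, Complex.ofReal_sin, ← Complex.exp_mul_I, ← Complex.exp_nat_mul]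
    push_cast
    ring_nf
  have e2 : (Real.cos a : ℂ) ^ 2 + (Real.sin a : ℂ) ^ 2 = 1 := by
    exact_mod_cast Real.cos_sq_add_sin_sq a
  apply mul_right_cancel₀ hc
  rw [e1]
  linear_combination (Complex.I + (Real.cos a + Real.sin a * Complex.I) ^ 2 * Complex.I) * hs -
    (Real.cos a + Real.sin a * Complex.I) * e2 +
    (Real.cos a + Real.sin a * Complex.I) * (Real.sin a) ^ 2 * Complex.I_sq

theorem one_sub_I_mul_ne_zero (M : ℝ) : 1 - Complex.I * M ≠ 0 := by
  intro h
  have := congrArg Complex.re h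
  simp at this

/-- The Cayley transform on the lattice side: the two defects differ by the nonzero factor `2i
exp(ix)`. The unbounded tangent is replaced by a phase. -/
theorem sin_mul_eq_cos_mul_iff (x : ℝ) (a b : ℂ) :
    (Real.sin x : ℂ) * a = Real.cos x * b ↔
      Complex.exp (2 * Complex.I * x) * (a - Complex.I * b) = a + Complex.I * b := by
  have e1 : Complex.exp (2 * Complex.I * x) =
      Complex.exp (x * Complex.I) * Complex.exp (x * Complex.I) := by
    rw [← Complex.exp_add]; ring_nf
  have e2 : Complex.exp (x * Complex.I) * Complex.exp (-x * Complex.I) = 1 := by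
    rw [← Complex.exp_add]; ring_nf; simp
  have e3 := Complex.exp_mul_I (x : ℂ)
  have e4 : Complex.exp (-x * Complex.I) = Complex.cos x - Complex.sin x * Complex.I := by
    rw [Complex.exp_mul_I, Complex.cos_neg, Complex.sin_neg]; ring
  have h0 := Complex.exp_ne_zero ((x : ℂ) * Complex.I)
  have key : Complex.exp (2 * Complex.I * x) * (a - Complex.I * b) - (a + Complex.I * b) =
      2 * Complex.I * Complex.exp (x * Complex.I) *
        ((Real.sin x : ℂ) * a - Real.cos x * b) := by
    rw [Complex.ofReal_sin, Complex.ofReal_cos, e1]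
    have h5 : a + Complex.I * b = Complex.exp (x * Complex.I) * Complex.exp (-x * Complex.I) *
      (a + Complex.I * b) := by rw [e2, one_mul]
    rw [h5, e4, e3]
    ring
  rw [← sub_eq_zero, ← sub_eq_zero (a := Complex.exp _ * _), key]
  simp [h0]

theorem memLp_translate {F : UnitAddTorus κ → ℂ} (hF : MemLp F 2) (t : UnitAddTorus κ) :
    MemLp (fun θ => F (θ + t)) 2 :=
  hF.comp_measurePreserving (measurePreserving_add_right volume t)

/-- Data conjugating the Maryland equation to a multiplication operator. -/
structure IsConjugation (M : UnitAddTorus κ → ℝ) (u : UnitAddTorus κ → ℂ) (σ : ℝ)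
    (t : UnitAddTorus κ) : Prop where
  continuous_symbol : Continuous M
  continuous_phase : Continuous u
  cohomological : ∀ θ, 2 * (Real.arctan (M θ) : ℂ) = 2 * σ + u (θ + t) - u θ

variable {M : UnitAddTorus κ → ℝ} {u : UnitAddTorus κ → ℂ} {σ : ℝ} {t : UnitAddTorus κ}
  {x : (κ → ℤ) → ℝ} {c₀ : ℂ}

/-- The conjugated function. -/
def conjugate (M : UnitAddTorus κ → ℝ) (u F : UnitAddTorus κ → ℂ) (θ : UnitAddTorus κ) : ℂ :=
  Complex.exp (-(Complex.I * u θ)) * ((1 - Complex.I * M θ) * F θ)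

theorem IsConjugation.memLp_conjugate (h : IsConjugation M u σ t) {F : UnitAddTorus κ → ℂ}
    (hF : MemLp F 2) : MemLp (conjugate M u F) 2 := by
  have h1 := h.continuous_symbol
  have h2 := h.continuous_phase
  exact mFourier_mul_memLp (m := fun θ => Complex.exp (-(Complex.I * u θ)))
    (mFourier_mul_memLp (m := fun θ => 1 - Complex.I * M θ) hF (by fun_prop)) (by fun_prop)

/-- With `G = (1 - iM)F`, the Cayley transforms on both sides turn the equation into `c₀ G(θ + t) =
exp(2i arctan M(θ)) G(θ)`. Substituting `G = exp(iu) V`, the cohomological equation replaces the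
variable factor by the constant `exp(2iσ)`, and the Fourier coefficients of `V` decouple. -/
theorem IsConjugation.equation_iff (h : IsConjugation M u σ t)
    (hx : ∀ n, Complex.exp (2 * Complex.I * x n) = c₀ * mFourier n t) {F : UnitAddTorus κ → ℂ}
    (hF : MemLp F 2) :
    (∀ n, (Real.sin (x n) : ℂ) * mFourierCoeff F n =
      Real.cos (x n) * mFourierCoeff (fun θ => (M θ : ℂ) * F θ) n) ↔
    ∀ n, Complex.exp (2 * Complex.I * x n) * mFourierCoeff (conjugate M u F) n =
      Complex.exp (2 * Complex.I * σ) * mFourierCoeff (conjugate M u F) n := by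
  have h1 := h.continuous_symbol
  have h2 := h.continuous_phase
  have hMF : MemLp (fun θ => (M θ : ℂ) * F θ) 2 := mFourier_mul_memLp hF (by fun_prop)
  set G : UnitAddTorus κ → ℂ := fun θ => (1 - Complex.I * M θ) * F θ with hG
  have hGm : MemLp G 2 := mFourier_mul_memLp (m := fun θ => 1 - Complex.I * M θ) hF (by fun_prop)
  set V := conjugate M u F with hV
  have hVm : MemLp V 2 := h.memLp_conjugate hF
  have hGp : MemLp (fun θ => Complex.exp (2 * Complex.I * Real.arctan (M θ)) * G θ) 2 :=
    mFourier_mul_memLp (m := fun θ => Complex.exp (2 * Complex.I * Real.arctan (M θ))) hGm (by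
      have : Continuous fun θ => Real.arctan (M θ) := Real.continuous_arctan.comp h1
      fun_prop)
  -- the two equations in terms of functions
  set A : UnitAddTorus κ → ℂ := fun θ => c₀ * G (θ + t) -
    Complex.exp (2 * Complex.I * Real.arctan (M θ)) * G θ with hA
  set B : UnitAddTorus κ → ℂ := fun θ => c₀ * V (θ + t) - Complex.exp (2 * Complex.I * σ) * V θ
    with hB
  have hAm : MemLp A 2 := ((memLp_translate hGm t).const_mul c₀).sub hGp
  have hBm : MemLp B 2 :=
    ((memLp_translate hVm t).const_mul c₀).sub (hVm.const_mul _)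
  -- The defects of the original and of the conjugated equation differ by a nonvanishing factor, so
  -- they vanish together.
  have hAB : ∀ θ, A θ = Complex.exp (Complex.I * u (θ + t)) * B θ := by
    intro θ
    have e1 : ∀ η, G η = Complex.exp (Complex.I * u η) * V η := by
      intro η
      rw [hV, conjugate, ← mul_assoc, ← Complex.exp_add, add_neg_cancel, Complex.exp_zero, one_mul]
    have e2 : Complex.exp (2 * Complex.I * Real.arctan (M θ)) * Complex.exp (Complex.I * u θ) =
        Complex.exp (Complex.I * u (θ + t)) * Complex.exp (2 * Complex.I * σ) := by
      rw [← Complex.exp_add, ← Complex.exp_add]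
      congr 1
      linear_combination Complex.I * h.cohomological θ
    simp only [hA, hB]
    rw [e1 (θ + t), e1 θ, ← mul_assoc _ _ (V θ), e2]
    ring
  have hA0 : (∀ n, mFourierCoeff A n = 0) ↔ A =ᵐ[volume] 0 :=
    ⟨ae_eq_zero_of_mFourierCoeff hAm, fun h n => by
      rw [mFourierCoeff_congr h]; simp [mFourierCoeff]⟩
  have hB0 : (∀ n, mFourierCoeff B n = 0) ↔ B =ᵐ[volume] 0 :=
    ⟨ae_eq_zero_of_mFourierCoeff hBm, fun h n => by
      rw [mFourierCoeff_congr h]; simp [mFourierCoeff]⟩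
  have hAB0 : A =ᵐ[volume] 0 ↔ B =ᵐ[volume] 0 := by
    refine Filter.eventually_congr (Filter.Eventually.of_forall fun θ => ?_)
    rw [hAB]
    simp [Complex.exp_ne_zero]
  have cA : ∀ n, mFourierCoeff A n = 0 ↔ (Real.sin (x n) : ℂ) * mFourierCoeff F n =
      Real.cos (x n) * mFourierCoeff (fun θ => (M θ : ℂ) * F θ) n := by
    intro n
    have g1 : mFourierCoeff G n = mFourierCoeff F n -
        Complex.I * mFourierCoeff (fun θ => (M θ : ℂ) * F θ) n := by
      rw [← mFourierCoeff_const_mul, ← mFourierCoeff_sub hF (hMF.const_mul _)]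
      congr 1
      funext θ
      simp only [hG]
      ring
    have g2 : mFourierCoeff (fun θ => Complex.exp (2 * Complex.I * Real.arctan (M θ)) * G θ) n =
        mFourierCoeff F n + Complex.I * mFourierCoeff (fun θ => (M θ : ℂ) * F θ) n := by
      rw [← mFourierCoeff_const_mul, ← mFourierCoeff_add hF (hMF.const_mul _)]
      congr 1
      funext θ
      simp only [hG]
      rw [← mul_assoc, ← one_add_I_mul_eq]
      ring
    rw [sin_mul_eq_cos_mul_iff, ← g1, ← g2, ← sub_eq_zero (b := mFourierCoeff (fun θ => _ * G θ) n),
      hx, mul_assoc, ← mFourierCoeff_translate, ← mFourierCoeff_const_mul,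
      ← mFourierCoeff_sub ((memLp_translate hGm t).const_mul c₀) hGp]
  have cB : ∀ n, mFourierCoeff B n = 0 ↔
      Complex.exp (2 * Complex.I * x n) * mFourierCoeff V n =
      Complex.exp (2 * Complex.I * σ) * mFourierCoeff V n := by
    intro n
    rw [← sub_eq_zero (a := Complex.exp _ * _), hx, mul_assoc, ← mFourierCoeff_translate,
      ← mFourierCoeff_const_mul, ← mFourierCoeff_const_mul,
      ← mFourierCoeff_sub ((memLp_translate hVm t).const_mul c₀) (hVm.const_mul _)]
  rw [← forall_congr' cA, hA0, hAB0, ← hB0]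
  exact forall_congr' cB

theorem eq_conjugate {ι : Type*} (M : UnitAddTorus ι → ℝ) (u F : UnitAddTorus ι → ℂ)
    (θ : UnitAddTorus ι) :
    F θ = Complex.exp (Complex.I * u θ) / (1 - Complex.I * M θ) * conjugate M u F θ := by
  have h := one_sub_I_mul_ne_zero (M θ)
  rw [conjugate, Complex.exp_neg]
  have h2 := Complex.exp_ne_zero (Complex.I * u θ)
  field_simp

/-- Without a solution of the quantization condition there are no nontrivial solutions. -/
theorem IsConjugation.ae_eq_zero (h : IsConjugation M u σ t)
    (hx : ∀ n, Complex.exp (2 * Complex.I * x n) = c₀ * mFourier n t) {F : UnitAddTorus κ → ℂ}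
    (hF : IsMarylandSolution M x F)
    (hno : ∀ n, Complex.exp (2 * Complex.I * x n) ≠ Complex.exp (2 * Complex.I * σ)) :
    F =ᵐ[volume] 0 := by
  have h0 := ae_eq_zero_of_mFourierCoeff (h.memLp_conjugate hF.memLp) fun n => by
    have := (h.equation_iff hx hF.memLp).1 hF.equation n
    by_contra hne
    exact hno n (mul_right_cancel₀ hne this)
  filter_upwards [h0] with θ hθ
  rw [eq_conjugate M u F θ, hθ]
  simp

theorem mFourierCoeff_mFourier [DecidableEq κ] (k n : κ → ℤ) :
    mFourierCoeff (mFourier k) n = if n = k then 1 else 0 := by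
  rw [← mFourierCoeff_toLp, ← mFourierBasis_repr]
  have h7 : (mFourier k).toLp 2 volume ℂ = mFourierBasis (d := κ) k := by
    rw [coe_mFourierBasis]
  rw [h7, HilbertBasis.repr_self, lp.single_apply, Pi.single_apply]

/-- A solution of the quantization condition gives a solution which is unique up to multiples. -/
theorem IsConjugation.exists_solution [DecidableEq κ] (h : IsConjugation M u σ t)
    (hx : ∀ n, Complex.exp (2 * Complex.I * x n) = c₀ * mFourier n t)
    (hinj : ∀ n n', Complex.exp (2 * Complex.I * x n) = Complex.exp (2 * Complex.I * x n') → n = n')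
    {n₀ : κ → ℤ} (hn₀ : Complex.exp (2 * Complex.I * x n₀) = Complex.exp (2 * Complex.I * σ)) :
    ∃ F₀, IsMarylandSolution M x F₀ ∧ (¬ F₀ =ᵐ[volume] 0) ∧
      ∀ F, IsMarylandSolution M x F → ∃ c : ℂ, F =ᵐ[volume] fun θ => c * F₀ θ := by
  have h1 := h.continuous_symbol
  have h2 := h.continuous_phase
  have hm : Continuous fun θ => Complex.exp (Complex.I * u θ) / (1 - Complex.I * M θ) :=
    Continuous.div (by fun_prop) (by fun_prop) fun θ => one_sub_I_mul_ne_zero _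
  have hmem : ∀ n : κ → ℤ, MemLp (mFourier n) 2 := fun n => by
    simpa using mFourier_mul_memLp (memLp_const (1 : ℂ)) (mFourier n).continuous
  -- The preimage under the conjugation of the single character with index `n₀`.
  set F₀ : UnitAddTorus κ → ℂ := fun θ =>
    Complex.exp (Complex.I * u θ) / (1 - Complex.I * M θ) * mFourier n₀ θ with hF₀
  have hF₀m : MemLp F₀ 2 := mFourier_mul_memLp (hmem n₀) hm
  have hconj : conjugate M u F₀ = mFourier n₀ := by
    funext θ
    have h := one_sub_I_mul_ne_zero (M θ)
    rw [conjugate, Complex.exp_neg]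
    have h2 := Complex.exp_ne_zero (Complex.I * u θ)
    simp only [hF₀]
    field_simp
  refine ⟨F₀, ⟨hF₀m, (h.equation_iff hx hF₀m).2 fun n => ?_⟩, fun h0 => ?_, fun F hF => ?_⟩
  · rw [hconj, mFourierCoeff_mFourier]
    split_ifs with hn
    · rw [hn, hn₀]
    · simp
  · have h3 : (mFourier n₀ : UnitAddTorus κ → ℂ) =ᵐ[volume] 0 := by
      rw [← hconj]
      filter_upwards [h0] with θ hθ
      rw [conjugate, hθ]
      simp
    have h4 := mFourierCoeff_congr h3 n₀
    rw [mFourierCoeff_mFourier, if_pos rfl] at h4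
    simp [mFourierCoeff] at h4
  · have h3 := (h.equation_iff hx hF.memLp).1 hF.equation
    set c := mFourierCoeff (conjugate M u F) n₀ with hc
    refine ⟨c, ?_⟩
    have h4 : conjugate M u F =ᵐ[volume] fun θ => c * mFourier n₀ θ := by
      refine ae_eq_of_mFourierCoeff (h.memLp_conjugate hF.memLp) ((hmem n₀).const_mul c) fun n => ?_
      rw [mFourierCoeff_const_mul, mFourierCoeff_mFourier]
      split_ifs with hn
      · rw [hn, mul_one]
      · rw [mul_zero]
        by_contra hne
        exact hn (hinj n n₀ ((mul_right_cancel₀ hne (h3 n)).trans hn₀.symm))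
    filter_upwards [h4] with θ hθ
    rw [eq_conjugate M u F θ, hθ, hF₀]
    ring

end Maryland

/-! ### Smoothness of the Green function -/

theorem abs_latticeSymbol_le {n : ℕ} (x : Fin n → ℝ) : |latticeSymbol x| ≤ 2 * n := by
  refine (Finset.abs_sum_le_sum_abs _ _).trans ?_
  refine (Finset.sum_le_sum (g := fun _ => (2 : ℝ)) fun j _ => ?_).trans (by simp [mul_comm])
  rw [abs_mul, abs_two]
  have := Real.abs_cos_le_one (2 * Real.pi * x j)
  linarith

theorem contDiff_latticeSymbol (n : ℕ) {r : WithTop ℕ∞} :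
    ContDiff ℝ r (latticeSymbol : (Fin n → ℝ) → ℝ) := by
  unfold latticeSymbol
  fun_prop

/-- Up to a factor, the derivatives of the Green function. -/
def greenPower (n k : ℕ) (μ : ℝ) : ℝ :=
  torusAverage fun x : Fin n → ℝ => ((latticeSymbol x - μ) ^ (k + 1))⁻¹

theorem hasDerivAt_greenPower (n k : ℕ) {μ : ℝ} (hμ : 2 * (n : ℝ) < |μ|) :
    HasDerivAt (greenPower n k) ((k + 1) * greenPower n (k + 1) μ) μ := by
  -- Half the distance from `|μ|` to the bound `2n` of the symbol, so the denominators stay at least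
  -- `δ` on the whole ball.
  set δ : ℝ := (|μ| - 2 * n) / 2 with hδ
  have hδ0 : 0 < δ := by rw [hδ]; linarith
  have hlow : ∀ ν ∈ Metric.ball μ δ, ∀ x : Fin n → ℝ, δ ≤ |latticeSymbol x - ν| := by
    intro ν hν x
    rw [Metric.mem_ball, Real.dist_eq] at hν
    have h1 := abs_latticeSymbol_le x
    have h2 := abs_sub_abs_le_abs_sub μ ν
    rw [abs_sub_comm μ ν] at h2
    have h3 := abs_sub_abs_le_abs_sub ν (latticeSymbol x)
    rw [abs_sub_comm ν] at h3
    rw [hδ] at hν ⊢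
    linarith
  have hcont : ∀ ν ∈ Metric.ball μ δ, ∀ j : ℕ,
      Continuous fun x : Fin n → ℝ => ((latticeSymbol x - ν) ^ (j + 1))⁻¹ := by
    intro ν hν j
    refine (((contDiff_latticeSymbol n (r := 0)).continuous.sub continuous_const).pow _).inv₀
      fun x => pow_ne_zero _ ?_
    exact abs_pos.1 (hδ0.trans_le (hlow ν hν x))
  have hμb : μ ∈ Metric.ball μ δ := Metric.mem_ball_self hδ0
  have key := hasDerivAt_integral_of_dominated_loc_of_deriv_le (𝕜 := ℝ)
    (μ := volume.restrict (Icc (0 : Fin n → ℝ) 1))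
    (F := fun ν x => ((latticeSymbol x - ν) ^ (k + 1))⁻¹)
    (F' := fun ν x => (k + 1) * ((latticeSymbol x - ν) ^ (k + 1 + 1))⁻¹)
    (bound := fun _ => (k + 1) * (δ ^ (k + 1 + 1))⁻¹) (x₀ := μ)
    (Metric.ball_mem_nhds μ hδ0)
    (by
      filter_upwards [Metric.ball_mem_nhds μ hδ0] with ν hν
      exact (hcont ν hν k).aestronglyMeasurable)
    ((hcont μ hμb k).continuousOn.integrableOn_compact isCompact_Icc)
    (continuous_const.mul (hcont μ hμb (k + 1))).aestronglyMeasurable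
    (Filter.Eventually.of_forall fun x ν hν => by
      rw [norm_mul, norm_inv, norm_pow, Real.norm_eq_abs, Real.norm_eq_abs,
        abs_of_nonneg (by positivity : (0 : ℝ) ≤ k + 1)]
      gcongr
      exact hlow ν hν x)
    ((continuous_const (y := (k + 1) * (δ ^ (k + 1 + 1))⁻¹)).continuousOn.integrableOn_compact
      isCompact_Icc)
    (Filter.Eventually.of_forall fun x ν hν => by
      have hne : latticeSymbol x - ν ≠ 0 := abs_pos.1 (hδ0.trans_le (hlow ν hν x))
      have h1 := (((hasDerivAt_id ν).const_sub (latticeSymbol x)).fun_pow (k + 1)).fun_inv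
        (pow_ne_zero _ hne)
      convert! h1 using 1
      simp only [id, Nat.add_sub_cancel]
      push_cast
      field_simp
      ring)
  have h2 := key.2
  rw [integral_const_mul] at h2
  exact h2

/-- Differentiation raises the power in the integrand by one, so the induction on the order of
smoothness runs over all powers simultaneously. -/
theorem contDiffOn_greenDiag (n : ℕ) {r : ℕ∞} :
    ContDiffOn ℝ r (greenDiag n) {μ | 2 * (n : ℝ) < |μ|} := by
  have hU : IsOpen {μ : ℝ | 2 * (n : ℝ) < |μ|} := isOpen_lt continuous_const continuous_abs
  have key : ∀ (m : ℕ) (k : ℕ), ContDiffOn ℝ m (greenPower n k) {μ | 2 * (n : ℝ) < |μ|} := by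
    intro m
    induction m with
    | zero =>
      intro k
      rw [Nat.cast_zero, contDiffOn_zero]
      exact fun μ hμ => (hasDerivAt_greenPower n k hμ).continuousAt.continuousWithinAt
    | succ m ih =>
      intro k
      push_cast
      rw [contDiffOn_succ_iff_deriv_of_isOpen hU]
      refine ⟨fun μ hμ => (hasDerivAt_greenPower n k hμ).differentiableAt.differentiableWithinAt,
        fun h => absurd h (by simp), ?_⟩
      refine (contDiffOn_const.mul (ih (k + 1))).congr fun μ hμ =>
        (hasDerivAt_greenPower n k hμ).deriv
  have h0 : greenDiag n = greenPower n 0 := by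
    funext μ
    simp [greenDiag, greenPower]
  rw [h0]
  exact (contDiffOn_infty.2 fun m => key m 0).of_le (by exact_mod_cast le_top)

/-- From `|d η| > 2d` and `|Δ_{d₂}| ≤ 2 d₂` the argument of the Green function stays in the region
of modulus larger than `2 d₁`, where that function is smooth. -/
theorem contDiff_symbolN {d₁ d₂ : ℕ} (hd : 0 < ((d₁ + d₂ : ℕ) : ℝ)) {q : ℝ → ℝ} {lam : ℝ}
    (hη : 2 < |hillDiscriminant q lam|) {r : ℕ∞} :
    ContDiff ℝ r fun x : Fin d₂ → ℝ => symbolN d₁ q x lam := by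
  unfold symbolN
  refine contDiff_const.mul ?_
  refine (contDiffOn_greenDiag d₁).comp_contDiff
    (contDiff_const.sub (contDiff_latticeSymbol d₂)) fun x => ?_
  have h1 := abs_latticeSymbol_le x
  have h2 : 2 * ((d₁ + d₂ : ℕ) : ℝ) < |((d₁ + d₂ : ℕ) : ℝ) * hillDiscriminant q lam| := by
    rw [abs_mul, abs_of_pos hd]; nlinarith
  have h3 := abs_sub_abs_le_abs_sub (((d₁ + d₂ : ℕ) : ℝ) * hillDiscriminant q lam) (latticeSymbol x)
  push_cast at h2 h3 ⊢
  rw [Set.mem_ofPred_eq]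
  linarith

/-! ### Fourier coefficients of smooth periodic functions -/

/-- The exponent of `x ↦ exp (-2πi k·x)` as a linear map. -/
def fourierPhase {n : ℕ} (k : Fin n → ℤ) : (Fin n → ℝ) →L[ℝ] ℂ :=
  ∑ i, (-(2 * Real.pi * Complex.I * k i) : ℂ) •
    (Complex.ofRealCLM.comp (ContinuousLinearMap.proj (R := ℝ) (φ := fun _ : Fin n => ℝ) i))

theorem fourierPhase_apply {n : ℕ} (k : Fin n → ℤ) (x : Fin n → ℝ) :
    fourierPhase k x = ∑ i, -(2 * Real.pi * Complex.I * k i) * (x i : ℂ) := by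
  simp [fourierPhase]

theorem fourierPhase_single {n : ℕ} (k : Fin n → ℤ) (j : Fin n) :
    fourierPhase k (Pi.single j 1) = -(2 * Real.pi * Complex.I * k j) := by
  rw [fourierPhase_apply, Finset.sum_eq_single j]
  · simp
  · intro i _ hi
    simp [hi]
  · simp

/-- Periodicity with respect to the integer lattice. -/
def IsLatticePeriodic {n : ℕ} (f : (Fin n → ℝ) → ℂ) : Prop :=
  ∀ j x, f (x + Pi.single j 1) = f x

theorem isLatticePeriodic_exp {n : ℕ} (k : Fin n → ℤ) :
    IsLatticePeriodic fun x => Complex.exp (fourierPhase k x) := by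
  intro j x
  simp only
  rw [map_add, fourierPhase_single, Complex.exp_add]
  have h : Complex.exp (-(2 * Real.pi * Complex.I * k j)) = 1 :=
    Complex.exp_eq_one_iff.2 ⟨-k j, by push_cast; ring⟩
  rw [h, mul_one]

/-- By the divergence theorem for the field with the single component `f` in direction `j`, the
integral is the difference over two opposite faces, on which `f` agrees by periodicity. -/
theorem integral_fderiv_single_eq_zero {n : ℕ} {f : (Fin (n + 1) → ℝ) → ℂ} (hf : ContDiff ℝ 1 f)
    (hp : IsLatticePeriodic f) (j : Fin (n + 1)) :
    ∫ x in Icc (0 : Fin (n + 1) → ℝ) 1, fderiv ℝ f x (Pi.single j 1) = 0 := by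
  have hc : Continuous fun x => fderiv ℝ f x (Pi.single j 1) :=
    (hf.continuous_fderiv one_ne_zero).clm_apply continuous_const
  have e : ∀ x, ∑ i, (if i = j then fderiv ℝ f x else 0) (Pi.single i (1 : ℝ)) =
      fderiv ℝ f x (Pi.single j 1) := by
    intro x
    rw [Finset.sum_eq_single j]
    · simp
    · intro i _ hi
      simp [hi]
    · simp
  have key := integral_divergence_of_hasFDerivAt_off_countable' (0 : Fin (n + 1) → ℝ) 1
    zero_le_one (fun i x => if i = j then f x else 0)
    (fun i x => if i = j then fderiv ℝ f x else 0) ∅ countable_empty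
    (fun i => by
      split_ifs
      · exact hf.continuous.continuousOn
      · exact continuousOn_const)
    (fun x _ i => by
      split_ifs
      · exact (hf.differentiable one_ne_zero x).hasFDerivAt
      · exact hasFDerivAt_const _ _)
    (by
      simp only [e]
      exact hc.continuousOn.integrableOn_compact isCompact_Icc)
  simp only [e] at key
  rw [key]
  refine Finset.sum_eq_zero fun i _ => ?_
  by_cases hi : i = j
  · subst hi
    simp only [if_true]
    rw [sub_eq_zero]
    refine setIntegral_congr_fun measurableSet_Icc fun x _ => ?_
    rw [← hp i (i.insertNth ((0 : Fin (n + 1) → ℝ) i) x)]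
    congr 1
    ext l
    refine Fin.succAboveCases i ?_ (fun l => ?_) l <;> simp
  · simp [hi]

/-- Integration by parts: the product of `f` with the character is again periodic, so there are no
boundary terms. -/
theorem integral_exp_mul_fderiv {n : ℕ} {f : (Fin (n + 1) → ℝ) → ℂ} (hf : ContDiff ℝ 1 f)
    (hp : IsLatticePeriodic f) (k : Fin (n + 1) → ℤ) (j : Fin (n + 1)) :
    ∫ x in Icc (0 : Fin (n + 1) → ℝ) 1,
        Complex.exp (fourierPhase k x) * fderiv ℝ f x (Pi.single j 1) =
      2 * Real.pi * Complex.I * k j *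
        ∫ x in Icc (0 : Fin (n + 1) → ℝ) 1, Complex.exp (fourierPhase k x) * f x := by
  have hE : ContDiff ℝ 1 fun x => Complex.exp (fourierPhase k x) :=
    (fourierPhase k).contDiff.cexp
  have h0 := integral_fderiv_single_eq_zero (hE.mul hf) (fun j x => by
    have h1 := isLatticePeriodic_exp k j x
    simp only at h1 ⊢
    rw [hp j x, h1]) j
  have e : ∀ x, fderiv ℝ (fun x => Complex.exp (fourierPhase k x) * f x) x (Pi.single j 1) =
      Complex.exp (fourierPhase k x) * fderiv ℝ f x (Pi.single j 1) -
        2 * Real.pi * Complex.I * k j * (Complex.exp (fourierPhase k x) * f x) := by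
    intro x
    rw [(((fourierPhase k).hasFDerivAt.cexp).fun_mul
      (hf.differentiable one_ne_zero x).hasFDerivAt).fderiv]
    simp [fourierPhase_single]
    ring
  simp only [e] at h0
  rw [integral_sub, integral_const_mul, sub_eq_zero] at h0
  · exact h0
  · exact (hE.continuous.mul ((hf.continuous_fderiv one_ne_zero).clm_apply
      continuous_const)).continuousOn.integrableOn_compact isCompact_Icc
  · exact (continuous_const.mul (hE.continuous.mul
      hf.continuous)).continuousOn.integrableOn_compact isCompact_Icc

theorem norm_exp_fourierPhase {n : ℕ} (k : Fin n → ℤ) (x : Fin n → ℝ) :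
    ‖Complex.exp (fourierPhase k x)‖ = 1 := by
  have : fourierPhase k x = ((-∑ i, 2 * Real.pi * k i * x i : ℝ) : ℂ) * Complex.I := by
    rw [fourierPhase_apply]
    push_cast
    rw [← Finset.sum_neg_distrib, Finset.sum_mul]
    exact Finset.sum_congr rfl fun i _ => by ring
  rw [this, Complex.norm_exp_ofReal_mul_I]

theorem exists_abs_apply_eq_norm {n : ℕ} (k : Fin (n + 1) → ℤ) : ∃ j, |(k j : ℝ)| = ‖k‖ := by
  by_contra! h
  have h1 : ∀ j, ‖k j‖ < ‖k‖ := fun j =>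
    lt_of_le_of_ne (norm_le_pi_norm k j) (by rw [Int.norm_eq_abs]; exact h j)
  have h2 : 0 < ‖k‖ := (norm_nonneg _).trans_lt (h1 0)
  exact lt_irrefl _ ((pi_norm_lt_iff h2).2 h1)

theorem volume_Icc_zero_one (n : ℕ) : volume (Icc (0 : Fin n → ℝ) 1) = 1 := by
  rw [Real.volume_Icc_pi]
  simp

/-- The Fourier coefficients of a smooth periodic function decay faster than any power. -/
theorem exists_norm_fourier_integral_le {n : ℕ} (r : ℕ) {f : (Fin (n + 1) → ℝ) → ℂ}
    (hf : ContDiff ℝ ((⊤ : ℕ∞) : WithTop ℕ∞) f) (hp : IsLatticePeriodic f) :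
    ∃ C : ℝ, ∀ k : Fin (n + 1) → ℤ, k ≠ 0 →
      ‖∫ x in Icc (0 : Fin (n + 1) → ℝ) 1, Complex.exp (fourierPhase k x) * f x‖ * ‖k‖ ^ r ≤ C := by
  induction r generalizing f with
  | zero =>
    obtain ⟨C, hC⟩ := (isCompact_Icc (a := (0 : Fin (n + 1) → ℝ)) (b := 1)).exists_bound_of_continuousOn
      hf.continuous.continuousOn
    refine ⟨C, fun k _ => ?_⟩
    rw [pow_zero, mul_one]
    have h1 := volume_Icc_zero_one (n + 1)
    have := norm_setIntegral_le_of_norm_le_const (μ := volume)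
      (s := Icc (0 : Fin (n + 1) → ℝ) 1) (C := C)
      (f := fun x => Complex.exp (fourierPhase k x) * f x) (by rw [h1]; simp) fun x hx => by
        rw [norm_mul, norm_exp_fourierPhase, one_mul]
        exact hC x hx
    refine this.trans ?_
    rw [measureReal_def, h1]
    simp
  | succ r ih =>
    have hD : ∀ j : Fin (n + 1), ContDiff ℝ ((⊤ : ℕ∞) : WithTop ℕ∞)
        fun x => fderiv ℝ f x (Pi.single j 1) := fun j =>
      (hf.fderiv_right (m := ((⊤ : ℕ∞) : WithTop ℕ∞)) (by simp)).clm_apply contDiff_const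
    have hDp : ∀ j : Fin (n + 1), IsLatticePeriodic fun x => fderiv ℝ f x (Pi.single j 1) := by
      intro j i x
      simp only
      rw [← fderiv_comp_add_right]
      congr 2
      funext y
      exact hp i y
    choose C hC using fun j => ih (hD j) (hDp j)
    refine ⟨∑ j, |C j|, fun k hk => ?_⟩
    -- Differentiating in a direction where the sup norm of `k` is attained gains the full factor
    -- `2π‖k‖`.
    obtain ⟨j, hj⟩ := exists_abs_apply_eq_norm k
    have h1 := hC j k hk
    have hf1 : ContDiff ℝ 1 f := hf.of_le (by exact_mod_cast le_top)
    rw [integral_exp_mul_fderiv hf1 hp k j] at h1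
    have h2 : ‖(2 * Real.pi * Complex.I * k j : ℂ)‖ = 2 * Real.pi * ‖k‖ := by
      rw [← hj]
      simp [abs_of_pos Real.pi_pos]
    rw [norm_mul, h2] at h1
    have h3 : C j ≤ ∑ j, |C j| :=
      (le_abs_self _).trans (Finset.single_le_sum (f := fun j => |C j|)
        (fun _ _ => abs_nonneg _) (Finset.mem_univ j))
    refine le_trans ?_ (h1.trans h3)
    set I := ‖∫ x in Icc (0 : Fin (n + 1) → ℝ) 1, Complex.exp (fourierPhase k x) * f x‖
    have h4 : 0 ≤ I * ‖k‖ ^ (r + 1) := by positivity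
    calc I * ‖k‖ ^ (r + 1) ≤ (2 * Real.pi) * (I * ‖k‖ ^ (r + 1)) :=
          le_mul_of_one_le_left h4 (by linarith [Real.pi_gt_three])
      _ = _ := by ring

/-! ### Solution of the cohomological equation -/

section Cohomology

attribute [local instance] instMeasureSpaceUnitAddCircle instIsAddHaarMeasureUnitAddCircleVolume
  instIsProbabilityMeasureUnitAddCircleVolume

open UnitAddTorus

theorem summable_one_add_abs_sq_inv : Summable fun n : ℤ => ((1 + |(n : ℝ)|) ^ 2)⁻¹ := by
  refine ((Real.summable_one_div_int_pow (p := 2)).2 one_lt_two).of_norm_bounded_eventually ?_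
  filter_upwards [(Set.finite_singleton (0 : ℤ)).compl_mem_cofinite] with n hn
  have hn' : (0 : ℝ) < |(n : ℝ)| := abs_pos.2 (by exact_mod_cast hn)
  rw [Real.norm_of_nonneg (by positivity), one_div, ← sq_abs (n : ℝ)]
  gcongr
  linarith

/-- Comparison with a product of one-dimensional series; each of the `d` coordinates uses up the
exponent `2`. -/
theorem summable_one_add_norm_inv (d : ℕ) :
    Summable fun k : Fin d → ℤ => ((1 + ‖k‖) ^ (2 * d))⁻¹ := by
  refine Summable.of_nonneg_of_le (fun k => by positivity) (fun k => ?_)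
    (summable_prod_pi (ι := Fin d) (fun _ => by positivity) summable_one_add_abs_sq_inv)
  rw [Finset.prod_inv_distrib]
  refine inv_anti₀ (Finset.prod_pos fun i _ => by positivity) ?_
  calc ∏ i, (1 + |(k i : ℝ)|) ^ 2 ≤ ∏ _i : Fin d, (1 + ‖k‖) ^ 2 := by
        refine Finset.prod_le_prod (fun i _ => by positivity) fun i _ => ?_
        have := norm_le_pi_norm k i
        rw [Int.norm_eq_abs] at this
        gcongr
    _ = (1 + ‖k‖) ^ (2 * d) := by simp [pow_mul]

theorem one_le_norm_of_ne_zero {d : ℕ} {k : Fin d → ℤ} (hk : k ≠ 0) : 1 ≤ ‖k‖ := by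
  obtain ⟨i, hi⟩ := Function.ne_iff.1 hk
  refine le_trans ?_ (norm_le_pi_norm k i)
  rw [Int.norm_eq_abs]
  exact_mod_cast Int.one_le_abs hi

/-- The cohomological equation over a Diophantine rotation. -/
theorem exists_cohomological {d : ℕ} {a : UnitAddTorus (Fin d) → ℂ} (ha : Continuous a)
    (hdecay : ∀ r : ℕ, ∃ C : ℝ, ∀ k : Fin d → ℤ, k ≠ 0 → ‖mFourierCoeff a k‖ * ‖k‖ ^ r ≤ C)
    {t : UnitAddTorus (Fin d)} {C β : ℝ} (hC : 0 < C)
    (ht : ∀ k : Fin d → ℤ, k ≠ 0 → C * ‖k‖ ^ (-β) ≤ ‖mFourier k t - 1‖) :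
    ∃ u : UnitAddTorus (Fin d) → ℂ, Continuous u ∧
      ∀ θ, a θ = mFourierCoeff a 0 + u (θ + t) - u θ := by
  -- The power `⌈β⌉₊` pays for the small divisors, and `2 * d` leaves a summable sequence.
  obtain ⟨D, hD⟩ := hdecay (⌈β⌉₊ + 2 * d)
  have hbound : ∀ k : Fin d → ℤ, k ≠ 0 → ∀ z : ℝ, 0 ≤ z → z * ‖k‖ ^ (2 * d) ≤ D →
      z ≤ |D| * 2 ^ (2 * d) * ((1 + ‖k‖) ^ (2 * d))⁻¹ := by
    intro k hk z hz h
    have h1 := one_le_norm_of_ne_zero hk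
    rw [← div_eq_mul_inv, le_div_iff₀ (by positivity)]
    calc z * (1 + ‖k‖) ^ (2 * d) ≤ z * (2 * ‖k‖) ^ (2 * d) := by gcongr; linarith
      _ = z * ‖k‖ ^ (2 * d) * 2 ^ (2 * d) := by rw [mul_pow]; ring
      _ ≤ |D| * 2 ^ (2 * d) := by gcongr; exact h.trans (le_abs_self D)
  -- The Fourier coefficients that the equation dictates for `u`. The zero mode of `u` is free and
  -- is set to zero.
  set b : (Fin d → ℤ) → ℂ := fun k =>
    if k = 0 then 0 else mFourierCoeff a k / (mFourier k t - 1) with hb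
  have hne : ∀ k : Fin d → ℤ, k ≠ 0 → 0 < ‖mFourier k t - 1‖ := fun k hk =>
    (mul_pos hC (Real.rpow_pos_of_pos (zero_lt_one.trans_le (one_le_norm_of_ne_zero hk)) _)).trans_le
      (ht k hk)
  have hbsum : Summable fun k => ‖b k‖ := by
    refine Summable.of_nonneg_of_le (fun _ => norm_nonneg _) (fun k => ?_)
      ((summable_one_add_norm_inv d).mul_left (C⁻¹ * (|D| * 2 ^ (2 * d))))
    by_cases hk : k = 0
    · simp only [hb, if_pos hk, norm_zero]
      positivity
    · have h1 := one_le_norm_of_ne_zero hk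
      have h0 : 0 < ‖k‖ := zero_lt_one.trans_le h1
      simp only [hb, if_neg hk, norm_div]
      have h2 := hbound k hk (‖mFourierCoeff a k‖ * ‖k‖ ^ ⌈β⌉₊) (by positivity)
        (by rw [mul_assoc, ← pow_add]; exact hD k hk)
      rw [div_le_iff₀ (hne k hk)]
      have h3 : ‖mFourierCoeff a k‖ ≤
          ‖mFourierCoeff a k‖ * ‖k‖ ^ ⌈β⌉₊ * (C⁻¹ * ‖mFourier k t - 1‖) := by
        have h4 : 1 ≤ ‖k‖ ^ ⌈β⌉₊ * (C⁻¹ * ‖mFourier k t - 1‖) := by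
          calc (1 : ℝ) = ‖k‖ ^ β * (C⁻¹ * (C * ‖k‖ ^ (-β))) := by
                rw [inv_mul_cancel_left₀ hC.ne', ← Real.rpow_add h0, add_neg_cancel,
                  Real.rpow_zero]
            _ ≤ ‖k‖ ^ ⌈β⌉₊ * (C⁻¹ * ‖mFourier k t - 1‖) := by
                gcongr
                · rw [← Real.rpow_natCast]
                  exact Real.rpow_le_rpow_of_exponent_le h1 (Nat.le_ceil β)
                · exact ht k hk
        rw [mul_assoc]
        exact le_mul_of_one_le_right (norm_nonneg _) h4
      calc ‖mFourierCoeff a k‖ ≤ _ := h3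
        _ ≤ (|D| * 2 ^ (2 * d) * ((1 + ‖k‖) ^ (2 * d))⁻¹) * (C⁻¹ * ‖mFourier k t - 1‖) := by
          gcongr
        _ = _ := by ring
  -- The divisors are at most `2`, so summability for `u` gives summability for `a`; the Fourier
  -- series of `a` then represents it at every point, and the equation holds everywhere.
  have hasum : Summable (mFourierCoeff a) := by
    have h1 : Summable fun k : Fin d → ℤ => 2 * ‖b k‖ := hbsum.mul_left 2
    refine Summable.of_norm_bounded_eventually h1 ?_
    filter_upwards [(Set.finite_singleton (0 : Fin d → ℤ)).compl_mem_cofinite] with k hk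
    have hk' : k ≠ 0 := hk
    simp only [hb, if_neg hk', norm_div]
    have h3 : ‖mFourier k t - 1‖ ≤ 2 := by
      refine (norm_sub_le _ _).trans ?_
      have h4 := (mFourier k).norm_coe_le_norm t
      rw [mFourier_norm] at h4
      simp only [norm_one]
      linarith
    rw [← mul_div_assoc, le_div_iff₀ (hne k hk'), mul_comm]
    gcongr
  have hterm : ∀ θ, Summable fun k => b k * mFourier k θ := fun θ =>
    Summable.of_norm (hbsum.of_nonneg_of_le (fun _ => norm_nonneg _) fun k => by
      rw [norm_mul]
      refine mul_le_of_le_one_right (norm_nonneg _) ?_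
      have h4 := (mFourier k).norm_coe_le_norm θ
      rwa [mFourier_norm] at h4)
  refine ⟨fun θ => ∑' k, b k * mFourier k θ, ?_, fun θ => ?_⟩
  · refine continuous_tsum (fun k => by fun_prop) hbsum fun k θ => ?_
    rw [norm_mul]
    refine mul_le_of_le_one_right (norm_nonneg _) ?_
    have h4 := (mFourier k).norm_coe_le_norm θ
    rwa [mFourier_norm] at h4
  · have h1 := hasSum_mFourier_series_apply_of_summable (f := ⟨a, ha⟩) hasum θ
    have h2 := ((hterm (θ + t)).hasSum.sub (hterm θ).hasSum).add
      (hasSum_ite_eq (0 : Fin d → ℤ) (mFourierCoeff a 0))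
    have h3 := h1.unique (h2.congr_fun fun k => ?_)
    · simp only [ContinuousMap.coe_mk] at h3
      rw [h3]
      ring
    · have h5 : mFourier k (θ + t) = mFourier k θ * mFourier k t := by
        simp [mFourier, fourier_apply, AddCircle.toCircle_add, Finset.prod_mul_distrib, smul_add]
      simp only [hb, ContinuousMap.coe_mk, smul_eq_mul]
      split_ifs with hk
      · subst hk
        simp [mFourier_zero]
      · rw [h5]
        have := norm_pos_iff.1 (hne k hk)
        field_simp
        ring

theorem mFourier_mk {d : ℕ} (k : Fin d → ℤ) (x : Fin d → ℝ) :
    mFourier k (fun j => (x j : UnitAddCircle)) =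
      Complex.exp (2 * Real.pi * Complex.I * ((∑ i, x i * k i : ℝ) : ℂ)) := by
  simp only [mFourier, ContinuousMap.coe_mk, fourier_coe_apply]
  rw [← Complex.exp_sum]
  congr 1
  push_cast
  rw [Finset.mul_sum]
  exact Finset.sum_congr rfl fun i _ => by ring

theorem mFourierCoeff_eq_integral {d : ℕ} (a : UnitAddTorus (Fin d) → ℂ) (k : Fin d → ℤ) :
    mFourierCoeff a k = ∫ x in Icc (0 : Fin d → ℝ) 1,
      Complex.exp (fourierPhase k x) * a fun j => (x j : UnitAddCircle) := by
  rw [mFourierCoeff, integral_torus_eq]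
  refine integral_congr_ae (Filter.Eventually.of_forall fun x => ?_)
  simp only [smul_eq_mul]
  rw [mFourier_mk, fourierPhase_apply]
  congr 2
  push_cast
  rw [Finset.mul_sum]
  refine Finset.sum_congr rfl fun i _ => ?_
  simp only [Pi.neg_apply]
  push_cast
  ring

/-- With `y = π(s - round s)` the left side is governed by `2|sin y|`, and Jordan's inequality
applies because `|y| ≤ π/2`. This converts distances to the integers into small divisors. -/
theorem norm_mFourier_sub_one_ge {d : ℕ} (k : Fin d → ℤ) (x : Fin d → ℝ) {ε : ℝ}
    (h : ∀ r : ℤ, ε ≤ |∑ i, x i * k i - (r : ℝ)|) :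
    4 * ε ≤ ‖mFourier k (fun j => (x j : UnitAddCircle)) - 1‖ := by
  set s : ℝ := ∑ i, x i * k i with hs
  set y : ℝ := Real.pi * (s - round s) with hy
  have e1 : mFourier k (fun j => (x j : UnitAddCircle)) = Complex.exp (Complex.I * (2 * y : ℝ)) := by
    rw [mFourier_mk, ← hs, Complex.exp_eq_exp_iff_exists_int]
    refine ⟨round s, ?_⟩
    rw [hy]
    push_cast
    ring
  rw [e1, Complex.norm_exp_I_mul_ofReal_sub_one, mul_div_cancel_left₀ _ two_ne_zero, norm_mul,
    Real.norm_eq_abs, Real.norm_eq_abs, abs_two]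
  have h1 : |y| = Real.pi * |s - round s| := by rw [hy, abs_mul, abs_of_pos Real.pi_pos]
  have h2 := Real.mul_abs_le_abs_sin (x := y) (by
    rw [h1]
    have := abs_sub_round s
    nlinarith [Real.pi_pos])
  rw [h1] at h2
  have h3 : 2 / Real.pi * (Real.pi * |s - round s|) = 2 * |s - round s| := by
    field_simp
  have := h (round s)
  linarith

theorem continuous_torusN {d₁ d₂ : ℕ} (hd : 0 < ((d₁ + d₂ : ℕ) : ℝ)) {q : ℝ → ℝ} {lam : ℝ}
    (hη : 2 < |hillDiscriminant q lam|) :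
    Continuous (torusN d₁ q lam : UnitAddTorus (Fin d₂) → ℝ) := by
  have e : (torusN d₁ q lam : UnitAddTorus (Fin d₂) → ℝ) = fun θ => -sOne q lam *
      greenDiag d₁ (((d₁ + d₂ : ℕ) : ℝ) * hillDiscriminant q lam - torusSymbol θ) := by
    funext θ
    rw [torusN, torusGreen_eq]
  rw [e]
  refine continuous_const.mul ((contDiffOn_greenDiag d₁ (r := 0)).continuousOn.comp_continuous
    (continuous_const.sub continuous_torusSymbol) fun θ => ?_)
  have h1 := abs_torusSymbol_le θ
  have h2 : 2 * ((d₁ + d₂ : ℕ) : ℝ) < |((d₁ + d₂ : ℕ) : ℝ) * hillDiscriminant q lam| := by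
    rw [abs_mul, abs_of_pos hd]; nlinarith
  have h3 := abs_sub_abs_le_abs_sub (((d₁ + d₂ : ℕ) : ℝ) * hillDiscriminant q lam) (torusSymbol θ)
  rw [Fintype.card_fin] at h1
  push_cast at h2 h3 ⊢
  rw [Set.mem_ofPred_eq]
  linarith

theorem mk_add_single {d : ℕ} (x : Fin d → ℝ) (j : Fin d) :
    (fun i => (((x + Pi.single j 1 : Fin d → ℝ) i : ℝ) : UnitAddCircle)) = fun i => (x i : UnitAddCircle) := by
  funext i
  by_cases h : i = j
  · subst h
    simp
  · simp [h]

/-- The conjugation of the Maryland equation at an energy off the unperturbed spectrum. -/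
theorem exists_isConjugation {d₁ d₂ : ℕ} (hd₂ : 1 ≤ d₂) {q : ℝ → ℝ} {lam : ℝ}
    (hη : 2 < |hillDiscriminant q lam|) (g' : ℝ) {ω : Fin d₂ → ℝ} (hω : IsDiophantine ω) :
    ∃ u, IsConjugation (fun θ => torusN d₁ q lam θ / g') u (sigma d₁ d₂ q g' lam)
      (fun j => (ω j : UnitAddCircle)) := by
  have hd : 0 < ((d₁ + d₂ : ℕ) : ℝ) := by exact_mod_cast (by omega : 0 < d₁ + d₂)
  obtain ⟨d, rfl⟩ : ∃ d, d₂ = d + 1 := ⟨d₂ - 1, by omega⟩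
  have hM : Continuous fun θ : UnitAddTorus (Fin (d + 1)) => torusN d₁ q lam θ / g' :=
    (continuous_torusN hd hη).div_const _
  set a : UnitAddTorus (Fin (d + 1)) → ℂ :=
    fun θ => 2 * (Real.arctan (torusN d₁ q lam θ / g') : ℂ) with ha
  have hac : Continuous a := by
    have := Real.continuous_arctan.comp hM
    exact continuous_const.mul (Complex.continuous_ofReal.comp this)
  have hsmooth : ContDiff ℝ ((⊤ : ℕ∞) : WithTop ℕ∞)
      fun x : Fin (d + 1) → ℝ => a fun j => (x j : UnitAddCircle) := by
    simp only [ha, torusN_mk]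
    exact contDiff_const.mul (Complex.ofRealCLM.contDiff.comp
      (Real.contDiff_arctan.comp ((contDiff_symbolN hd hη).div_const _)))
  have hper : IsLatticePeriodic fun x : Fin (d + 1) → ℝ => a fun j => (x j : UnitAddCircle) := by
    intro j x
    simp only
    rw [mk_add_single]
  obtain ⟨C, hC, β, -, hωC⟩ := hω
  obtain ⟨u, hu, huθ⟩ := exists_cohomological hac (fun r => by
      obtain ⟨D, hD⟩ := exists_norm_fourier_integral_le r hsmooth hper
      refine ⟨D, fun k hk => ?_⟩
      rw [mFourierCoeff_eq_integral]
      exact hD k hk)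
    (t := fun j => (ω j : UnitAddCircle)) (C := 4 * C) (β := β) (by positivity) (fun k hk => by
      rw [mul_assoc]
      exact norm_mFourier_sub_one_ge k ω fun r => hωC k hk r)
  refine ⟨u, hM, hu, fun θ => ?_⟩
  -- The constant in the cohomological equation is the mean of `2 arctan(N/g')`, that is, `2σ`.
  have h0 : mFourierCoeff a 0 = 2 * sigma d₁ (d + 1) q g' lam := by
    rw [mFourierCoeff_eq_integral, sigma, torusAverage, ← integral_complex_ofReal, ← integral_const_mul]
    refine integral_congr_ae (Filter.Eventually.of_forall fun x => ?_)
    simp [ha, torusN_mk, fourierPhase_apply]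
  rw [← h0]
  exact huθ θ

end Cohomology

/-! ### Monotonicity and continuity of `σ` -/

/-- By compactness `g - f` attains a positive minimum on the unit cube, so the inequality stays
strict after averaging. -/
theorem torusAverage_lt {n : ℕ} {f g : (Fin n → ℝ) → ℝ} (hf : Continuous f) (hg : Continuous g)
    (h : ∀ x, f x < g x) : torusAverage f < torusAverage g := by
  obtain ⟨x₀, -, hx₀⟩ := (isCompact_Icc (a := (0 : Fin n → ℝ)) (b := 1)).exists_isMinOn
    ⟨0, by simp⟩ (hg.sub hf).continuousOn
  have hfi := hf.continuousOn.integrableOn_compact (μ := volume)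
    (isCompact_Icc (a := (0 : Fin n → ℝ)) (b := 1))
  have hgi := hg.continuousOn.integrableOn_compact (μ := volume)
    (isCompact_Icc (a := (0 : Fin n → ℝ)) (b := 1))
  have h1 := setIntegral_mono_on (μ := volume) (s := Icc (0 : Fin n → ℝ) 1)
    (f := fun _ => g x₀ - f x₀) (g := fun x => g x - f x) (by
      rw [integrableOn_const_iff, volume_Icc_zero_one]; simp) (hgi.sub hfi) measurableSet_Icc
    fun x hx => hx₀ hx
  rw [setIntegral_const, integral_sub hgi hfi, measureReal_def, volume_Icc_zero_one] at h1
  simp only [ENNReal.toReal_one, one_smul] at h1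
  have := h x₀
  unfold torusAverage
  linarith

theorem torusAverage_const {n : ℕ} (c : ℝ) : torusAverage (fun _ : Fin n → ℝ => c) = c := by
  rw [torusAverage, setIntegral_const, measureReal_def, volume_Icc_zero_one]
  simp

section Sigma

variable {d₁ d₂ : ℕ} {q : ℝ → ℝ} {a b : ℝ}

/-- A continuous function without zeros keeps its sign on an interval, and on each half-line
inversion reverses the order. -/
theorem strictMonoOn_inv_of_strictAntiOn {F : ℝ → ℝ} (hF : StrictAntiOn F (Icc a b))
    (hc : ContinuousOn F (Icc a b)) (h0 : ∀ x ∈ Icc a b, F x ≠ 0) :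
    StrictMonoOn (fun x => (F x)⁻¹) (Icc a b) := by
  intro x hx y hy hxy
  have h1 := hF hx hy hxy
  have hsub : Icc x y ⊆ Icc a b := Icc_subset_Icc hx.1 hy.2
  simp only
  rcases (h0 y hy).lt_or_gt with hy0 | hy0
  · have hx0 : F x < 0 := by
      by_contra! hx0
      obtain ⟨z, hz, hz0⟩ := intermediate_value_Icc' hxy.le (hc.mono hsub) ⟨hy0.le, hx0⟩
      exact h0 z (hsub hz) hz0
    exact (inv_lt_inv_of_neg hx0 hy0).2 h1
  · exact (inv_lt_inv₀ (hy0.trans h1) hy0).2 h1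

/-- With `τ = (Δ_{d₁} + Δ_{d₂})/d ∈ [-2, 2]`, `N` is `1/d` times the average of `s/(η - τ)`. Each
integrand is the reciprocal of a decreasing function without zeros. -/
theorem strictMonoOn_symbolN (hd : 0 < ((d₁ + d₂ : ℕ) : ℝ))
    (hq : MemLp q 2 (volume.restrict (Icc (0 : ℝ) 1)))
    (hs : ∀ lam ∈ Icc a b, sOne q lam ≠ 0) (hη : ∀ lam ∈ Icc a b, 2 < |hillDiscriminant q lam|)
    (x : Fin d₂ → ℝ) : StrictMonoOn (symbolN d₁ q x) (Icc a b) := by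
  intro l hl l' hl' hll
  set τ : (Fin d₁ → ℝ) → ℝ := fun y => (latticeSymbol y + latticeSymbol x) / ((d₁ + d₂ : ℕ) : ℝ)
    with hτ
  have hτ2 : ∀ y, |τ y| ≤ 2 := by
    intro y
    have h1 := abs_latticeSymbol_le x
    have h2 := abs_latticeSymbol_le y
    have h3 := abs_add_le (latticeSymbol y) (latticeSymbol x)
    rw [hτ, abs_div, abs_of_pos hd, div_le_iff₀ hd]
    push_cast
    linarith
  have hne : ∀ y, ∀ l ∈ Icc a b, hillDiscriminant q l - τ y ≠ 0 := by
    intro y l hl h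
    have := hη l hl
    rw [sub_eq_zero.1 h] at this
    exact absurd (hτ2 y) (not_le.2 this)
  have hmono : ∀ y, StrictMonoOn (fun l => ((hillDiscriminant q l - τ y) / sOne q l)⁻¹)
      (Icc a b) := fun y =>
    strictMonoOn_inv_of_strictAntiOn (strictAntiOn_hillDiscriminant_sub_div hq (hτ2 y) hs)
      (((continuous_hillDiscriminant hq).sub continuous_const).continuousOn.div
        (continuous_sOne hq).continuousOn hs)
      fun l hl => div_ne_zero (hne y l hl) (hs l hl)
  have e : ∀ l ∈ Icc a b, symbolN d₁ q x l = (((d₁ + d₂ : ℕ) : ℝ))⁻¹ *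
      torusAverage fun y : Fin d₁ → ℝ => ((hillDiscriminant q l - τ y) / sOne q l)⁻¹ := by
    intro l hl
    rw [symbolN, greenDiag, torusAverage, torusAverage, ← integral_const_mul,
      ← integral_const_mul]
    refine integral_congr_ae (Filter.Eventually.of_forall fun y => ?_)
    have h1 : latticeSymbol y - (((d₁ + d₂ : ℕ) : ℝ) * hillDiscriminant q l - latticeSymbol x) =
        -(((d₁ + d₂ : ℕ) : ℝ) * (hillDiscriminant q l - τ y)) := by
      rw [hτ]
      field_simp
      ring
    simp only
    rw [h1, inv_div, inv_neg, mul_inv, div_eq_mul_inv]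
    ring
  have hcont : ∀ l ∈ Icc a b, Continuous fun y : Fin d₁ → ℝ =>
      ((hillDiscriminant q l - τ y) / sOne q l)⁻¹ := fun l hl =>
    ((continuous_const.sub
      (((contDiff_latticeSymbol d₁ (r := 0)).continuous.add continuous_const).div_const _)).div_const
        _).inv₀ fun y => div_ne_zero (hne y l hl) (hs l hl)
  rw [e l hl, e l' hl']
  exact mul_lt_mul_of_pos_left
    (torusAverage_lt (hcont l hl) (hcont l' hl') fun y => hmono y hl hl' hll) (inv_pos.2 hd)

theorem continuous_arctan_symbolN (hd : 0 < ((d₁ + d₂ : ℕ) : ℝ)) {lam : ℝ}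
    (hη : 2 < |hillDiscriminant q lam|) (g' : ℝ) :
    Continuous fun x : Fin d₂ → ℝ => Real.arctan (symbolN d₁ q x lam / g') :=
  Real.continuous_arctan.comp ((contDiff_symbolN hd hη (r := 0)).continuous.div_const _)

theorem strictMonoOn_sigma (hd : 0 < ((d₁ + d₂ : ℕ) : ℝ))
    (hq : MemLp q 2 (volume.restrict (Icc (0 : ℝ) 1)))
    (hs : ∀ lam ∈ Icc a b, sOne q lam ≠ 0) (hη : ∀ lam ∈ Icc a b, 2 < |hillDiscriminant q lam|)
    {g' : ℝ} (hg : 0 < g') : StrictMonoOn (sigma d₁ d₂ q g') (Icc a b) := by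
  intro l hl l' hl' hll
  refine torusAverage_lt (continuous_arctan_symbolN hd (hη l hl) g')
    (continuous_arctan_symbolN hd (hη l' hl') g') fun x => Real.arctan_strictMono ?_
  exact div_lt_div_of_pos_right (strictMonoOn_symbolN hd hq hs hη x hl hl' hll) hg

theorem continuousOn_sigma (hd : 0 < ((d₁ + d₂ : ℕ) : ℝ))
    (hq : MemLp q 2 (volume.restrict (Icc (0 : ℝ) 1)))
    (hη : ∀ lam ∈ Icc a b, 2 < |hillDiscriminant q lam|) (g' : ℝ) :
    ContinuousOn (sigma d₁ d₂ q g') (Icc a b) := by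
  rw [continuousOn_iff_continuous_domRestrict]
  refine continuous_parametric_integral_of_continuous (μ := volume)
    (f := fun (l : Icc a b) (x : Fin d₂ → ℝ) => Real.arctan (symbolN d₁ q x l / g')) ?_ isCompact_Icc
  refine Real.continuous_arctan.comp (Continuous.div_const ?_ _)
  have h1 := (continuous_sOne hq).comp (continuous_subtype_val (p := (· ∈ Icc a b)))
  have h2 := (continuous_hillDiscriminant hq).comp (continuous_subtype_val (p := (· ∈ Icc a b)))
  refine (h1.comp continuous_fst).neg.mul
    ((contDiffOn_greenDiag d₁ (r := 0)).continuousOn.comp_continuous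
      (((h2.comp continuous_fst).const_mul _).sub
        ((contDiff_latticeSymbol d₂ (r := 0)).continuous.comp continuous_snd)) fun p => ?_)
  have h1 := abs_latticeSymbol_le p.2
  have h2 : 2 * ((d₁ + d₂ : ℕ) : ℝ) < |((d₁ + d₂ : ℕ) : ℝ) * hillDiscriminant q p.1| := by
    rw [abs_mul, abs_of_pos hd]
    have := hη p.1 p.1.2
    nlinarith
  have h3 := abs_sub_abs_le_abs_sub (((d₁ + d₂ : ℕ) : ℝ) * hillDiscriminant q p.1)
    (latticeSymbol p.2)
  push_cast at h2 h3
  rw [Set.mem_ofPred_eq]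
  push_cast
  linarith

/-- The values of `σ` lie in an open interval of length `π`, which makes the solution of a condition
mod `π` unique. -/
theorem abs_sigma_lt (hd : 0 < ((d₁ + d₂ : ℕ) : ℝ)) {lam : ℝ}
    (hη : 2 < |hillDiscriminant q lam|) (g' : ℝ) : |sigma d₁ d₂ q g' lam| < Real.pi / 2 := by
  have hc := continuous_arctan_symbolN (d₂ := d₂) hd hη g'
  rw [abs_lt]
  constructor
  · rw [← torusAverage_const (n := d₂) (-(Real.pi / 2))]
    exact torusAverage_lt continuous_const hc fun x => Real.neg_pi_div_two_lt_arctan _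
  · rw [← torusAverage_const (n := d₂) (Real.pi / 2)]
    exact torusAverage_lt hc continuous_const fun x => Real.arctan_lt_pi_div_two _

end Sigma

/-! ### The quantization conditions -/

section Quantization

variable {d₁ d₂ : ℕ} {q : ℝ → ℝ} {g φ lam : ℝ} {ω : Fin d₂ → ℝ}

/-- Doubling the angle turns the congruence mod `π` into an equality of phases, the form in which
the conjugated equation produces it. -/
theorem solvesQuantization_iff (m : Fin d₂ → ℤ) : SolvesQuantization d₁ q g ω φ m lam ↔
    Complex.exp (2 * Complex.I * dualPhase g ω φ m) =
      Complex.exp (2 * Complex.I * sigma d₁ d₂ q (1 / |g|) lam) := by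
  rw [eq_comm, Complex.exp_eq_exp_iff_exists_int]
  refine exists_congr fun k => ?_
  have h2 : (2 * Complex.I : ℂ) ≠ 0 := by simp
  have e : (2 * Complex.I * dualPhase g ω φ m + k * (2 * Real.pi * Complex.I) : ℂ) =
      2 * Complex.I * ((dualPhase g ω φ m + k * Real.pi : ℝ) : ℂ) := by
    push_cast
    ring
  rw [e, mul_right_inj' h2, Complex.ofReal_inj, dualPhase]

theorem real_sign_cases (hg : g ≠ 0) : Real.sign g = 1 ∨ Real.sign g = -1 := by
  rcases hg.lt_or_gt with h | h
  · exact Or.inr (Real.sign_of_neg h)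
  · exact Or.inl (Real.sign_of_pos h)

theorem IsDiophantine.sum_ne_int (hω : IsDiophantine ω) {m : Fin d₂ → ℤ} (hm : m ≠ 0) (r : ℤ) :
    ∑ i, ω i * (m i : ℝ) ≠ r := by
  obtain ⟨C, hC, β, -, h⟩ := hω
  intro he
  have h1 := h m hm r
  rw [he, sub_self, abs_zero] at h1
  exact absurd h1 (not_le.2 (mul_pos hC (Real.rpow_pos_of_pos (norm_pos_iff.2 hm) _)))

theorem IsDiophantine.sign_mul (hω : IsDiophantine ω) (hg : g ≠ 0) :
    IsDiophantine fun i => Real.sign g * ω i := by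
  obtain ⟨C, hC, β, hβ, h⟩ := hω
  refine ⟨C, hC, β, hβ, fun m hm r => ?_⟩
  rcases real_sign_cases hg with h1 | h1
  · simpa [h1] using h m hm r
  · have h2 := h m hm (-r)
    rw [← abs_neg] at h2
    convert h2 using 2
    simp [h1]
    ring

theorem exp_dualPhase (m : Fin d₂ → ℤ) : Complex.exp (2 * Complex.I * dualPhase g ω φ m) =
    Complex.exp (2 * Real.pi * Complex.I * ((Real.sign g * φ + 1 / 2 : ℝ) : ℂ)) *
      UnitAddTorus.mFourier m (fun j => ((Real.sign g * ω j : ℝ) : UnitAddCircle)) := by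
  rw [mFourier_mk, ← Complex.exp_add]
  congr 1
  rw [dualPhase]
  push_cast
  ring

/-- A coincidence of phases would make `ω'·(m - m')` an integer, which the Diophantine condition
forbids for `m ≠ m'`. -/
theorem exp_dualPhase_injective (hω : IsDiophantine ω) (hg : g ≠ 0) (m m' : Fin d₂ → ℤ)
    (h : Complex.exp (2 * Complex.I * dualPhase g ω φ m) =
      Complex.exp (2 * Complex.I * dualPhase g ω φ m')) : m = m' := by
  by_contra hne
  rw [Complex.exp_eq_exp_iff_exists_int] at h
  obtain ⟨k, hk⟩ := h
  have h2 : (2 * Complex.I : ℂ) ≠ 0 := by simp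
  have e : (2 * Complex.I * dualPhase g ω φ m' + k * (2 * Real.pi * Complex.I) : ℂ) =
      2 * Complex.I * ((dualPhase g ω φ m' + k * Real.pi : ℝ) : ℂ) := by
    push_cast
    ring
  rw [e, mul_right_inj' h2, Complex.ofReal_inj, dualPhase, dualPhase] at hk
  apply (hω.sign_mul hg).sum_ne_int (sub_ne_zero.2 hne) k
  simp only [Pi.sub_apply, Int.cast_sub, mul_sub, Finset.sum_sub_distrib]
  apply mul_left_cancel₀ Real.pi_ne_zero
  linarith

theorem IsDiophantine.irrational (hω : IsDiophantine ω) (i : Fin d₂) : Irrational (ω i) := by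
  rw [irrational_iff_ne_rational]
  intro p r hr h
  apply hω.sum_ne_int (m := Pi.single i r) (by simpa using hr) p
  rw [Finset.sum_eq_single i]
  · have hr' : (r : ℝ) ≠ 0 := by exact_mod_cast hr
    rw [Pi.single_eq_same, h, div_mul_cancel₀ _ hr']
  · intro j _ hj
    simp [hj]
  · simp

/-- The values admitted by the quantization conditions are dense. -/
theorem exists_dualPhase_mem_Ioo (hd₂ : 1 ≤ d₂) (hω : IsDiophantine ω) (hg : g ≠ 0) {s t : ℝ}
    (hst : s < t) : ∃ (m : Fin d₂ → ℤ) (k : ℤ), dualPhase g ω φ m + k * Real.pi ∈ Ioo s t := by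
  -- Already one irrational coordinate of the frequency generates, together with `1`, a dense
  -- subgroup of the line.
  set i : Fin d₂ := ⟨0, by omega⟩
  have hd : Dense (AddSubgroup.closure {Real.sign g * ω i, 1} : Set ℝ) := by
    rw [dense_addSubgroupClosure_pair_iff, div_one]
    exact (hω.sign_mul hg).irrational i
  set c : ℝ := Real.sign g * φ + 1 / 2
  have hpi := Real.pi_pos
  obtain ⟨y, hy, hyc⟩ := hd.exists_between (sub_lt_sub_right (div_lt_div_of_pos_right hst hpi) c)
  rw [SetLike.mem_coe, AddSubgroup.mem_closure_pair] at hy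
  obtain ⟨n, k, hnk⟩ := hy
  have e : dualPhase g ω φ (Pi.single i n) + k * Real.pi = Real.pi * (y + c) := by
    rw [dualPhase, Finset.sum_eq_single i, ← hnk]
    · simp only [Pi.single_eq_same, zsmul_eq_mul]
      ring
    · intro j _ hj
      simp [hj]
    · simp
  refine ⟨Pi.single i n, k, ?_⟩
  rw [e]
  have h1 : s / Real.pi < y + c := by linarith [hyc.1]
  have h2 : y + c < t / Real.pi := by linarith [hyc.2]
  rw [div_lt_iff₀' hpi] at h1
  rw [lt_div_iff₀' hpi] at h2
  exact ⟨h1, h2⟩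

/-- Every interval contains a solution of a quantization condition. -/
theorem exists_solvesQuantization (hd₂ : 1 ≤ d₂) (hω : IsDiophantine ω) (hg : g ≠ 0) {s t : ℝ}
    (hst : s < t) (hσ : StrictMonoOn (sigma d₁ d₂ q (1 / |g|)) (Icc s t))
    (hc : ContinuousOn (sigma d₁ d₂ q (1 / |g|)) (Icc s t)) :
    ∃ lam ∈ Ioo s t, ∃ m, SolvesQuantization d₁ q g ω φ m lam := by
  obtain ⟨m, k, hmk⟩ := exists_dualPhase_mem_Ioo (φ := φ) hd₂ hω hg
    (hσ (left_mem_Icc.2 hst.le) (right_mem_Icc.2 hst.le) hst)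
  obtain ⟨lam, hlam, he⟩ := intermediate_value_Ioo hst.le hc hmk
  exact ⟨lam, hlam, m, k, he⟩

theorem subset_closure_of_exists_mem_Ioo {S : Set ℝ} {a b : ℝ} (hab : a < b)
    (h : ∀ s t, a ≤ s → s < t → t ≤ b → ∃ x ∈ Ioo s t, x ∈ S) : Icc a b ⊆ closure S := by
  rw [← closure_Ioo hab.ne]
  refine closure_minimal (fun x hx => ?_) isClosed_closure
  rw [Metric.mem_closure_iff]
  intro ε hε
  obtain ⟨y, hy, hyS⟩ := h x (min b (x + ε)) hx.1.le (lt_min hx.2 (by linarith)) (min_le_left _ _)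
  refine ⟨y, hyS, ?_⟩
  have h1 := hy.2.trans_le (min_le_right _ _)
  rw [dist_comm, Real.dist_eq, abs_of_pos (by linarith [hy.1])]
  linarith

/-- Each quantization condition has at most one solution. -/
theorem SolvesQuantization.unique {m : Fin d₂ → ℤ} {S : Set ℝ}
    (hσ : StrictMonoOn (sigma d₁ d₂ q (1 / |g|)) S)
    (hb : ∀ l ∈ S, |sigma d₁ d₂ q (1 / |g|) l| < Real.pi / 2) {l l' : ℝ} (hl : l ∈ S) (hl' : l' ∈ S)
    (h : SolvesQuantization d₁ q g ω φ m l) (h' : SolvesQuantization d₁ q g ω φ m l') : l = l' := by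
  obtain ⟨k, hk⟩ := h
  obtain ⟨k', hk'⟩ := h'
  have h1 := abs_lt.1 (hb l hl)
  have h2 := abs_lt.1 (hb l' hl')
  -- Two values of `σ` differ by less than `π`, so the integers in the two conditions coincide.
  have h3 : |((k - k' : ℤ) : ℝ)| < 1 := by
    have e : sigma d₁ d₂ q (1 / |g|) l - sigma d₁ d₂ q (1 / |g|) l' =
        ((k - k' : ℤ) : ℝ) * Real.pi := by
      rw [hk, hk']
      push_cast
      ring
    have h4 : |((k - k' : ℤ) : ℝ) * Real.pi| < 1 * Real.pi := by
      rw [← e, abs_lt]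
      constructor <;> linarith
    rw [abs_mul, abs_of_pos Real.pi_pos] at h4
    exact lt_of_mul_lt_mul_right h4 Real.pi_pos.le
  have h4 : k - k' = 0 := Int.abs_lt_one_iff.1 (by exact_mod_cast h3)
  refine hσ.injOn hl hl' ?_
  rw [hk, hk', sub_eq_zero.1 h4]

end Quantization

/-! ### Eigenvalues of the Maryland operator -/

section Eigenvalues

attribute [local instance] instMeasureSpaceUnitAddCircle instIsAddHaarMeasureUnitAddCircleVolume
  instIsProbabilityMeasureUnitAddCircleVolume

open UnitAddTorus

variable {d₁ d₂ : ℕ} {q : ℝ → ℝ} {g φ lam : ℝ} {ω : Fin d₂ → ℝ}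

theorem mem_opEigenspace_schrodinger {α : Vertex d₁ d₂ → ℝ} {z : ℂ} {f : StateSpace d₁ d₂} :
    f ∈ opEigenspace (schrodinger q α) z ↔ (f, z • f) ∈ opGraph q α := by
  rw [← schrodinger_graph, LinearPMap.mem_graph_iff, opEigenspace, Submodule.mem_map]
  refine exists_congr fun y => ?_
  rw [LinearMap.mem_ker, LinearMap.sub_apply, LinearMap.smul_apply, sub_eq_zero]
  constructor
  · rintro ⟨h1, h2⟩
    have h2' : (y : StateSpace d₁ d₂) = f := h2
    exact ⟨h2', by rw [← h2']; exact h1⟩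
  · rintro ⟨h1, h2⟩
    have h1' : (y : StateSpace d₁ d₂) = f := h1
    refine ⟨?_, h1⟩
    rw [Submodule.subtype_apply, h1']
    exact h2

theorem edgeComponent_const_mul (c : ℂ) (ξ : Vertex d₁ d₂ → ℂ) (e : Edge d₁ d₂) :
    edgeComponent q lam (fun m => c * ξ m) e = c • edgeComponent q lam ξ e := by
  simp only [edgeComponent, smul_add, smul_smul]
  congr 2
  ring

theorem vertexValue_eq_zero (hq : MemLp q 2 (volume.restrict (Icc (0 : ℝ) 1)))
    {ξ : Vertex d₁ d₂ → ℂ} {e : Edge d₁ d₂} (h : edgeComponent q lam ξ e = 0) : ξ e.1 = 0 := by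
  obtain ⟨K, -, hK⟩ := exists_norm_le_edgeComb hq lam
  have h1 := (hK (ξ e.1) ((ξ (e.1 + basisVec e.2) - (edgeSolution q lam 1 0).1 1 * ξ e.1) /
    sOne q lam)).1
  rw [edgeComponent] at h
  rw [h, norm_zero, mul_zero] at h1
  exact norm_le_zero_iff.1 h1

theorem latticeResolvent_congr_const_mul {μ : ℝ} (hμ : 2 * ((d₁ + d₂ : ℕ) : ℝ) < |μ|)
    {f f₀ : UnitAddTorus (Fin d₂) → ℂ} (hf : MemLp f 2) (hf₀ : MemLp f₀ 2) {c : ℂ}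
    (h : f =ᵐ[volume] fun θ => c * f₀ θ) :
    (latticeResolvent μ f : Vertex d₁ d₂ → ℂ) = fun m => c * latticeResolvent μ f₀ m := by
  refine (eq_latticeResolvent hμ hf ((latticeResolvent_memlp hμ hf₀).const_mul c) fun m => ?_).symm
  have h1 := latticeResolvent_equation hμ hf₀ m
  have e : neighborSum (fun m => c * latticeResolvent μ f₀ m) m =
      c * neighborSum (latticeResolvent μ f₀) m := by
    simp only [neighborSum, Finset.mul_sum, mul_add]
  rw [e, mFourierCoeff_congr h, mFourierCoeff_const_mul, mul_left_comm, ← mul_sub, h1]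
  split_ifs <;> simp

theorem latticeResolvent_eq_zero {μ : ℝ} (hμ : 2 * ((d₁ + d₂ : ℕ) : ℝ) < |μ|)
    {f : UnitAddTorus (Fin d₂) → ℂ} (hf : MemLp f 2) (h : f =ᵐ[volume] 0) (m : Vertex d₁ d₂) :
    latticeResolvent μ f m = 0 := by
  have h1 := latticeResolvent_congr_const_mul hμ (c := 0) hf hf (h.trans (by simp only [zero_mul]; rfl))
  rw [h1]
  simp

/-- An eigenvalue solves one of the quantization conditions. -/
theorem exists_solvesQuantization_of_eigenvalue (hd₁ : 1 ≤ d₁) (hd₂ : 1 ≤ d₂)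
    (hq : MemLp q 2 (volume.restrict (Icc (0 : ℝ) 1))) (hg : g ≠ 0) (hω : IsDiophantine ω)
    (hφ : ∀ (m : Fin d₂ → ℤ) (k : ℤ), φ ≠ ∑ i, ω i * (m i : ℝ) + (k : ℝ) / 2)
    (hs : sOne q lam ≠ 0) (hη : 2 < |hillDiscriminant q lam|)
    (h : lam ∈ realEigenvalues (schrodinger q (marylandCoupling (d₁ := d₁) g ω φ))) :
    ∃ m, SolvesQuantization d₁ q g ω φ m lam := by
  have hd : 0 < ((d₁ + d₂ : ℕ) : ℝ) := by exact_mod_cast (by omega : 0 < d₁ + d₂)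
  have hμ : 2 * ((d₁ + d₂ : ℕ) : ℝ) < |((d₁ + d₂ : ℕ) : ℝ) * hillDiscriminant q lam| := by
    rw [abs_mul, abs_of_pos hd]; nlinarith
  by_contra! hno
  apply h
  rw [eq_bot_iff]
  intro f hf
  obtain ⟨ξ, hξ, hdiff, hfe⟩ := exists_vertexValues hq hd₁ hs (mem_opEigenspace_schrodinger.1 hf)
  obtain ⟨F, hF, hξF⟩ := exists_marylandSolution hd hs hη hg hφ hξ hdiff
  obtain ⟨u, hu⟩ := exists_isConjugation hd₂ hη (1 / |g|) (hω.sign_mul hg)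
  have hF0 := hu.ae_eq_zero exp_dualPhase hF fun m hm => hno m ((solvesQuantization_iff m).2 hm)
  have hξ0 : ∀ m, ξ m = 0 := fun m => by
    rw [hξF, latticeResolvent_eq_zero hμ hF.memLp hF0, mul_zero]
  rw [Submodule.mem_bot]
  ext1
  funext e
  rw [hfe]
  simp [edgeComponent, hξ0]

/-- A solution of a quantization condition is a simple eigenvalue. -/
theorem finrank_opEigenspace_eq_one (hd₁ : 1 ≤ d₁) (hd₂ : 1 ≤ d₂)
    (hq : MemLp q 2 (volume.restrict (Icc (0 : ℝ) 1))) (hg : g ≠ 0) (hω : IsDiophantine ω)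
    (hφ : ∀ (m : Fin d₂ → ℤ) (k : ℤ), φ ≠ ∑ i, ω i * (m i : ℝ) + (k : ℝ) / 2)
    (hs : sOne q lam ≠ 0) (hη : 2 < |hillDiscriminant q lam|) {m : Fin d₂ → ℤ}
    (h : SolvesQuantization d₁ q g ω φ m lam) :
    Module.finrank ℂ
      (opEigenspace (schrodinger q (marylandCoupling (d₁ := d₁) g ω φ)) (lam : ℂ)) = 1 := by
  have hd : 0 < ((d₁ + d₂ : ℕ) : ℝ) := by exact_mod_cast (by omega : 0 < d₁ + d₂)
  have hμ : 2 * ((d₁ + d₂ : ℕ) : ℝ) < |((d₁ + d₂ : ℕ) : ℝ) * hillDiscriminant q lam| := by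
    rw [abs_mul, abs_of_pos hd]; nlinarith
  obtain ⟨u, hu⟩ := exists_isConjugation hd₂ hη (1 / |g|) (hω.sign_mul hg)
  obtain ⟨F₀, hF₀, hF₀0, huniq⟩ := hu.exists_solution exp_dualPhase
    (exp_dualPhase_injective hω hg) ((solvesQuantization_iff m).1 h)
  obtain ⟨ξ₀, hξ₀, hdiff, hξF₀, hcoeff⟩ := solvesDifference_of_marylandSolution hd hη hg hφ hF₀
  obtain ⟨f₀, hf₀, hf₀e⟩ := exists_eigenvector hq hs hξ₀ hdiff
  rw [finrank_eq_one_iff']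
  -- A vanishing eigenfunction would have vanishing vertex values; the Fourier coefficients of `F₀`
  -- are `α` times the surface values, so `F₀` would vanish as well.
  refine ⟨⟨f₀, mem_opEigenspace_schrodinger.2 hf₀⟩, fun h0 => hF₀0 ?_, fun w => ?_⟩
  · have h0' : f₀ = 0 := congrArg Subtype.val h0
    refine ae_eq_zero_of_mFourierCoeff hF₀.memLp fun n => ?_
    have h1 : edgeComponent q lam ξ₀ ((0, n), Sum.inl ⟨0, hd₁⟩) = 0 := by
      rw [← hf₀e, h0']
      rfl
    rw [hcoeff, vertexValue_eq_zero hq h1, mul_zero]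
  · obtain ⟨f, hf⟩ := w
    obtain ⟨ξ, hξ, hdiff', hfe⟩ := exists_vertexValues hq hd₁ hs (mem_opEigenspace_schrodinger.1 hf)
    obtain ⟨F, hF, hξF⟩ := exists_marylandSolution hd hs hη hg hφ hξ hdiff'
    obtain ⟨c, hc⟩ := huniq F hF
    refine ⟨c, Subtype.ext ?_⟩
    have e : ξ = fun m => c * ξ₀ m := by
      funext m
      rw [hξF, latticeResolvent_congr_const_mul hμ hF.memLp hF₀.memLp hc, hξF₀]
      ring
    change c • f₀ = f
    ext1
    funext e'
    rw [hfe, e, edgeComponent_const_mul, ← hf₀e]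
    rfl

end Eigenvalues

end MarylandGraph

end

/-! ### Proof of the theorem -/

theorem mainTheorem2 (d₁ d₂ : ℕ) (hd₁ : 1 ≤ d₁) (hd₂ : 1 ≤ d₂)
    (q : ℝ → ℝ) (hq : MeasureTheory.MemLp q 2 (MeasureTheory.volume.restrict (Set.Icc (0 : ℝ) 1)))
    (g : ℝ) (hg : g ≠ 0) (ω : Fin d₂ → ℝ) (hω : IsDiophantine ω)
    (φ : ℝ) (hφ : ∀ (m : Fin d₂ → ℤ) (k : ℤ), φ ≠ ∑ i, ω i * (m i : ℝ) + (k : ℝ) / 2)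
    (a b : ℝ) (hab : a < b)
    (hspec : ∀ lam ∈ Set.Icc a b,
      (lam : ℂ) ∉ opSpectrum (schrodinger q (fun _ : Vertex d₁ d₂ => 0))) :
    -- `σ` is strictly increasing on `[a, b]`
    StrictMonoOn (sigma d₁ d₂ q (1 / |g|)) (Set.Icc a b) ∧
    -- the eigenvalues of `H` in `[a, b]` are dense in `[a, b]`
    Set.Icc a b ⊆ closure (realEigenvalues (schrodinger q (marylandCoupling (d₁ := d₁) g ω φ)) ∩ Set.Icc a b) ∧
    -- they are exactly the solutions of the quantization conditions
    realEigenvalues (schrodinger q (marylandCoupling (d₁ := d₁) g ω φ)) ∩ Set.Icc a b =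
      {lam | lam ∈ Set.Icc a b ∧ ∃ m : Fin d₂ → ℤ, SolvesQuantization d₁ q g ω φ m lam} ∧
    -- they are simple
    (∀ lam ∈ realEigenvalues (schrodinger q (marylandCoupling (d₁ := d₁) g ω φ)) ∩ Set.Icc a b,
      Module.finrank ℂ (opEigenspace (schrodinger q (marylandCoupling (d₁ := d₁) g ω φ)) (lam : ℂ)) = 1) ∧
    -- every `m` gives at most one solution
    (∀ m : Fin d₂ → ℤ, ∀ lam ∈ Set.Icc a b, ∀ lam' ∈ Set.Icc a b,
      SolvesQuantization d₁ q g ω φ m lam → SolvesQuantization d₁ q g ω φ m lam' →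
        lam = lam') ∧
    -- distinct `m` give distinct solutions
    (∀ m m' : Fin d₂ → ℤ, ∀ lam ∈ Set.Icc a b, ∀ lam' ∈ Set.Icc a b,
      SolvesQuantization d₁ q g ω φ m lam → SolvesQuantization d₁ q g ω φ m' lam' →
        m ≠ m' → lam ≠ lam') := by
  have hd : 0 < ((d₁ + d₂ : ℕ) : ℝ) := by exact_mod_cast (by omega : 0 < d₁ + d₂)
  have hs : ∀ lam ∈ Set.Icc a b, sOne q lam ≠ 0 := fun lam hl =>
    sOne_ne_zero_of_notMem_opSpectrum hq hd₁ hd₂ (hspec lam hl)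
  have hη : ∀ lam ∈ Set.Icc a b, 2 < |hillDiscriminant q lam| := fun lam hl =>
    two_lt_abs_hillDiscriminant hq hd₁ (hs lam hl) (hspec lam hl)
  have hmono : StrictMonoOn (sigma d₁ d₂ q (1 / |g|)) (Set.Icc a b) :=
    strictMonoOn_sigma hd hq hs hη (one_div_pos.2 (abs_pos.2 hg))
  have heig : realEigenvalues (schrodinger q (marylandCoupling (d₁ := d₁) g ω φ)) ∩ Set.Icc a b =
      {lam | lam ∈ Set.Icc a b ∧ ∃ m : Fin d₂ → ℤ, SolvesQuantization d₁ q g ω φ m lam} := by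
    ext lam
    constructor
    · rintro ⟨h, hl⟩
      exact ⟨hl, exists_solvesQuantization_of_eigenvalue hd₁ hd₂ hq hg hω hφ (hs lam hl)
        (hη lam hl) h⟩
    · rintro ⟨hl, m, h⟩
      -- That the energy is an eigenvalue follows from the dimension count: a trivial eigenspace
      -- cannot have dimension one.
      refine ⟨fun h0 => ?_, hl⟩
      have h1 := finrank_opEigenspace_eq_one hd₁ hd₂ hq hg hω hφ (hs lam hl) (hη lam hl) h
      rw [h0, finrank_bot] at h1
      exact zero_ne_one h1
  refine ⟨hmono, ?_, heig, ?_, ?_, ?_⟩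
  · rw [heig]
    refine subset_closure_of_exists_mem_Ioo hab fun s t hs' hst ht => ?_
    have hsub := Set.Icc_subset_Icc hs' ht
    obtain ⟨lam, hl, hm⟩ := exists_solvesQuantization hd₂ hω hg hst (hmono.mono hsub)
      ((continuousOn_sigma hd hq hη _).mono hsub)
    exact ⟨lam, hl, hsub (Set.Ioo_subset_Icc_self hl), hm⟩
  · intro lam h
    rw [heig] at h
    obtain ⟨hl, m, hm⟩ := h
    exact finrank_opEigenspace_eq_one hd₁ hd₂ hq hg hω hφ (hs lam hl) (hη lam hl) hm
  · intro m lam hl lam' hl' h h'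
    exact SolvesQuantization.unique hmono (fun l hl => abs_sigma_lt hd (hη l hl) _) hl hl' h h'
  · rintro m m' lam hl lam' hl' h h' hmm rfl
    exact hmm (exp_dualPhase_injective hω hg m m' (((solvesQuantization_iff m).1 h).trans
      ((solvesQuantization_iff m').1 h').symm))
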